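/- Let $n\ge 1$, write $z=(z',z_n)\in\mathbb{C}^{n-1}\times\mathbb{C}$ and $y=\operatorname{Im} z$, and let \[ T_B=\{z\in\mathbb{C}^n:\ |y'|^2<y_n\},\qquad \rho(z)=y_n-|y'|^2,\qquad \rho(z,w)=\tfrac14\Big(\sum_{j=1}^{n-1}(z_j-\overline{w_j})^2-2i(z_n-\overline{w_n})\Big). \] Let $\alpha>-1$, let $V$ be Lebesgue measure on $T_B$, $dV_\alpha=\rho^\alpha\,dV$, $\mathbf i=(0',i)$, and let \[ K_\alpha(z,w)=\frac{\Gamma(n+1+\alpha)}{2^{n+1}\pi^n\,\Gamma(\alpha+1)\,\rho(z,w)^{n+1+\alpha}} \] (principal power; $\operatorname{Re}\rho(z,w)>0$ on $T_B\times T_B$) be the weighted Bergman kernel. For functions $f$ on $T_B$ put \[ \widetilde P_\alpha f(z)=\int_{T_B}\big(K_\alpha(z,w)-K_\alpha(\mathbf i,w)\big)f(w)\,dV_\alpha(w),\qquad z\in T_B . \] For $f$ holomorphic on $T_B$ let $|\widetilde\nabla f|\ge 0$ be given by \[ |\widetilde\nabla f(z)|^2=4\rho(z)\Big(2\rho(z)\Big|\frac{\partial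 f}{\partial z_n}(z)\Big|^2+\sum_{j=1}^{n-1}\Big|\frac{\partial f}{\partial z_j}(z)+2y_j\frac{\partial f}{\partial z_n}(z)\Big|^2\Big), \] let $\|f\|_{\mathcal B}=\sup_{z\in T_B}|\widetilde\nabla f(z)|$, let $\mathcal B$ be the space of holomorphic $f$ on $T_B$ with $\|f\|_{\mathcal B}<\infty$, and let $\widetilde{\mathcal B}=\{f\in\mathcal B: f(\mathbf i)=0\}$. Theorem C. $\widetilde P_\alpha$ is a bounded projection from $L^\infty(T_B)$ onto $\widetilde{\mathcal B}$. That is: for every $f\in L^\infty(T_B)$ and $z\in T_B$ the integral defining $\widetilde P_\alpha f(z)$ converges absolutely; $\widetilde P_\alpha$ is linear on $L^\infty(T_B)$ and maps it into $\widetilde{\mathcal B}$; there is a constant $C$ depending only on $n$ and $\alpha$ such that $\|\widetilde P_\alpha f\|_{\mathcal B}\le C\|f\|_\infty$ for all $f\in L^\infty(T_B)$; every $g\in\widetilde{\mathcal B}$ equals $\widetilde P_\alpha f$ for some $f\in L^\infty(T_B)$; and for every $g\in\widetilde{\mathcal B}$ the integral defining $\widetilde P_\alpha g(z)$ converges absolutely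 for all $z\in T_B$ and $\widetilde P_\alpha g=g$ on $T_B$. -/

import Mathlib

open MeasureTheory
open scoped ENNReal

noncomputable section

/-- `ℂⁿ` with `n = m + 1`, written as pairs `z = (z', z_n)` with `z' ∈ ℂⁿ⁻¹ = ℂᵐ`, `z_n ∈ ℂ`;
its `volume` is Lebesgue measure. -/
abbrev CSpace (m : ℕ) : Type := (Fin m → ℂ) × ℂ

/-- `ρ(z) = y_n - |y'|²`, where `y = Im z`. -/
def tubeRho {m : ℕ} (z : CSpace m) : ℝ := z.2.im - ∑ j, (z.1 j).im ^ 2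

/-- The tubular domain `T_B = {x + i y : x ∈ ℝⁿ, |y'|² < y_n}`. -/
def tubeDomain (m : ℕ) : Set (CSpace m) := {z | ∑ j, (z.1 j).im ^ 2 < z.2.im}

/-- The base point `𝐢 = (0', i)`. -/
def tubeBase (m : ℕ) : CSpace m := (0, Complex.I)

/-- `ρ(z,w) = ((z' - w̄')² - 2i (z_n - w̄_n)) / 4`, where `u² = u · u = ∑ u_j²` (no conjugation).
On `T_B × T_B` its real part is positive. -/
def tubeRho₂ {m : ℕ} (z w : CSpace m) : ℂ :=
  (∑ j, (z.1 j - (starRingEnd ℂ) (w.1 j)) ^ 2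
    - 2 * Complex.I * (z.2 - (starRingEnd ℂ) w.2)) / 4

/-- The weighted Bergman kernel
`K_α(z,w) = Γ(n+1+α) / (2ⁿ⁺¹ πⁿ Γ(α+1) ρ(z,w)ⁿ⁺¹⁺ᵅ)`, `n = m + 1`, with the principal power. -/
def tubeKernel {m : ℕ} (α : ℝ) (z w : CSpace m) : ℂ :=
  ((Real.Gamma ((m + 1 : ℕ) + 1 + α)
      / (2 ^ ((m + 1) + 1) * Real.pi ^ (m + 1) * Real.Gamma (α + 1)) : ℝ) : ℂ)
    / tubeRho₂ z w ^ ((((m + 1 : ℕ) + 1 + α : ℝ)) : ℂ)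

/-- The modified kernel `K_α(z,w) - K_α(𝐢,w)`. -/
def tubeModKernel {m : ℕ} (α : ℝ) (z w : CSpace m) : ℂ :=
  tubeKernel α z w - tubeKernel α (tubeBase m) w

/-- Lebesgue measure on `T_B`. -/
def tubeVolume (m : ℕ) : Measure (CSpace m) := volume.restrict (tubeDomain m)

/-- The weighted measure `dV_α = ρ^α dV` on `T_B`. -/
def tubeWeighted (m : ℕ) (α : ℝ) : Measure (CSpace m) :=
  (tubeVolume m).withDensity fun w => ENNReal.ofReal (tubeRho w ^ α)

/-- The modified projection
`P̃_α f(z) = ∫_{T_B} (K_α(z,w) - K_α(𝐢,w)) f(w) dV_α(w)`. -/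
def tubeModProj {m : ℕ} (α : ℝ) (f : CSpace m → ℂ) (z : CSpace m) : ℂ :=
  ∫ w, tubeModKernel α z w * f w ∂(tubeWeighted m α)

/-- `∂f/∂z_j`, `1 ≤ j ≤ n - 1`. -/
def tubePartial {m : ℕ} (f : CSpace m → ℂ) (j : Fin m) (z : CSpace m) : ℂ :=
  fderiv ℂ f z (Pi.single j 1, 0)

/-- `∂f/∂z_n`. -/
def tubePartialLast {m : ℕ} (f : CSpace m → ℂ) (z : CSpace m) : ℂ :=
  fderiv ℂ f z (0, 1)

/-- The length `|∇̃ f(z)|` of the invariant gradient of a holomorphic function: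
`|∇̃ f|² = 4ρ (2ρ |∂_n f|² + ∑_{j<n} |∂_j f + 2 y_j ∂_n f|²)`. -/
def tubeInvGrad {m : ℕ} (f : CSpace m → ℂ) (z : CSpace m) : ℝ :=
  Real.sqrt (4 * tubeRho z * (2 * tubeRho z * ‖tubePartialLast f z‖ ^ 2
    + ∑ j, ‖tubePartial f j z + 2 * ((z.1 j).im : ℂ) * tubePartialLast f z‖ ^ 2))

/-- Membership in the Bloch space `𝓑` of `T_B` (only the values on `T_B` matter). -/
def IsTubeBloch {m : ℕ} (f : CSpace m → ℂ) : Prop :=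
  DifferentiableOn ℂ f (tubeDomain m) ∧ BddAbove (tubeInvGrad f '' tubeDomain m)

/-- The Bloch (semi-)norm `‖f‖_𝓑 = sup {|∇̃ f(z)| : z ∈ T_B}`. -/
def tubeBlochNorm {m : ℕ} (f : CSpace m → ℂ) : ℝ := sSup (tubeInvGrad f '' tubeDomain m)

/-- Membership in `𝓑̃ = {f ∈ 𝓑 : f(𝐢) = 0}`. -/
def IsTubeBlochZero {m : ℕ} (f : CSpace m → ℂ) : Prop :=
  IsTubeBloch f ∧ f (tubeBase m) = 0

end

/-!
# The modified Bergman projection of the tubular domain `T_B` maps `L^∞` onto the Bloch space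

**Coordinates.** For fixed `z ∈ T_B`, `siegelMap z` is a measure preserving polynomial automorphism,
in which `T_B` becomes the Siegel domain `|u|²/2 < Im ω`, with `ρ(w) = Im ω - |u|²/2` and
`ρ(z,w) = (ρ(z) + i ω̄)/2`. The kernel thus depends on `ω` alone, and the fibre integral
`∫ (y - |u|²/2)₊^β du` is an explicit multiple of `y^{β+n-1}`. All integrals reduce to
the upper half plane.

**Boundedness.** In these coordinates `∫ ρ(w)^β |ρ(z,w)|^{-s} dV(w) = C ρ(z)^{n+1+β-s}` for
`s > n+1+β` (`exists_lintegral_tubeRho₂_eq`). Differentiating `ρ(z,w)` in `z` costs at most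
`|ρ(z,w)|^{1/2}`, so the modified kernel decays faster than `K_α` by `|ρ(𝐢,w)|^{-1/2}`. This gives
absolute convergence and differentiation under the integral sign, both for bounded `f` and for the
(logarithmically growing) Bloch functions; since `(∂_j + 2 y_j ∂_n) ρ(z,w)` is half the
conjugate of `z_j - w_j`, it also gives `|∇̃ P̃_α f| ≤ C ‖f‖_∞` (`exists_norm_deriv_tubeModProj_le`).

**Reproduction.** For `G` holomorphic on `T_B`, the rotations `u ↦ e^{iθ}u` replace `G` by its
restriction to `u = 0`. On the half plane the Cayley transform and the mean value property on
circles then show that `∫ G(w) ρ(w)^β ρ(z,w)^{-(n+1+β)} dV(w)` is a multiple of `G(z)`, and with one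
more power of the kernel a multiple of `∂_n G(z)` (`integral_tube_reproducing`,
`integral_tube_reproducing_deriv`). Hence `∂_n P̃_α f = ∂_n g` in two cases: for `f = g`, and for the
bounded function `f = -2i/(α+1) ρ ∂_n g`.

**Conclusion.** In both cases `h = P̃_α f - g` is invariant under vertical translations because
`∂_n h = 0`, while its tangential derivatives tend to zero along vertical lines. So `h` is constant,
and `h(𝐢) = 0` (`tubeModProj_eq_of_tubePartialLast_eq`).
-/

/-! ### Geometry of `ρ(z)` and `ρ(z,w)` -/

lemma mem_tubeDomain_iff {m : ℕ} {z : CSpace m} : z ∈ tubeDomain m ↔ 0 < tubeRho z := by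
  simp [tubeDomain, tubeRho]

lemma continuous_tubeRho {m : ℕ} : Continuous (tubeRho : CSpace m → ℝ) := by
  unfold tubeRho; fun_prop

lemma isOpen_tubeDomain {m : ℕ} : IsOpen (tubeDomain m) := by
  have : tubeDomain m = tubeRho ⁻¹' Set.Ioi 0 := by
    ext z; simp [mem_tubeDomain_iff]
  rw [this]
  exact isOpen_Ioi.preimage continuous_tubeRho

lemma tubeRho_tubeBase {m : ℕ} : tubeRho (tubeBase m) = 1 := by
  simp [tubeRho, tubeBase]

lemma tubeBase_mem {m : ℕ} : tubeBase m ∈ tubeDomain m := by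
  rw [mem_tubeDomain_iff, tubeRho_tubeBase]; norm_num

lemma concaveOn_tubeRho {m : ℕ} : ConcaveOn ℝ Set.univ (tubeRho : CSpace m → ℝ) := by
  refine ⟨convex_univ, fun z _ w _ a b ha hb hab => ?_⟩
  have hb' : b = 1 - a := by linarith
  have key : ∑ j, (a * (z.1 j).im + b * (w.1 j).im) ^ 2 ≤
      ∑ j, (a * (z.1 j).im ^ 2 + b * (w.1 j).im ^ 2) := by
    refine Finset.sum_le_sum fun j _ => ?_
    nlinarith [mul_nonneg (mul_nonneg ha hb) (sq_nonneg ((z.1 j).im - (w.1 j).im)), hab]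
  rw [Finset.sum_add_distrib, ← Finset.mul_sum, ← Finset.mul_sum] at key
  simp only [tubeRho, smul_eq_mul, Prod.snd_add, Prod.smul_snd, Complex.add_im, Complex.smul_im,
    Prod.fst_add, Prod.smul_fst, Pi.add_apply, Pi.smul_apply]
  linarith

lemma convex_le_tubeRho {m : ℕ} (r : ℝ) : Convex ℝ {z : CSpace m | r ≤ tubeRho z} := by
  simpa using concaveOn_tubeRho.convex_ge r

lemma convex_tubeDomain {m : ℕ} : Convex ℝ (tubeDomain m) := by
  have := (concaveOn_tubeRho (m := m)).convex_gt 0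
  simpa [tubeDomain, tubeRho] using this

/-- The half plane `Re > 0` contains `ρ(z,w)`: this makes the principal power holomorphic. -/
lemma re_tubeRho₂ {m : ℕ} (z w : CSpace m) :
    (tubeRho₂ z w).re
      = (∑ j, ‖z.1 j - w.1 j‖ ^ 2 + 2 * tubeRho z + 2 * tubeRho w) / 4 := by
  have h : ∀ j, ‖z.1 j - w.1 j‖ ^ 2
      = ((z.1 j - (starRingEnd ℂ) (w.1 j)) ^ 2).re + 2 * (z.1 j).im ^ 2 + 2 * (w.1 j).im ^ 2 := by
    intro j
    rw [← Complex.normSq_eq_norm_sq, Complex.normSq_apply, pow_two, Complex.mul_re]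
    simp only [Complex.sub_re, Complex.sub_im, Complex.conj_re, Complex.conj_im]
    ring
  have h4 : (4 : ℂ) = ((4 : ℝ) : ℂ) := by norm_num
  simp only [tubeRho₂, tubeRho, h, Finset.sum_add_distrib, ← Finset.mul_sum]
  rw [h4, Complex.div_ofReal_re]
  simp only [Complex.sub_re, Complex.mul_re, Complex.re_sum, Complex.re_ofNat, Complex.I_re,
    Complex.im_ofNat, Complex.I_im, Complex.mul_im, Complex.sub_im, Complex.conj_im,
    Complex.conj_re]
  ring

lemma tubeRho_add_le_norm_tubeRho₂ {m : ℕ} (z w : CSpace m) :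
    ∑ j, ‖z.1 j - w.1 j‖ ^ 2 + 2 * tubeRho z + 2 * tubeRho w ≤ 4 * ‖tubeRho₂ z w‖ := by
  have h1 := re_tubeRho₂ z w
  have h2 := Complex.re_le_norm (tubeRho₂ z w)
  linarith

lemma tubeRho_le_norm_tubeRho₂ {m : ℕ} {z w : CSpace m} (hw : w ∈ tubeDomain m) :
    tubeRho z / 2 ≤ ‖tubeRho₂ z w‖ := by
  rw [mem_tubeDomain_iff] at hw
  have := tubeRho_add_le_norm_tubeRho₂ z w
  have h0 : 0 ≤ ∑ j, ‖z.1 j - w.1 j‖ ^ 2 := Finset.sum_nonneg fun _ _ => by positivity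
  linarith

lemma tubeRho_le_norm_tubeRho₂' {m : ℕ} {z w : CSpace m} (hz : z ∈ tubeDomain m) :
    tubeRho w / 2 ≤ ‖tubeRho₂ z w‖ := by
  rw [mem_tubeDomain_iff] at hz
  have := tubeRho_add_le_norm_tubeRho₂ z w
  have h0 : 0 ≤ ∑ j, ‖z.1 j - w.1 j‖ ^ 2 := Finset.sum_nonneg fun _ _ => by positivity
  linarith

lemma norm_sub_sq_le_norm_tubeRho₂ {m : ℕ} {z w : CSpace m} (hz : z ∈ tubeDomain m)
    (hw : w ∈ tubeDomain m) (j : Fin m) : ‖z.1 j - w.1 j‖ ^ 2 ≤ 4 * ‖tubeRho₂ z w‖ := by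
  rw [mem_tubeDomain_iff] at hw hz
  have := tubeRho_add_le_norm_tubeRho₂ z w
  have h0 : ‖z.1 j - w.1 j‖ ^ 2 ≤ ∑ j, ‖z.1 j - w.1 j‖ ^ 2 :=
    Finset.single_le_sum (f := fun j => ‖z.1 j - w.1 j‖ ^ 2) (fun _ _ => by positivity)
      (Finset.mem_univ j)
  linarith

lemma norm_sub_le_norm_tubeRho₂ {m : ℕ} {z w : CSpace m} (hz : z ∈ tubeDomain m)
    (hw : w ∈ tubeDomain m) (j : Fin m) :
    ‖z.1 j - w.1 j‖ ≤ 2 * ‖tubeRho₂ z w‖ ^ (1 / 2 : ℝ) := by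
  rw [← Real.sqrt_eq_rpow]
  refine (pow_le_pow_iff_left₀ (norm_nonneg _) (by positivity) two_ne_zero).1 ?_
  rw [mul_pow, Real.sq_sqrt (norm_nonneg _)]
  have := norm_sub_sq_le_norm_tubeRho₂ hz hw j
  linarith

lemma re_tubeRho₂_pos {m : ℕ} {z w : CSpace m} (hz : z ∈ tubeDomain m) (hw : w ∈ tubeDomain m) :
    0 < (tubeRho₂ z w).re := by
  rw [mem_tubeDomain_iff] at hw hz
  rw [re_tubeRho₂]
  have h0 : 0 ≤ ∑ j, ‖z.1 j - w.1 j‖ ^ 2 := Finset.sum_nonneg fun _ _ => by positivity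
  linarith

lemma norm_tubeRho₂_pos {m : ℕ} {z w : CSpace m} (hz : z ∈ tubeDomain m)
    (hw : w ∈ tubeDomain m) : 0 < ‖tubeRho₂ z w‖ :=
  (re_tubeRho₂_pos hz hw).trans_le (Complex.re_le_norm _)

lemma tubeRho₂_mem_slitPlane {m : ℕ} {z w : CSpace m} (hz : z ∈ tubeDomain m)
    (hw : w ∈ tubeDomain m) : tubeRho₂ z w ∈ Complex.slitPlane :=
  Or.inl (re_tubeRho₂_pos hz hw)

lemma continuous_tubeRho₂_right {m : ℕ} (z : CSpace m) : Continuous (tubeRho₂ z) := by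
  unfold tubeRho₂
  have : Continuous (starRingEnd ℂ) := Complex.continuous_conj
  fun_prop

/-- Moving `z` within a bounded part of `{ρ ≥ r}` changes `|ρ(z,w)|` at most by a factor that does
not depend on `w`. -/
lemma exists_norm_tubeRho₂_le_mul (m : ℕ) (M r : ℝ) (hM : 0 ≤ M) (hr : 0 < r) :
    ∃ L : ℝ, 0 < L ∧ ∀ z z₀ w : CSpace m, ‖z‖ ≤ M → ‖z₀‖ ≤ M → r ≤ tubeRho z →
      w ∈ tubeDomain m → ‖tubeRho₂ z₀ w‖ ≤ L * ‖tubeRho₂ z w‖ := by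
  refine ⟨1 + ((m * (2 * M * (4 * M + 2)) + 4 * M) * (2 / r) + m * (16 * M)), by positivity, ?_⟩
  intro z z₀ w hz hz₀ hr' hw
  have hzm : z ∈ tubeDomain m := mem_tubeDomain_iff.2 (hr.trans_le hr')
  have h1 : tubeRho₂ z₀ w - tubeRho₂ z w
      = (∑ j, (z₀.1 j - z.1 j) * (z₀.1 j + z.1 j - 2 * (starRingEnd ℂ) (w.1 j))
          - 2 * Complex.I * (z₀.2 - z.2)) / 4 := by
    simp only [tubeRho₂]
    rw [← sub_div, show ∀ a b c d : ℂ, a - b - (c - d) = (a - c) - (b - d) by intros; ring,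
      ← Finset.sum_sub_distrib]
    congr 2
    · exact Finset.sum_congr rfl fun j _ => by ring
    · ring
  have hz1 : ∀ j, ‖z.1 j‖ ≤ M := fun j => (norm_le_pi_norm z.1 j).trans ((norm_fst_le z).trans hz)
  have hz2 : ∀ j, ‖z₀.1 j‖ ≤ M :=
    fun j => (norm_le_pi_norm z₀.1 j).trans ((norm_fst_le z₀).trans hz₀)
  set N := ‖tubeRho₂ z w‖ with hN
  have hNr : r / 2 ≤ N := le_trans (by linarith) (tubeRho_le_norm_tubeRho₂ hw)
  have hterm : ∀ j, ‖(z₀.1 j - z.1 j) * (z₀.1 j + z.1 j - 2 * (starRingEnd ℂ) (w.1 j))‖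
      ≤ 2 * M * (4 * M + 2 + 8 * N) := by
    intro j
    have hs := norm_sub_sq_le_norm_tubeRho₂ hzm hw j
    have hs' : ‖z.1 j - w.1 j‖ ≤ 1 + 4 * N := by nlinarith [sq_nonneg (‖z.1 j - w.1 j‖ - 1)]
    have hw' : ‖w.1 j‖ ≤ M + (1 + 4 * N) := by
      calc ‖w.1 j‖ = ‖z.1 j - (z.1 j - w.1 j)‖ := by congr 1; ring
        _ ≤ _ := norm_sub_le _ _
        _ ≤ _ := add_le_add (hz1 j) hs'
    rw [norm_mul]
    refine mul_le_mul ((norm_sub_le _ _).trans (by linarith [hz1 j, hz2 j])) ?_ (norm_nonneg _)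
      (by positivity)
    refine (norm_sub_le _ _).trans ?_
    have := norm_add_le (z₀.1 j) (z.1 j)
    rw [norm_mul, RCLike.norm_conj]
    norm_num
    linarith [hz1 j, hz2 j]
  have h2 : ‖tubeRho₂ z₀ w - tubeRho₂ z w‖ ≤ m * (2 * M * (4 * M + 2 + 8 * N)) + 4 * M := by
    rw [h1, norm_div]
    have hA : ‖∑ j, (z₀.1 j - z.1 j) * (z₀.1 j + z.1 j - 2 * (starRingEnd ℂ) (w.1 j))‖
        ≤ m * (2 * M * (4 * M + 2 + 8 * N)) := by
      refine (norm_sum_le_of_le _ fun j _ => hterm j).trans ?_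
      simp
    have hB : ‖2 * Complex.I * (z₀.2 - z.2)‖ ≤ 4 * M := by
      rw [norm_mul, norm_mul, Complex.norm_I]
      norm_num
      have := norm_sub_le z₀.2 z.2
      linarith [(norm_snd_le z).trans hz, (norm_snd_le z₀).trans hz₀]
    have hC := norm_sub_le (∑ j, (z₀.1 j - z.1 j) * (z₀.1 j + z.1 j - 2 * (starRingEnd ℂ) (w.1 j)))
      (2 * Complex.I * (z₀.2 - z.2))
    have h4 : ‖(4 : ℂ)‖ = 4 := by norm_num
    rw [h4]
    have hpos : 0 ≤ (m : ℝ) * (2 * M * (4 * M + 2 + 8 * N)) + 4 * M := by positivity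
    linarith
  have h3 : 1 ≤ 2 / r * N := by
    rw [div_mul_eq_mul_div, le_div_iff₀ hr]; linarith
  have h5 : ‖tubeRho₂ z₀ w‖ ≤ N + ‖tubeRho₂ z₀ w - tubeRho₂ z w‖ := by
    have := norm_add_le (tubeRho₂ z w) (tubeRho₂ z₀ w - tubeRho₂ z w)
    rwa [add_sub_cancel] at this
  have h6 : (m * (2 * M * (4 * M + 2)) + 4 * M) * 1
      ≤ (m * (2 * M * (4 * M + 2)) + 4 * M) * (2 / r * N) := by gcongr
  nlinarith

/-- The complex derivative of `z ↦ ρ(z,w)`. -/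
noncomputable def tubeRho₂Deriv {m : ℕ} (z w : CSpace m) : CSpace m →L[ℂ] ℂ :=
  ∑ j, ((z.1 j - (starRingEnd ℂ) (w.1 j)) / 2) •
      (ContinuousLinearMap.proj (R := ℂ) (φ := fun _ : Fin m => ℂ) j ∘L
        ContinuousLinearMap.fst ℂ (Fin m → ℂ) ℂ)
    - (Complex.I / 2) • ContinuousLinearMap.snd ℂ (Fin m → ℂ) ℂ

lemma tubeRho₂Deriv_apply {m : ℕ} (z w δ : CSpace m) :
    tubeRho₂Deriv z w δ = ∑ j, (z.1 j - (starRingEnd ℂ) (w.1 j)) / 2 * δ.1 j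
      - Complex.I / 2 * δ.2 := by
  simp [tubeRho₂Deriv]

lemma hasFDerivAt_tubeRho₂ {m : ℕ} (z w : CSpace m) :
    HasFDerivAt (fun z => tubeRho₂ z w) (tubeRho₂Deriv z w) z := by
  have h1 : ∀ j : Fin m, HasFDerivAt (fun z : CSpace m => (z.1 j - (starRingEnd ℂ) (w.1 j)) ^ 2)
      ((2 * (z.1 j - (starRingEnd ℂ) (w.1 j))) •
      (ContinuousLinearMap.proj (R := ℂ) (φ := fun _ : Fin m => ℂ) j ∘L
        ContinuousLinearMap.fst ℂ (Fin m → ℂ) ℂ)) z := by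
    intro j
    have := ((ContinuousLinearMap.proj (R := ℂ) (φ := fun _ : Fin m => ℂ) j ∘L
        ContinuousLinearMap.fst ℂ (Fin m → ℂ) ℂ).hasFDerivAt (x := z)).sub_const
          ((starRingEnd ℂ) (w.1 j))
    simpa using this.pow 2
  have h2 : HasFDerivAt (fun z : CSpace m => z.2 - (starRingEnd ℂ) w.2)
      (ContinuousLinearMap.snd ℂ (Fin m → ℂ) ℂ) z :=
    ((ContinuousLinearMap.snd ℂ (Fin m → ℂ) ℂ).hasFDerivAt).sub_const _
  have h3 := ((HasFDerivAt.fun_sum fun j (_ : j ∈ Finset.univ) => h1 j).sub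
    (h2.const_mul (2 * Complex.I))).mul_const (4 : ℂ)⁻¹
  have h4 : (4 : ℂ)⁻¹ • (∑ j, ((2 * (z.1 j - (starRingEnd ℂ) (w.1 j))) •
      (ContinuousLinearMap.proj (R := ℂ) (φ := fun _ : Fin m => ℂ) j ∘L
        ContinuousLinearMap.fst ℂ (Fin m → ℂ) ℂ)) -
      (2 * Complex.I) • ContinuousLinearMap.snd ℂ (Fin m → ℂ) ℂ) = tubeRho₂Deriv z w := by
    ext δ <;> simp [tubeRho₂Deriv, Finset.mul_sum]
    · refine Finset.sum_congr rfl fun j _ => by ring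
    · ring
  rw [h4] at h3
  exact h3

/-- On bounded parts of `{ρ ≥ r}` the derivative of `ρ(z,w)` in `z` is of the size of
`|ρ(z,w)|^{1/2}`: it grows only linearly in `w'`. -/
lemma exists_norm_tubeRho₂Deriv_le (m : ℕ) (M r : ℝ) (hM : 0 ≤ M) (hr : 0 < r) :
    ∃ L : ℝ, 0 < L ∧ ∀ z w : CSpace m, ‖z‖ ≤ M → r ≤ tubeRho z →
      w ∈ tubeDomain m → ‖tubeRho₂Deriv z w‖ ≤ L * ‖tubeRho₂ z w‖ ^ (1 / 2 : ℝ) := by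
  refine ⟨m * (M * (2 / r) ^ (1 / 2 : ℝ) + 1) + (2 / r) ^ (1 / 2 : ℝ), by positivity, ?_⟩
  intro z w hz hr' hw
  have hzm : z ∈ tubeDomain m := mem_tubeDomain_iff.2 (hr.trans_le hr')
  set N := ‖tubeRho₂ z w‖ ^ (1 / 2 : ℝ) with hN
  have hN0 : 0 ≤ N := by positivity
  have h1 : 1 ≤ (2 / r) ^ (1 / 2 : ℝ) * N := by
    rw [hN, ← Real.mul_rpow (by positivity) (norm_nonneg _)]
    apply Real.one_le_rpow _ (by norm_num)
    rw [div_mul_eq_mul_div, le_div_iff₀ hr]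
    linarith [tubeRho_le_norm_tubeRho₂ (z := z) hw]
  have hz1 : ∀ j, ‖z.1 j‖ ≤ M := fun j => (norm_le_pi_norm z.1 j).trans ((norm_fst_le z).trans hz)
  have hterm : ∀ j, ‖z.1 j - (starRingEnd ℂ) (w.1 j)‖ ≤ 2 * M + 2 * N := by
    intro j
    have hs := norm_sub_le_norm_tubeRho₂ hzm hw j
    have hw' : ‖w.1 j‖ ≤ M + 2 * N := by
      calc ‖w.1 j‖ = ‖z.1 j - (z.1 j - w.1 j)‖ := by congr 1; ring
        _ ≤ _ := norm_sub_le _ _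
        _ ≤ _ := add_le_add (hz1 j) hs
    refine (norm_sub_le _ _).trans ?_
    rw [RCLike.norm_conj]
    linarith [hz1 j]
  refine ContinuousLinearMap.opNorm_le_bound _ (by positivity) fun δ => ?_
  rw [tubeRho₂Deriv_apply]
  have hδ1 : ∀ j, ‖δ.1 j‖ ≤ ‖δ‖ := fun j => (norm_le_pi_norm δ.1 j).trans (norm_fst_le δ)
  have hA : ‖∑ j, (z.1 j - (starRingEnd ℂ) (w.1 j)) / 2 * δ.1 j‖ ≤ m * ((M + N) * ‖δ‖) := by
    refine (norm_sum_le_of_le (f := fun j => (z.1 j - (starRingEnd ℂ) (w.1 j)) / 2 * δ.1 j)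
      (n := fun _ => (M + N) * ‖δ‖) _ fun j _ => ?_).trans (by simp)
    rw [norm_mul, norm_div]
    have := hterm j
    gcongr
    · norm_num; linarith
    · exact hδ1 j
  have hB : ‖Complex.I / 2 * δ.2‖ ≤ ‖δ‖ := by
    rw [norm_mul, norm_div, Complex.norm_I]
    norm_num
    linarith [norm_snd_le δ, norm_nonneg δ]
  refine (norm_sub_le _ _).trans ((add_le_add hA hB).trans ?_)
  have h5 : M * 1 ≤ M * ((2 / r) ^ (1 / 2 : ℝ) * N) := by gcongr
  have h6 : (m : ℝ) * (M + N) + 1 ≤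
      (m * (M * (2 / r) ^ (1 / 2 : ℝ) + 1) + (2 / r) ^ (1 / 2 : ℝ)) * N := by
    have : (m : ℝ) * (M * 1) ≤ m * (M * ((2 / r) ^ (1 / 2 : ℝ) * N)) := by gcongr
    nlinarith
  calc m * ((M + N) * ‖δ‖) + ‖δ‖ = (m * (M + N) + 1) * ‖δ‖ := by ring
    _ ≤ _ := by gcongr

/-- The combination of derivatives in the invariant gradient removes `Im z_j`:
`(∂_j + 2 y_j ∂_n) ρ(z,w) = conj (z_j - w_j) / 2`. -/
lemma tubeRho₂Deriv_tangential {m : ℕ} (z w : CSpace m) (j : Fin m) :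
    tubeRho₂Deriv z w (Pi.single j 1, 0) + 2 * ((z.1 j).im : ℂ) * tubeRho₂Deriv z w (0, 1)
      = (starRingEnd ℂ) (z.1 j - w.1 j) / 2 := by
  simp only [tubeRho₂Deriv_apply, Pi.single_apply, mul_ite, mul_one, mul_zero, Finset.sum_ite_eq',
    Finset.mem_univ, if_true, Pi.zero_apply, Finset.sum_const_zero, zero_sub, sub_zero, map_sub]
  refine Complex.ext ?_ ?_ <;> simp
  ring

lemma tubeRho₂Deriv_last {m : ℕ} (z w : CSpace m) :
    tubeRho₂Deriv z w (0, 1) = -(Complex.I / 2) := by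
  simp [tubeRho₂Deriv_apply]

/-- `|ρ(𝐢,w)|` dominates the size of `w`. -/
lemma size_le_norm_tubeRho₂_base {m : ℕ} {w : CSpace m} (hw : w ∈ tubeDomain m) :
    1 + ∑ j, ‖w.1 j‖ ^ 2 + ‖w.2‖ ≤ 8 * ‖tubeRho₂ (tubeBase m) w‖ := by
  have h1 := tubeRho_add_le_norm_tubeRho₂ (tubeBase m) w
  rw [tubeRho_tubeBase] at h1
  simp only [tubeBase, Pi.zero_apply, zero_sub, norm_neg] at h1
  rw [mem_tubeDomain_iff] at hw
  have h2 : 2 * Complex.I * (starRingEnd ℂ) w.2 =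
      4 * tubeRho₂ (tubeBase m) w - ∑ j, ((starRingEnd ℂ) (w.1 j)) ^ 2 - 2 := by
    simp only [tubeRho₂, tubeBase, Pi.zero_apply, zero_sub]
    have : ∀ x : ℂ, (-x) ^ 2 = x ^ 2 := fun x => by ring
    simp only [this]
    linear_combination 2 * Complex.I_mul_I
  have h3 : 2 * ‖w.2‖ ≤ 4 * ‖tubeRho₂ (tubeBase m) w‖ + ∑ j, ‖w.1 j‖ ^ 2 + 2 := by
    have h4 : 2 * ‖w.2‖ = ‖2 * Complex.I * (starRingEnd ℂ) w.2‖ := by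
      rw [norm_mul, norm_mul, Complex.norm_I, RCLike.norm_conj]; norm_num
    rw [h4, h2]
    refine (norm_sub_le _ _).trans (add_le_add ((norm_sub_le _ _).trans (add_le_add ?_ ?_)) ?_)
    · rw [norm_mul]; norm_num
    · refine norm_sum_le_of_le _ fun j _ => ?_
      rw [norm_pow, RCLike.norm_conj]
    · norm_num
  change _ ≤ 4 * ‖tubeRho₂ (tubeBase m) w‖ at h1
  linarith

/-! ### Averaging over rotations, and integration over the fibres of the Siegel domain -/

/-- For a measure invariant under the rotations `u ↦ e^{iθ} u`, an integrand may be replaced by its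
averages over circles; for integrands holomorphic along complex lines, these are given by
Cauchy's formula. -/
lemma integral_eq_integral_circleAverage {E : Type*} [NormedAddCommGroup E] [NormedSpace ℂ E]
    [MeasurableSpace E] [BorelSpace E] [SecondCountableTopology E] (μ : Measure E) [SFinite μ]
    (hμ : ∀ θ : ℝ, MeasurePreserving (fun u : E => circleMap 0 1 θ • u) μ μ)
    (F : E → ℂ) (hF : Integrable F μ) :
    ∫ u, F u ∂μ = ∫ u, Real.circleAverage (fun c => F (c • u)) 0 1 ∂μ := by
  set ν : Measure ℝ := volume.restrict (Set.Ioc 0 (2 * Real.pi)) with hν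
  have hmp : MeasurePreserving (fun p : ℝ × E => (p.1, circleMap 0 1 p.1 • p.2))
      (ν.prod μ) (ν.prod μ) := by
    refine (MeasurePreserving.id ν).skew_product (g := fun θ u => circleMap 0 1 θ • u) ?_ ?_
    · exact (((continuous_circleMap 0 1).comp continuous_fst).smul continuous_snd).measurable
    · exact Filter.Eventually.of_forall fun θ => (hμ θ).map_eq
  have hint : Integrable (fun p : ℝ × E => F (circleMap 0 1 p.1 • p.2)) (ν.prod μ) :=
    hmp.integrable_comp_of_integrable (g := fun p : ℝ × E => F p.2) (hF.comp_snd ν)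
  have hle : (0 : ℝ) ≤ 2 * Real.pi := by positivity
  simp only [Real.circleAverage, intervalIntegral.integral_of_le hle, ← hν]
  rw [integral_smul, integral_integral_swap (f := fun u θ => F (circleMap 0 1 θ • u)) hint.swap]
  have : ∀ θ : ℝ, ∫ u, F (circleMap 0 1 θ • u) ∂μ = ∫ u, F u ∂μ := by
    intro θ
    have hne : circleMap 0 1 θ ≠ 0 := circleMap_ne_center one_ne_zero
    exact (hμ θ).integral_comp (Homeomorph.smulOfNeZero _ hne).measurableEmbedding F
  simp only [this, integral_const]
  rw [hν, Measure.real, Measure.restrict_apply_univ, Real.volume_Ioc, sub_zero,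
    ENNReal.toReal_ofReal hle, smul_smul, inv_mul_cancel₀ (by positivity), one_smul]

lemma measurePreserving_circleMap_smul (θ : ℝ) :
    MeasurePreserving (fun u : ℂ => circleMap 0 1 θ • u) volume volume := by
  have h : ‖circleMap 0 1 θ‖ = 1 := by simp
  exact (rotation ⟨circleMap 0 1 θ, by simp [Submonoid.unitSphere]⟩).measurePreserving

lemma measurePreserving_circleMap_smul_pi (m : ℕ) (θ : ℝ) :
    MeasurePreserving (fun u : Fin m → ℂ => circleMap 0 1 θ • u) volume volume :=
  volume_preserving_pi fun _ => measurePreserving_circleMap_smul θ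

lemma lintegral_comp_smul {E : Type*} [NormedAddCommGroup E] [NormedSpace ℝ E]
    [MeasurableSpace E] [BorelSpace E] [FiniteDimensional ℝ E] (μ : Measure E)
    [μ.IsAddHaarMeasure] (f : E → ℝ≥0∞) {r : ℝ} (hr : r ≠ 0) :
    ∫⁻ x, f (r • x) ∂μ = ENNReal.ofReal |(r ^ Module.finrank ℝ E)⁻¹| * ∫⁻ x, f x ∂μ := by
  have h := (Homeomorph.smulOfNeZero r hr (α := E)).measurableEmbedding.lintegral_map (μ := μ) f
  change ∫⁻ x, f x ∂(Measure.map (fun x => r • x) μ) = ∫⁻ x, f (r • x) ∂μ at h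
  rw [← h, Measure.map_addHaar_smul μ hr, lintegral_smul_measure, smul_eq_mul]

/-- The truncated power `x₊^β`, which vanishes for `x ≤ 0`. -/
noncomputable def truncPow (β x : ℝ) : ℝ := if 0 < x then x ^ β else 0

lemma truncPow_of_pos {β x : ℝ} (hx : 0 < x) : truncPow β x = x ^ β := if_pos hx

lemma truncPow_of_nonpos {β x : ℝ} (hx : x ≤ 0) : truncPow β x = 0 := if_neg hx.not_gt

lemma truncPow_nonneg (β x : ℝ) : 0 ≤ truncPow β x := by
  unfold truncPow; split_ifs with h
  · positivity
  · rfl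

lemma truncPow_mul {β y : ℝ} (hy : 0 < y) (x : ℝ) :
    truncPow β (y * x) = y ^ β * truncPow β x := by
  rcases le_or_gt x 0 with hx | hx
  · rw [truncPow_of_nonpos hx, truncPow_of_nonpos (by nlinarith), mul_zero]
  · rw [truncPow_of_pos hx, truncPow_of_pos (by positivity), Real.mul_rpow hy.le hx.le]

lemma measurable_truncPow (β : ℝ) : Measurable (truncPow β) :=
  Measurable.ite measurableSet_Ioi (measurable_id.pow_const β) measurable_const

lemma lintegral_truncPow_mul_exp {β : ℝ} (hβ : -1 < β) :
    ∫⁻ t : ℝ, ENNReal.ofReal (truncPow β t) * ENNReal.ofReal (Real.exp (-t))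
      = ENNReal.ofReal (Real.Gamma (β + 1)) := by
  have h1 : (fun t : ℝ => ENNReal.ofReal (truncPow β t) * ENNReal.ofReal (Real.exp (-t)))
      = (Set.Ioi 0).indicator
        (fun t => ENNReal.ofReal (Real.exp (-t) * t ^ ((β + 1) - 1))) := by
    funext t
    by_cases ht : 0 < t
    · rw [Set.indicator_of_mem (Set.mem_Ioi.2 ht), truncPow_of_pos ht,
        ← ENNReal.ofReal_mul (by positivity), add_sub_cancel_right, mul_comm]
    · rw [Set.indicator_of_notMem (by simpa using ht), truncPow_of_nonpos (not_lt.1 ht)]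
      simp
  rw [h1, lintegral_indicator measurableSet_Ioi, Real.Gamma_eq_integral (by linarith),
    ofReal_integral_eq_lintegral_ofReal (Real.GammaIntegral_convergent (by linarith))]
  filter_upwards [ae_restrict_mem measurableSet_Ioi] with t ht
  have : (0 : ℝ) < t := ht
  positivity

lemma lintegral_exp_neg_half_sum_norm_sq (m : ℕ) :
    ∫⁻ u : Fin m → ℂ, ENNReal.ofReal (Real.exp (-(∑ j, ‖u j‖ ^ 2 / 2)))
      = ENNReal.ofReal ((2 * Real.pi) ^ m) := by
  have hg : ∫ v : ℂ, Real.exp (-(‖v‖ ^ 2 / 2)) = 2 * Real.pi := by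
    have := GaussianFourier.integral_rexp_neg_mul_sq_norm (V := ℂ) (b := 1 / 2) (by norm_num)
    rw [Complex.finrank_real_complex] at this
    convert this using 1
    · congr 1; funext v; congr 1; ring
    · norm_num; ring
  have hgi : Integrable (fun v : ℂ => Real.exp (-(‖v‖ ^ 2 / 2))) := by
    by_contra h
    rw [integral_undef h] at hg
    have := Real.pi_pos
    linarith
  have hfun : (fun u : Fin m → ℂ => Real.exp (-(∑ j, ‖u j‖ ^ 2 / 2)))
      = fun u => ∏ j, Real.exp (-(‖u j‖ ^ 2 / 2)) := by
    funext u
    rw [← Real.exp_sum, Finset.sum_neg_distrib]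
  rw [← ofReal_integral_eq_lintegral_ofReal]
  · rw [hfun, integral_fintype_prod_volume_eq_prod
      (f := fun (_ : Fin m) (v : ℂ) => Real.exp (-(‖v‖ ^ 2 / 2)))]
    simp [hg]
  · rw [hfun]
    exact Integrable.fintype_prod (f := fun (_ : Fin m) (v : ℂ) => Real.exp (-(‖v‖ ^ 2 / 2)))
      fun _ => hgi
  · exact Filter.Eventually.of_forall fun _ => by positivity

/-- The value at `y = 1` of `∫ (y - |u|²/2)₊^β du` over `ℂᵐ`. -/
noncomputable def fibreConst (m : ℕ) (β : ℝ) : ℝ :=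
  (2 * Real.pi) ^ m * Real.Gamma (β + 1) / Real.Gamma (β + m + 1)

lemma fibreConst_pos (m : ℕ) {β : ℝ} (hβ : -1 < β) : 0 < fibreConst m β := by
  have h1 := Real.Gamma_pos_of_pos (s := β + 1) (by linarith)
  have h2 := Real.Gamma_pos_of_pos (s := β + m + 1) (by have : (0 : ℝ) ≤ m := Nat.cast_nonneg m; linarith)
  unfold fibreConst
  positivity

lemma measurable_truncPow_sub (m : ℕ) (β : ℝ) :
    Measurable fun p : (Fin m → ℂ) × ℝ => truncPow β (p.2 - ∑ j, ‖p.1 j‖ ^ 2 / 2) :=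
  (measurable_truncPow β).comp (by fun_prop)

/-- Scaling gives the power of `y`; integrating the identity against `e^{-y}` gives the constant. -/
lemma lintegral_truncPow_sub_sum (m : ℕ) {β : ℝ} (hβ : -1 < β) (y : ℝ) :
    ∫⁻ u : Fin m → ℂ, ENNReal.ofReal (truncPow β (y - ∑ j, ‖u j‖ ^ 2 / 2))
      = ENNReal.ofReal (truncPow (β + m) y) * ENNReal.ofReal (fibreConst m β) := by
  set Λ : ℝ → ℝ≥0∞ :=
    fun y => ∫⁻ u : Fin m → ℂ, ENNReal.ofReal (truncPow β (y - ∑ j, ‖u j‖ ^ 2 / 2)) with hΛ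
  have hm0 : (0 : ℝ) ≤ m := Nat.cast_nonneg m
  have hscale : ∀ y, Λ y = ENNReal.ofReal (truncPow (β + m) y) * Λ 1 := by
    intro y
    rcases le_or_gt y 0 with hy | hy
    · rw [truncPow_of_nonpos hy, ENNReal.ofReal_zero, zero_mul, hΛ]
      simp only
      rw [← lintegral_zero (μ := (volume : Measure (Fin m → ℂ)))]
      congr 1; funext u
      have : 0 ≤ ∑ j, ‖u j‖ ^ 2 / 2 := Finset.sum_nonneg fun _ _ => by positivity
      rw [truncPow_of_nonpos (by linarith), ENNReal.ofReal_zero]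
    · have hs : √y ≠ 0 := (Real.sqrt_pos.2 hy).ne'
      have h1 := lintegral_comp_smul (volume : Measure (Fin m → ℂ))
        (fun u => ENNReal.ofReal (truncPow β (y - ∑ j, ‖u j‖ ^ 2 / 2))) hs
      have h2 : ∀ u : Fin m → ℂ, ENNReal.ofReal (truncPow β (y - ∑ j, ‖(√y • u) j‖ ^ 2 / 2))
          = ENNReal.ofReal (y ^ β) * ENNReal.ofReal (truncPow β (1 - ∑ j, ‖u j‖ ^ 2 / 2)) := by
        intro u
        rw [← ENNReal.ofReal_mul (by positivity), ← truncPow_mul hy, mul_sub, mul_one,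
          Finset.mul_sum]
        congr 3
        refine Finset.sum_congr rfl fun j _ => ?_
        rw [Pi.smul_apply, norm_smul, mul_pow, Real.norm_eq_abs, sq_abs, Real.sq_sqrt hy.le]
        ring
      simp only [h2] at h1
      rw [lintegral_const_mul' _ _ ENNReal.ofReal_ne_top] at h1
      have hfr : Module.finrank ℝ (Fin m → ℂ) = 2 * m := by
        simp [Module.finrank_pi_fintype, Complex.finrank_real_complex, mul_comm]
      rw [hfr, pow_mul, Real.sq_sqrt hy.le, abs_of_pos (by positivity)] at h1
      change ENNReal.ofReal (y ^ β) * Λ 1 = _ * Λ y at h1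
      rw [truncPow_of_pos hy, Real.rpow_add hy, Real.rpow_natCast, mul_comm (y ^ β),
        ENNReal.ofReal_mul (by positivity), mul_assoc, h1, ← mul_assoc,
        ← ENNReal.ofReal_mul (by positivity), mul_inv_cancel₀ (by positivity)]
      simp
  have hswap : ∫⁻ y : ℝ, Λ y * ENNReal.ofReal (Real.exp (-y))
      = ENNReal.ofReal (Real.Gamma (β + 1)) * ENNReal.ofReal ((2 * Real.pi) ^ m) := by
    have hmeas : Measurable fun p : (Fin m → ℂ) × ℝ =>
        ENNReal.ofReal (truncPow β (p.2 - ∑ j, ‖p.1 j‖ ^ 2 / 2))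
          * ENNReal.ofReal (Real.exp (-p.2)) :=
      (measurable_truncPow_sub m β).ennreal_ofReal.mul (by fun_prop)
    calc ∫⁻ y : ℝ, Λ y * ENNReal.ofReal (Real.exp (-y))
        = ∫⁻ y : ℝ, ∫⁻ u : Fin m → ℂ, ENNReal.ofReal (truncPow β (y - ∑ j, ‖u j‖ ^ 2 / 2))
          * ENNReal.ofReal (Real.exp (-y)) := by
          refine lintegral_congr fun y => ?_
          rw [lintegral_mul_const' _ _ ENNReal.ofReal_ne_top]
      _ = ∫⁻ u : Fin m → ℂ, ∫⁻ y : ℝ, ENNReal.ofReal (truncPow β (y - ∑ j, ‖u j‖ ^ 2 / 2))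
          * ENNReal.ofReal (Real.exp (-y)) :=
          (lintegral_lintegral_swap (f := fun (u : Fin m → ℂ) (y : ℝ) =>
            ENNReal.ofReal (truncPow β (y - ∑ j, ‖u j‖ ^ 2 / 2))
              * ENNReal.ofReal (Real.exp (-y))) hmeas.aemeasurable).symm
      _ = ∫⁻ u : Fin m → ℂ, ENNReal.ofReal (Real.Gamma (β + 1))
          * ENNReal.ofReal (Real.exp (-(∑ j, ‖u j‖ ^ 2 / 2))) := by
          refine lintegral_congr fun u => ?_
          rw [← lintegral_add_right_eq_self _ (∑ j, ‖u j‖ ^ 2 / 2),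
            ← lintegral_truncPow_mul_exp hβ, ← lintegral_mul_const' _ _ ENNReal.ofReal_ne_top]
          refine lintegral_congr fun y => ?_
          rw [add_sub_cancel_right, neg_add, Real.exp_add, ENNReal.ofReal_mul (by positivity),
            mul_assoc]
      _ = _ := by
          rw [lintegral_const_mul' _ _ ENNReal.ofReal_ne_top, lintegral_exp_neg_half_sum_norm_sq]
  have hΓ := Real.Gamma_pos_of_pos (s := β + m + 1) (by linarith)
  have hone : Λ 1 = ENNReal.ofReal (fibreConst m β) := by
    have h1 : ∫⁻ y : ℝ, Λ y * ENNReal.ofReal (Real.exp (-y))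
        = ENNReal.ofReal (Real.Gamma (β + m + 1)) * Λ 1 := by
      rw [← lintegral_truncPow_mul_exp (β := β + m) (by linarith), ← lintegral_mul_const]
      · refine lintegral_congr fun y => ?_
        rw [hscale y]; ring
      · exact (measurable_truncPow _).ennreal_ofReal.mul (by fun_prop)
    rw [hswap, ← ENNReal.ofReal_mul (Real.Gamma_pos_of_pos (by linarith)).le] at h1
    have h2 : ENNReal.ofReal (Real.Gamma (β + m + 1)) ≠ 0 := by simpa using hΓ
    rw [← ENNReal.mul_right_inj h2 ENNReal.ofReal_ne_top, ← h1, ← ENNReal.ofReal_mul hΓ.le]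
    congr 1
    unfold fibreConst
    field_simp
  rw [← hone]
  exact hscale y

lemma integral_truncPow_sub_sum (m : ℕ) {β : ℝ} (hβ : -1 < β) (y : ℝ) :
    ∫ u : Fin m → ℂ, truncPow β (y - ∑ j, ‖u j‖ ^ 2 / 2)
      = fibreConst m β * truncPow (β + m) y := by
  rw [integral_eq_lintegral_of_nonneg_ae
    (Filter.Eventually.of_forall fun _ => truncPow_nonneg _ _),
    lintegral_truncPow_sub_sum m hβ, ENNReal.toReal_mul,
    ENNReal.toReal_ofReal (truncPow_nonneg _ _), ENNReal.toReal_ofReal (fibreConst_pos m hβ).le,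
    mul_comm]
  exact ((measurable_truncPow_sub m β).comp
    (measurable_id.prodMk measurable_const)).aestronglyMeasurable

/-- The total mass of `(1-|η|²)^β` on the unit disc, as the case `m = 1` of the fibre integral. -/
lemma integral_truncPow_one_sub_norm_sq {β : ℝ} (hβ : -1 < β) :
    ∫ η : ℂ, truncPow β (1 - ‖η‖ ^ 2) = Real.pi / (β + 1) := by
  have h1 := integral_truncPow_sub_sum 1 hβ 1
  have hmp := volume_preserving_funUnique (Fin 1) ℂ
  have h2 := hmp.integral_comp (MeasurableEquiv.measurableEmbedding _)
    (fun η : ℂ => truncPow β (1 - ‖η‖ ^ 2 / 2))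
  have h3 := Measure.integral_comp_smul (volume : Measure ℂ)
    (fun η : ℂ => truncPow β (1 - ‖η‖ ^ 2 / 2)) √2
  have h4 : ∀ η : ℂ, ‖√2 • η‖ ^ 2 / 2 = ‖η‖ ^ 2 := fun η => by
    rw [norm_smul, mul_pow, Real.norm_eq_abs, sq_abs, Real.sq_sqrt (by norm_num)]; ring
  simp only [h4, Complex.finrank_real_complex] at h3
  rw [h3, ← h2]
  simp only [Finset.univ_unique, Finset.sum_singleton] at h1
  change ∫ u : Fin 1 → ℂ, truncPow β (1 - ‖u default‖ ^ 2 / 2) = _ at h1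
  change _ • ∫ u : Fin 1 → ℂ, truncPow β (1 - ‖u default‖ ^ 2 / 2) = _
  have hΓ := Real.Gamma_pos_of_pos (s := β + 1) (by linarith)
  have hβ1 : β + 1 ≠ 0 := by linarith
  rw [h1, truncPow_of_pos one_pos, Real.one_rpow, Real.sq_sqrt (by norm_num), fibreConst,
    Nat.cast_one, Real.Gamma_add_one hβ1, abs_of_pos (by norm_num)]
  simp only [smul_eq_mul]
  field_simp

/-! ### Siegel coordinates and the size of the kernel in the mean -/

lemma lintegral_truncPow_mul_one_add_rpow_lt_top {B p : ℝ} (hB : -1 < B) (hp : B + 1 < p) :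
    ∫⁻ y : ℝ, ENNReal.ofReal (truncPow B y * (1 + |y|) ^ (-p)) < ⊤ := by
  have h1 : ∫⁻ y in Set.Ioc (0 : ℝ) 1, ENNReal.ofReal (y ^ B) < ⊤ := by
    have : IntegrableOn (fun y : ℝ => y ^ B) (Set.Ioc 0 1) :=
      (intervalIntegrable_iff_integrableOn_Ioc_of_le zero_le_one).1
        (intervalIntegral.intervalIntegrable_rpow' hB)
    exact this.lintegral_lt_top
  have h2 : ∫⁻ y in Set.Ioi (1 : ℝ), ENNReal.ofReal (y ^ (B - p)) < ⊤ :=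
    (integrableOn_Ioi_rpow_of_lt (by linarith) one_pos).lintegral_lt_top
  have h3 : ∀ y : ℝ, ENNReal.ofReal (truncPow B y * (1 + |y|) ^ (-p)) ≤
      (Set.Ioc (0 : ℝ) 1).indicator (fun y => ENNReal.ofReal (y ^ B)) y
        + (Set.Ioi (1 : ℝ)).indicator (fun y => ENNReal.ofReal (y ^ (B - p))) y := by
    intro y
    rcases le_or_gt y 0 with hy | hy
    · simp [truncPow_of_nonpos hy]
    rw [truncPow_of_pos hy, abs_of_pos hy]
    rcases le_or_gt y 1 with hy1 | hy1
    · refine le_add_right ?_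
      rw [Set.indicator_of_mem (Set.mem_Ioc.2 ⟨hy, hy1⟩)]
      refine ENNReal.ofReal_le_ofReal (mul_le_of_le_one_right (by positivity) ?_)
      exact Real.rpow_le_one_of_one_le_of_nonpos (by linarith) (by linarith)
    · refine le_add_left ?_
      rw [Set.indicator_of_mem (Set.mem_Ioi.2 hy1), Real.rpow_sub hy, div_eq_mul_inv,
        ← Real.rpow_neg hy.le]
      refine ENNReal.ofReal_le_ofReal (mul_le_mul_of_nonneg_left ?_ (by positivity))
      exact Real.rpow_le_rpow_of_nonpos hy (by linarith) (by linarith)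
  refine (lintegral_mono h3).trans_lt ?_
  rw [lintegral_add_left (Measurable.indicator (by fun_prop) measurableSet_Ioc),
    lintegral_indicator measurableSet_Ioc, lintegral_indicator measurableSet_Ioi]
  exact ENNReal.add_lt_top.2 ⟨h1, h2⟩

lemma lintegral_halfPlaneKernel_one_lt_top {B s : ℝ} (hB : -1 < B) (hs : 2 + B < s) :
    ∫⁻ ω : ℂ, ENNReal.ofReal (truncPow B ω.im) *
      ENNReal.ofReal (‖((1 : ℝ) + Complex.I * (starRingEnd ℂ) ω) / 2‖ ^ (-s)) < ⊤ := by
  -- the decay `s` is split into `p > B + 1` for the variable `y` and `q > 1` for the variable `x`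
  set δ : ℝ := (s - 2 - B) / 2 with hδ
  have hδ0 : 0 < δ := by rw [hδ]; linarith
  set p := B + 1 + δ
  set q := 1 + δ
  have hs' : s = p + q := by simp only [p, q, hδ]; ring
  have hq : ∫⁻ x : ℝ, ENNReal.ofReal ((1 + |x|) ^ (-q)) < ⊤ := by
    have := integrable_one_add_norm (E := ℝ) (μ := volume) (r := q) (by simp [q, hδ0])
    exact this.lintegral_lt_top
  have hp := lintegral_truncPow_mul_one_add_rpow_lt_top hB (p := p) (by simp [p, hδ0])
  have hle : ∀ ω : ℂ, ENNReal.ofReal (truncPow B ω.im) *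
      ENNReal.ofReal (‖((1 : ℝ) + Complex.I * (starRingEnd ℂ) ω) / 2‖ ^ (-s)) ≤
      ENNReal.ofReal (4 ^ s) * (ENNReal.ofReal ((1 + |ω.re|) ^ (-q)) *
        ENNReal.ofReal (truncPow B ω.im * (1 + |ω.im|) ^ (-p))) := by
    intro ω
    rcases le_or_gt ω.im 0 with hy | hy
    · simp [truncPow_of_nonpos hy]
    rw [← ENNReal.ofReal_mul (truncPow_nonneg _ _), ← ENNReal.ofReal_mul (by positivity),
      ← ENNReal.ofReal_mul (by positivity)]
    refine ENNReal.ofReal_le_ofReal ?_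
    have h1 : (1 + |ω.re|) ^ (-q) * (truncPow B ω.im * (1 + |ω.im|) ^ (-p))
      = truncPow B ω.im * ((1 + |ω.im|) ^ (-p) * (1 + |ω.re|) ^ (-q)) := by ring
    rw [h1, mul_left_comm]
    refine mul_le_mul_of_nonneg_left ?_ (truncPow_nonneg _ _)
    set N := ‖((1 : ℝ) + Complex.I * (starRingEnd ℂ) ω) / 2‖ with hN
    have hre : (((1 : ℝ) + Complex.I * (starRingEnd ℂ) ω) / 2).re = (1 + ω.im) / 2 := by
      rw [show (2 : ℂ) = ((2 : ℝ) : ℂ) by norm_num, Complex.div_ofReal_re]; simp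
    have him : (((1 : ℝ) + Complex.I * (starRingEnd ℂ) ω) / 2).im = ω.re / 2 := by
      rw [show (2 : ℂ) = ((2 : ℝ) : ℂ) by norm_num, Complex.div_ofReal_im]; simp
    have hN1 : (1 + ω.im) / 2 ≤ N := by rw [← hre]; exact Complex.re_le_norm _
    have hN2 : |ω.re| / 2 ≤ N := by
      have := Complex.abs_im_le_norm (((1 : ℝ) + Complex.I * (starRingEnd ℂ) ω) / 2)
      rwa [him, abs_div, abs_two] at this
    have hy' := abs_of_pos hy
    have hx := abs_nonneg ω.re
    have hNpos : 0 < N := by linarith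
    have e1 : 1 + |ω.im| ≤ 4 * N := by rw [hy']; linarith
    have e2 : 1 + |ω.re| ≤ 4 * N := by linarith
    have e3 : (4 * N) ^ (-p) ≤ (1 + |ω.im|) ^ (-p) :=
      Real.rpow_le_rpow_of_nonpos (by positivity) e1 (by simp only [p]; linarith)
    have e4 : (4 * N) ^ (-q) ≤ (1 + |ω.re|) ^ (-q) :=
      Real.rpow_le_rpow_of_nonpos (by positivity) e2 (by simp only [q]; linarith)
    calc N ^ (-s) = 4 ^ s * ((4 * N) ^ (-p) * (4 * N) ^ (-q)) := by
          rw [← Real.rpow_add (by positivity), ← neg_add, ← hs',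
            Real.mul_rpow (by norm_num) hNpos.le, ← mul_assoc, ← Real.rpow_add (by norm_num)]
          simp
      _ ≤ _ := by gcongr
  refine (lintegral_mono hle).trans_lt ?_
  rw [lintegral_const_mul' _ _ ENNReal.ofReal_ne_top]
  refine ENNReal.mul_lt_top ENNReal.ofReal_lt_top ?_
  have hmp := Complex.volume_preserving_equiv_real_prod
  have := hmp.lintegral_comp_emb (MeasurableEquiv.measurableEmbedding _) (fun x : ℝ × ℝ =>
    ENNReal.ofReal ((1 + |x.1|) ^ (-q)) * ENNReal.ofReal (truncPow B x.2 * (1 + |x.2|) ^ (-p)))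
  simp only [Complex.measurableEquivRealProd_apply] at this
  rw [this, Measure.volume_eq_prod, lintegral_prod_mul
    (f := fun x : ℝ => ENNReal.ofReal ((1 + |x|) ^ (-q)))
    (g := fun y : ℝ => ENNReal.ofReal (truncPow B y * (1 + |y|) ^ (-p)))]
  · exact ENNReal.mul_lt_top hq hp
  · exact Measurable.aemeasurable (by fun_prop)
  · exact (((measurable_truncPow B).mul (by fun_prop)).ennreal_ofReal).aemeasurable

/-- The mean size of `|r + i ω̄|^{-s}` over the half plane, with its homogeneity in `r`. -/
lemma exists_lintegral_halfPlaneKernel_eq {B s : ℝ} (hB : -1 < B) (hs : 2 + B < s) :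
    ∃ K : ℝ, 0 ≤ K ∧ ∀ r : ℝ, 0 < r → ∫⁻ ω : ℂ, ENNReal.ofReal (truncPow B ω.im) *
      ENNReal.ofReal (‖((r : ℂ) + Complex.I * (starRingEnd ℂ) ω) / 2‖ ^ (-s))
        = ENNReal.ofReal (K * r ^ (2 + B - s)) := by
  have hfin := lintegral_halfPlaneKernel_one_lt_top hB hs
  refine ⟨(∫⁻ ω : ℂ, ENNReal.ofReal (truncPow B ω.im) * ENNReal.ofReal
    (‖((1 : ℝ) + Complex.I * (starRingEnd ℂ) ω) / 2‖ ^ (-s))).toReal, ENNReal.toReal_nonneg,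
    fun r hr => ?_⟩
  rw [ENNReal.ofReal_mul ENNReal.toReal_nonneg, ENNReal.ofReal_toReal hfin.ne]
  have h1 := lintegral_comp_smul (volume : Measure ℂ) (fun ω : ℂ => ENNReal.ofReal (truncPow B ω.im)
    * ENNReal.ofReal (‖((r : ℂ) + Complex.I * (starRingEnd ℂ) ω) / 2‖ ^ (-s))) hr.ne'
  have h2 : ∀ ω : ℂ, ENNReal.ofReal (truncPow B (r • ω).im)
      * ENNReal.ofReal (‖((r : ℂ) + Complex.I * (starRingEnd ℂ) (r • ω)) / 2‖ ^ (-s))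
      = ENNReal.ofReal (r ^ (B - s)) * (ENNReal.ofReal (truncPow B ω.im) *
      ENNReal.ofReal (‖((1 : ℝ) + Complex.I * (starRingEnd ℂ) ω) / 2‖ ^ (-s))) := by
    intro ω
    have e1 : ((r : ℂ) + Complex.I * (starRingEnd ℂ) (r • ω)) / 2
        = r * (((1 : ℝ) + Complex.I * (starRingEnd ℂ) ω) / 2) := by
      rw [Complex.real_smul, map_mul, Complex.conj_ofReal]; push_cast; ring
    rw [e1, norm_mul, Complex.norm_real, Real.norm_eq_abs, abs_of_pos hr, Complex.smul_im,
      smul_eq_mul, truncPow_mul hr, Real.mul_rpow hr.le (norm_nonneg _),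
      ENNReal.ofReal_mul (by positivity), ENNReal.ofReal_mul (by positivity), sub_eq_add_neg B s,
      Real.rpow_add hr, ENNReal.ofReal_mul (by positivity)]
    ring
  simp only [h2] at h1
  rw [lintegral_const_mul' _ _ ENNReal.ofReal_ne_top, Complex.finrank_real_complex,
    abs_of_pos (by positivity)] at h1
  rw [mul_comm, show 2 + B - s = 2 + (B - s) by ring, Real.rpow_add hr,
    ENNReal.ofReal_mul (by positivity), mul_assoc, h1, ← mul_assoc,
    ← ENNReal.ofReal_mul (by positivity), Real.rpow_two, mul_inv_cancel₀ (by positivity)]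
  simp

/-- The holomorphic coordinates `(u, ω)` centred at `z` which turn `T_B` into the Siegel domain
`|u|²/2 < Im ω`, the base point `z` corresponding to `(0, i ρ(z))`. -/
noncomputable def siegelMap {m : ℕ} (z p : CSpace m) : CSpace m :=
  (z.1 + p.1, (z.2 - Complex.I * tubeRho z
    + ∑ j, (2 * ((z.1 j).im : ℂ) * p.1 j - Complex.I / 2 * p.1 j ^ 2)) + p.2)

lemma tubeRho_siegelMap {m : ℕ} (z p : CSpace m) :
    tubeRho (siegelMap z p) = p.2.im - ∑ j, ‖p.1 j‖ ^ 2 / 2 := by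
  have h : ∀ j, ‖p.1 j‖ ^ 2 / 2 = ((p.1 j).re ^ 2 + (p.1 j).im ^ 2) / 2 := fun j => by
    rw [← Complex.normSq_eq_norm_sq, Complex.normSq_apply]; ring
  have h2 : ∀ j, (2 * ((z.1 j).im : ℂ) * p.1 j - Complex.I / 2 * p.1 j ^ 2).im
      = ((z.1 j).im + (p.1 j).im) ^ 2 - (z.1 j).im ^ 2 - ‖p.1 j‖ ^ 2 / 2 := by
    intro j
    rw [h, show (2 * ((z.1 j).im : ℂ) * p.1 j - Complex.I / 2 * p.1 j ^ 2)
      = ((2 * (z.1 j).im : ℝ) : ℂ) * p.1 j - ((1 / 2 : ℝ) : ℂ) * (Complex.I * p.1 j ^ 2) by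
        push_cast; ring, Complex.sub_im, Complex.im_ofReal_mul, Complex.im_ofReal_mul,
        Complex.I_mul_im, pow_two (p.1 j), Complex.mul_re]
    ring
  have h3 : (∑ j, (2 * ((z.1 j).im : ℂ) * p.1 j - Complex.I / 2 * p.1 j ^ 2)).im
      = ∑ j, ((z.1 j).im + (p.1 j).im) ^ 2 - ∑ j, (z.1 j).im ^ 2 - ∑ j, ‖p.1 j‖ ^ 2 / 2 := by
    rw [Complex.im_sum, Finset.sum_congr rfl fun j _ => h2 j, Finset.sum_sub_distrib,
      Finset.sum_sub_distrib]
  simp only [tubeRho, siegelMap, Complex.add_im, h3, Pi.add_apply, Complex.sub_im,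
    Complex.I_mul_im, Complex.ofReal_re]
  ring

lemma tubeRho₂_siegelMap {m : ℕ} (z p : CSpace m) :
    tubeRho₂ z (siegelMap z p) = ((tubeRho z : ℂ) + Complex.I * (starRingEnd ℂ) p.2) / 2 := by
  set Q : ℂ := ∑ j, (2 * ((z.1 j).im : ℂ) * p.1 j - Complex.I / 2 * p.1 j ^ 2) with hQ
  have h : ∀ j, (z.1 j - (starRingEnd ℂ) (z.1 j + p.1 j)) ^ 2
      = -(2 * Complex.I) * (starRingEnd ℂ)
          (2 * ((z.1 j).im : ℂ) * p.1 j - Complex.I / 2 * p.1 j ^ 2)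
        - 4 * ((z.1 j).im : ℂ) ^ 2 := by
    intro j
    have e : z.1 j - (starRingEnd ℂ) (z.1 j) = 2 * (z.1 j).im * Complex.I := by
      rw [Complex.sub_conj]; push_cast; ring
    rw [map_add, ← sub_sub, e]
    simp only [map_sub, map_mul, map_pow, Complex.conj_I, Complex.conj_ofReal, map_div₀,
      map_ofNat]
    linear_combination (4 * ((z.1 j).im : ℂ) ^ 2 + (starRingEnd ℂ) (p.1 j) ^ 2) * Complex.I_mul_I
  have hsum : ∑ j, (z.1 j - (starRingEnd ℂ) (z.1 j + p.1 j)) ^ 2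
      = -(2 * Complex.I) * (starRingEnd ℂ) Q - 4 * ∑ j, ((z.1 j).im : ℂ) ^ 2 := by
    rw [Finset.sum_congr rfl fun j _ => h j, Finset.sum_sub_distrib, ← Finset.mul_sum,
      ← Finset.mul_sum, hQ, map_sum]
  have e2 : z.2 - (starRingEnd ℂ) z.2 = 2 * (z.2).im * Complex.I := by
    rw [Complex.sub_conj]; push_cast; ring
  have hρ : (tubeRho z : ℂ) = ((z.2).im : ℂ) - ∑ j, ((z.1 j).im : ℂ) ^ 2 := by
    simp [tubeRho]
  have hlast : z.2 - (starRingEnd ℂ) (siegelMap z p).2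
      = 2 * (z.2).im * Complex.I - Complex.I * tubeRho z - (starRingEnd ℂ) Q
        - (starRingEnd ℂ) p.2 := by
    rw [← e2]
    simp only [siegelMap, map_add, map_sub, map_mul, Complex.conj_I, Complex.conj_ofReal, ← hQ]
    ring
  have hfirst : (siegelMap z p).1 = z.1 + p.1 := rfl
  simp only [tubeRho₂, hlast, hfirst, Pi.add_apply, hsum, hρ]
  linear_combination ((-1/2) * (((z.2).im : ℂ)) - (1/2) * ∑ j, ((z.1 j).im : ℂ) ^ 2)
    * Complex.I_mul_I

lemma continuous_siegelMap {m : ℕ} (z : CSpace m) : Continuous (siegelMap z) := by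
  unfold siegelMap; fun_prop

lemma siegelMap_injective {m : ℕ} (z : CSpace m) : Function.Injective (siegelMap z) := by
  rintro ⟨u, ω⟩ ⟨u', ω'⟩ h
  simp only [siegelMap, Prod.mk.injEq, add_right_inj] at h
  obtain ⟨rfl, h2⟩ := h
  simpa using h2

lemma measurePreserving_siegelMap {m : ℕ} (z : CSpace m) :
    MeasurePreserving (siegelMap z) volume volume := by
  have := (measurePreserving_add_left (volume : Measure (Fin m → ℂ)) z.1).skew_product
    (μc := (volume : Measure ℂ)) (μd := (volume : Measure ℂ))
    (g := fun u ω => (z.2 - Complex.I * tubeRho z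
    + ∑ j, (2 * ((z.1 j).im : ℂ) * u j - Complex.I / 2 * u j ^ 2)) + ω)
    (Continuous.measurable (by unfold Function.uncurry; fun_prop))
    (Filter.Eventually.of_forall fun u => map_add_left_eq_self _ _)
  exact this

lemma measurableEmbedding_siegelMap {m : ℕ} (z : CSpace m) :
    MeasurableEmbedding (siegelMap z) :=
  (continuous_siegelMap z).measurableEmbedding (siegelMap_injective z)

/-- The mean size of the kernel: `∫ ρ(w)^β |ρ(z,w)|^{-s} dV(w) = C ρ(z)^{n+1+β-s}`. -/
lemma exists_lintegral_tubeRho₂_eq (m : ℕ) {β s : ℝ} (hβ : -1 < β) (hs : m + 2 + β < s) :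
    ∃ K : ℝ, 0 ≤ K ∧ ∀ z ∈ tubeDomain m,
      ∫⁻ w, ENNReal.ofReal (truncPow β (tubeRho w)) * ENNReal.ofReal (‖tubeRho₂ z w‖ ^ (-s))
        = ENNReal.ofReal (K * tubeRho z ^ (m + 2 + β - s)) := by
  have hm0 : (0 : ℝ) ≤ m := Nat.cast_nonneg m
  obtain ⟨K, hK0, hK⟩ := exists_lintegral_halfPlaneKernel_eq (B := β + m) (s := s)
    (by linarith) (by linarith)
  refine ⟨fibreConst m β * K, mul_nonneg (fibreConst_pos m hβ).le hK0, fun z hz => ?_⟩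
  rw [mem_tubeDomain_iff] at hz
  rw [← (measurePreserving_siegelMap z).lintegral_comp_emb (measurableEmbedding_siegelMap z)]
  simp only [tubeRho_siegelMap, tubeRho₂_siegelMap]
  rw [Measure.volume_eq_prod, lintegral_prod_symm]
  · simp only
    have h1 : ∀ ω : ℂ,
        ∫⁻ u : Fin m → ℂ, ENNReal.ofReal (truncPow β (ω.im - ∑ j, ‖u j‖ ^ 2 / 2)) *
        ENNReal.ofReal (‖((tubeRho z : ℂ) + Complex.I * (starRingEnd ℂ) ω) / 2‖ ^ (-s))
        = ENNReal.ofReal (fibreConst m β) * (ENNReal.ofReal (truncPow (β + m) ω.im) *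
        ENNReal.ofReal (‖((tubeRho z : ℂ) + Complex.I * (starRingEnd ℂ) ω) / 2‖ ^ (-s))) := by
      intro ω
      rw [lintegral_mul_const' _ _ ENNReal.ofReal_ne_top, lintegral_truncPow_sub_sum m hβ]
      ring
    simp only [h1]
    rw [lintegral_const_mul' _ _ ENNReal.ofReal_ne_top, hK _ hz,
      ← ENNReal.ofReal_mul (fibreConst_pos m hβ).le]
    congr 1
    rw [show 2 + (β + m) - s = m + 2 + β - s by ring]; ring
  · have hconj : Continuous (starRingEnd ℂ) := Complex.continuous_conj
    have h1 : Measurable fun p : CSpace m => truncPow β (p.2.im - ∑ j, ‖p.1 j‖ ^ 2 / 2) :=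
      (measurable_truncPow β).comp (Continuous.measurable (by fun_prop))
    have h2 : Measurable fun p : CSpace m =>
        ‖((tubeRho z : ℂ) + Complex.I * (starRingEnd ℂ) p.2) / 2‖ ^ (-s) :=
      (Continuous.measurable (by fun_prop)).pow_const _
    exact (h1.ennreal_ofReal.mul h2.ennreal_ofReal).aemeasurable

/-! ### The modified projection on functions of moderate growth -/

/-- The exponent `n + 1 + α` of the kernel, `n = m + 1`. -/
noncomputable def kernelExp (m : ℕ) (α : ℝ) : ℝ := (m + 1 : ℕ) + 1 + α

lemma kernelExp_eq (m : ℕ) (α : ℝ) : kernelExp m α = m + 2 + α := by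
  unfold kernelExp; push_cast; ring

lemma kernelExp_pos (m : ℕ) {α : ℝ} (hα : -1 < α) : 0 < kernelExp m α := by
  have : (0 : ℝ) ≤ m := Nat.cast_nonneg m
  rw [kernelExp_eq]; linarith

/-- The normalizing constant of the kernel. -/
noncomputable def kernelConst (m : ℕ) (α : ℝ) : ℝ :=
  Real.Gamma (kernelExp m α) / (2 ^ ((m + 1) + 1) * Real.pi ^ (m + 1) * Real.Gamma (α + 1))

lemma kernelConst_pos (m : ℕ) {α : ℝ} (hα : -1 < α) : 0 < kernelConst m α := by
  have h1 := Real.Gamma_pos_of_pos (kernelExp_pos m hα)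
  have h2 := Real.Gamma_pos_of_pos (s := α + 1) (by linarith)
  unfold kernelConst
  positivity

lemma tubeKernel_eq {m : ℕ} (α : ℝ) (z w : CSpace m) :
    tubeKernel α z w = kernelConst m α * tubeRho₂ z w ^ ((-kernelExp m α : ℝ) : ℂ) := by
  rw [Complex.ofReal_neg, Complex.cpow_neg, ← div_eq_mul_inv]
  rfl

/-- The complex derivative of `z ↦ K_α(z,w)`. -/
noncomputable def tubeKernelDeriv {m : ℕ} (α : ℝ) (z w : CSpace m) : CSpace m →L[ℂ] ℂ :=
  (kernelConst m α * (-kernelExp m α : ℝ) * tubeRho₂ z w ^ ((-(kernelExp m α + 1) : ℝ) : ℂ)) •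
    tubeRho₂Deriv z w

lemma hasFDerivAt_tubeKernel {m : ℕ} (α : ℝ) {z w : CSpace m} (hz : z ∈ tubeDomain m)
    (hw : w ∈ tubeDomain m) :
    HasFDerivAt (fun z => tubeKernel α z w) (tubeKernelDeriv α z w) z := by
  simp only [tubeKernel_eq]
  have h1 := (Complex.hasStrictDerivAt_cpow_const (c := ((-kernelExp m α : ℝ) : ℂ))
    (tubeRho₂_mem_slitPlane hz hw)).hasDerivAt.comp_hasFDerivAt z (hasFDerivAt_tubeRho₂ z w)
  have h2 := h1.const_mul (kernelConst m α : ℂ)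
  refine h2.congr_fderiv ?_
  rw [tubeKernelDeriv, smul_smul]
  congr 1
  push_cast
  rw [show -(kernelExp m α : ℂ) - 1 = -((kernelExp m α : ℂ) + 1) by ring]
  ring

lemma norm_tubeKernelDeriv_apply {m : ℕ} {α : ℝ} (hα : -1 < α) (z w δ : CSpace m) :
    ‖tubeKernelDeriv α z w δ‖ = kernelConst m α * kernelExp m α *
      ‖tubeRho₂ z w‖ ^ (-(kernelExp m α + 1)) * ‖tubeRho₂Deriv z w δ‖ := by
  rw [tubeKernelDeriv, smul_apply, norm_smul, norm_mul, norm_mul,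
    Complex.norm_cpow_real, Complex.norm_real, Complex.norm_real, norm_neg, Real.norm_eq_abs,
    Real.norm_eq_abs, abs_of_pos (kernelConst_pos m hα), abs_of_pos (kernelExp_pos m hα)]

lemma norm_tubeKernelDeriv {m : ℕ} {α : ℝ} (hα : -1 < α) (z w : CSpace m) :
    ‖tubeKernelDeriv α z w‖ = kernelConst m α * kernelExp m α *
      ‖tubeRho₂ z w‖ ^ (-(kernelExp m α + 1)) * ‖tubeRho₂Deriv z w‖ := by
  rw [tubeKernelDeriv, norm_smul, norm_mul, norm_mul,
    Complex.norm_cpow_real, Complex.norm_real, Complex.norm_real, norm_neg, Real.norm_eq_abs,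
    Real.norm_eq_abs, abs_of_pos (kernelConst_pos m hα), abs_of_pos (kernelExp_pos m hα)]

lemma norm_tubeBase_le (m : ℕ) : ‖tubeBase m‖ ≤ 1 := by
  simp [tubeBase, Prod.norm_def]

/-- Locally uniformly in `z`, differentiation improves the decay of the kernel in `w` by
`|ρ(𝐢,w)|^{-1/2}`. -/
lemma exists_norm_tubeKernelDeriv_le (m : ℕ) {α : ℝ} (hα : -1 < α) (M r : ℝ) (hM : 1 ≤ M)
    (hr : 0 < r) :
    ∃ L : ℝ, 0 < L ∧ ∀ z w : CSpace m, ‖z‖ ≤ M → r ≤ tubeRho z → w ∈ tubeDomain m →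
      ‖tubeKernelDeriv α z w‖ ≤ L * ‖tubeRho₂ (tubeBase m) w‖ ^ (-(kernelExp m α + 1 / 2)) := by
  obtain ⟨L₁, hL₁, h₁⟩ := exists_norm_tubeRho₂_le_mul m M r (by linarith) hr
  obtain ⟨L₂, hL₂, h₂⟩ := exists_norm_tubeRho₂Deriv_le m M r (by linarith) hr
  have hc := kernelConst_pos m hα
  have he := kernelExp_pos m hα
  refine ⟨kernelConst m α * kernelExp m α * L₂ * L₁ ^ (kernelExp m α + 1 / 2), by positivity, ?_⟩
  intro z w hz hrz hw
  have hzm : z ∈ tubeDomain m := mem_tubeDomain_iff.2 (hr.trans_le hrz)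
  have hN := norm_tubeRho₂_pos hzm hw
  have hB := norm_tubeRho₂_pos (tubeBase_mem (m := m)) hw
  have hcmp := h₁ z (tubeBase m) w hz ((norm_tubeBase_le m).trans hM) hrz hw
  have hpow : ‖tubeRho₂ z w‖ ^ (-(kernelExp m α + 1 / 2)) ≤
      L₁ ^ (kernelExp m α + 1 / 2) * ‖tubeRho₂ (tubeBase m) w‖ ^ (-(kernelExp m α + 1 / 2)) := by
    have h := Real.rpow_le_rpow_of_nonpos hB hcmp
      (show -(kernelExp m α + 1 / 2) ≤ 0 by linarith)
    rw [Real.mul_rpow hL₁.le hN.le] at h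
    calc _ = L₁ ^ (kernelExp m α + 1 / 2) * (L₁ ^ (-(kernelExp m α + 1 / 2)) *
        ‖tubeRho₂ z w‖ ^ (-(kernelExp m α + 1 / 2))) := by
          rw [← mul_assoc, ← Real.rpow_add hL₁, add_neg_cancel, Real.rpow_zero, one_mul]
      _ ≤ _ := by gcongr
  rw [norm_tubeKernelDeriv hα]
  calc kernelConst m α * kernelExp m α *
      ‖tubeRho₂ z w‖ ^ (-(kernelExp m α + 1)) * ‖tubeRho₂Deriv z w‖
      ≤ kernelConst m α * kernelExp m α *
      ‖tubeRho₂ z w‖ ^ (-(kernelExp m α + 1)) * (L₂ * ‖tubeRho₂ z w‖ ^ (1 / 2 : ℝ)) := by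
        gcongr; exact h₂ z w hz hrz hw
    _ = kernelConst m α * kernelExp m α * L₂ * ‖tubeRho₂ z w‖ ^ (-(kernelExp m α + 1 / 2)) := by
        rw [show -(kernelExp m α + 1 / 2) = -(kernelExp m α + 1) + 1 / 2 by ring,
          Real.rpow_add hN]
        ring
    _ ≤ kernelConst m α * kernelExp m α * L₂ * (L₁ ^ (kernelExp m α + 1 / 2) *
        ‖tubeRho₂ (tubeBase m) w‖ ^ (-(kernelExp m α + 1 / 2))) := by gcongr
    _ = _ := by ring

lemma exists_norm_tubeModKernel_le {m : ℕ} {α : ℝ} (hα : -1 < α) {z : CSpace m}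
    (hz : z ∈ tubeDomain m) :
    ∃ L : ℝ, 0 < L ∧ ∀ w ∈ tubeDomain m,
      ‖tubeModKernel α z w‖ ≤ L * ‖tubeRho₂ (tubeBase m) w‖ ^ (-(kernelExp m α + 1 / 2)) := by
  have hz' := mem_tubeDomain_iff.1 hz
  obtain ⟨L, hL, h⟩ := exists_norm_tubeKernelDeriv_le m hα (max 1 ‖z‖) (min 1 (tubeRho z))
    (le_max_left _ _) (lt_min one_pos hz')
  refine ⟨L * (‖z - tubeBase m‖ + 1), by positivity, fun w hw => ?_⟩
  set S : Set (CSpace m) := Metric.closedBall 0 (max 1 ‖z‖) ∩ {x | min 1 (tubeRho z) ≤ tubeRho x}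
  have hS : Convex ℝ S := (convex_closedBall _ _).inter (convex_le_tubeRho _)
  have hST : ∀ x ∈ S, x ∈ tubeDomain m := fun x hx =>
    mem_tubeDomain_iff.2 ((lt_min one_pos hz').trans_le hx.2)
  have := hS.norm_image_sub_le_of_norm_hasFDerivWithin_le (𝕜 := ℂ)
    (f := fun x => tubeKernel α x w) (f' := fun x => tubeKernelDeriv α x w)
    (C := L * ‖tubeRho₂ (tubeBase m) w‖ ^ (-(kernelExp m α + 1 / 2)))
    (x := tubeBase m) (y := z)
    (fun x hx => (hasFDerivAt_tubeKernel α (hST x hx) hw).hasFDerivWithinAt)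
    (fun x hx => h x w (by simpa using hx.1) hx.2 hw)
    ⟨by simpa using Or.inl (norm_tubeBase_le m), by simp [tubeRho_tubeBase]⟩
    ⟨by simp, by simp⟩
  refine (show ‖tubeModKernel α z w‖ ≤ _ from this).trans ?_
  have h0 : 0 ≤ ‖tubeRho₂ (tubeBase m) w‖ ^ (-(kernelExp m α + 1 / 2)) := by positivity
  nlinarith [mul_nonneg hL.le h0]

/-- `|f(w)| ≤ C ρ(w)^{-ε} |ρ(𝐢,w)|^{2ε}` on `T_B`: a growth condition which for `ε = 0` says that
`f` is essentially bounded by `C`, and which for every `ε > 0` holds for Bloch functions. -/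
structure HasTubeGrowth {m : ℕ} (ε C : ℝ) (f : CSpace m → ℂ) : Prop where
  aestronglyMeasurable : AEStronglyMeasurable f (tubeVolume m)
  bound : ∀ᵐ w ∂(tubeVolume m),
    ‖f w‖ ≤ C * (tubeRho w ^ (-ε) * ‖tubeRho₂ (tubeBase m) w‖ ^ (2 * ε))

lemma measurable_ofReal_tubeRho_rpow (m : ℕ) (α : ℝ) :
    Measurable fun w : CSpace m => ENNReal.ofReal (tubeRho w ^ α) :=
  (continuous_tubeRho.measurable.pow_const α).ennreal_ofReal

lemma tubeWeighted_absolutelyContinuous (m : ℕ) (α : ℝ) : tubeWeighted m α ≪ tubeVolume m :=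
  withDensity_absolutelyContinuous _ _

lemma ae_tubeVolume_mem (m : ℕ) : ∀ᵐ w ∂(tubeVolume m), w ∈ tubeDomain m :=
  ae_restrict_mem isOpen_tubeDomain.measurableSet

lemma ae_tubeWeighted_mem (m : ℕ) (α : ℝ) : ∀ᵐ w ∂(tubeWeighted m α), w ∈ tubeDomain m :=
  (tubeWeighted_absolutelyContinuous m α).ae_le (ae_tubeVolume_mem m)

lemma measurable_norm_tubeRho₂_rpow {m : ℕ} (z : CSpace m) (s : ℝ) :
    Measurable fun w => ‖tubeRho₂ z w‖ ^ s :=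
  (continuous_tubeRho₂_right z).norm.measurable.pow_const s

/-- The absolute integral of a kernel of order `s` against a function of growth `ε`, with its
dependence on `z`. The comparison factor `L` enters only through `L^{2ε}`, so it is harmless for
bounded functions. -/
lemma exists_integral_norm_tubeRho₂_mul_le (m : ℕ) {α ε s : ℝ} (hε : 0 ≤ ε) (hεα : ε < α + 1)
    (hs : m + 2 + α + ε < s) :
    ∃ K : ℝ, 0 ≤ K ∧ ∀ (C : ℝ) (f : CSpace m → ℂ), 0 ≤ C → HasTubeGrowth ε C f →
      ∀ (z : CSpace m) (L : ℝ), z ∈ tubeDomain m → 0 ≤ L →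
      (∀ w ∈ tubeDomain m, ‖tubeRho₂ (tubeBase m) w‖ ≤ L * ‖tubeRho₂ z w‖) →
      Integrable (fun w => ‖tubeRho₂ z w‖ ^ (-s) * ‖f w‖) (tubeWeighted m α) ∧
        ∫ w, ‖tubeRho₂ z w‖ ^ (-s) * ‖f w‖ ∂(tubeWeighted m α)
          ≤ K * C * L ^ (2 * ε) * tubeRho z ^ (m + 2 + α + ε - s) := by
  obtain ⟨K, hK0, hK⟩ := exists_lintegral_tubeRho₂_eq m (β := α - ε) (s := s - 2 * ε)
    (by linarith) (by linarith)
  refine ⟨K, hK0, fun C f hC hf z L hz hL hcmp => ?_⟩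
  have hz' := mem_tubeDomain_iff.1 hz
  have hfm : AEStronglyMeasurable (fun w => ‖tubeRho₂ z w‖ ^ (-s) * ‖f w‖) (tubeVolume m) :=
    (measurable_norm_tubeRho₂_rpow z (-s)).aestronglyMeasurable.mul hf.aestronglyMeasurable.norm
  have hle : ∫⁻ w, ENNReal.ofReal (‖tubeRho₂ z w‖ ^ (-s) * ‖f w‖) ∂(tubeWeighted m α)
      ≤ ENNReal.ofReal (K * C * L ^ (2 * ε) * tubeRho z ^ (m + 2 + α + ε - s)) := by
    rw [tubeWeighted, lintegral_withDensity_eq_lintegral_mul₀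
      (measurable_ofReal_tubeRho_rpow m α).aemeasurable hfm.aemeasurable.ennreal_ofReal]
    calc _ ≤ ∫⁻ w, ENNReal.ofReal (C * L ^ (2 * ε)) *
          (ENNReal.ofReal (truncPow (α - ε) (tubeRho w)) *
          ENNReal.ofReal (‖tubeRho₂ z w‖ ^ (-(s - 2 * ε)))) ∂(tubeVolume m) := by
          refine lintegral_mono_ae ?_
          filter_upwards [hf.bound, ae_tubeVolume_mem m] with w hw hwm
          have hρ := mem_tubeDomain_iff.1 hwm
          have hN := norm_tubeRho₂_pos hz hwm
          rw [Pi.mul_apply, ← ENNReal.ofReal_mul (by positivity),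
            ← ENNReal.ofReal_mul (truncPow_nonneg _ _), ← ENNReal.ofReal_mul (by positivity),
            truncPow_of_pos hρ]
          refine ENNReal.ofReal_le_ofReal ?_
          calc tubeRho w ^ α * (‖tubeRho₂ z w‖ ^ (-s) * ‖f w‖)
              ≤ tubeRho w ^ α * (‖tubeRho₂ z w‖ ^ (-s) *
                (C * (tubeRho w ^ (-ε) * (L * ‖tubeRho₂ z w‖) ^ (2 * ε)))) := by
                gcongr
                refine hw.trans ?_
                gcongr
                exact hcmp w hwm
            _ = C * L ^ (2 * ε) * ((tubeRho w ^ α * tubeRho w ^ (-ε)) *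
                (‖tubeRho₂ z w‖ ^ (-s) * ‖tubeRho₂ z w‖ ^ (2 * ε))) := by
                rw [Real.mul_rpow hL hN.le]; ring
            _ = _ := by
                rw [← Real.rpow_add hρ, ← Real.rpow_add hN, ← sub_eq_add_neg,
                  show -s + 2 * ε = -(s - 2 * ε) by ring]
      _ ≤ ∫⁻ w, ENNReal.ofReal (C * L ^ (2 * ε)) *
          (ENNReal.ofReal (truncPow (α - ε) (tubeRho w)) *
          ENNReal.ofReal (‖tubeRho₂ z w‖ ^ (-(s - 2 * ε)))) := setLIntegral_le_lintegral _ _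
      _ = _ := by
          rw [lintegral_const_mul' _ _ ENNReal.ofReal_ne_top, hK z hz,
            ← ENNReal.ofReal_mul (by positivity)]
          congr 1
          rw [show (m : ℝ) + 2 + (α - ε) - (s - 2 * ε) = m + 2 + α + ε - s by ring]
          ring
  have hnn : ∀ w, 0 ≤ ‖tubeRho₂ z w‖ ^ (-s) * ‖f w‖ := fun w => by positivity
  have hfm' := hfm.mono_ac (tubeWeighted_absolutelyContinuous m α)
  have hint : Integrable (fun w => ‖tubeRho₂ z w‖ ^ (-s) * ‖f w‖) (tubeWeighted m α) := by
    refine ⟨hfm', ?_⟩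
    rw [hasFiniteIntegral_iff_ofReal (Filter.Eventually.of_forall hnn)]
    exact hle.trans_lt ENNReal.ofReal_lt_top
  refine ⟨hint, ?_⟩
  rw [← ENNReal.ofReal_le_ofReal_iff (by positivity),
    ofReal_integral_eq_lintegral_ofReal hint (Filter.Eventually.of_forall hnn)]
  exact hle

section Projection

variable {m : ℕ} {α ε C : ℝ} {f : CSpace m → ℂ}

lemma HasTubeGrowth.integrable_majorant (hε : 0 ≤ ε) (hεα : ε < α + 1)
    (hε2 : ε < 1 / 2) (hC : 0 ≤ C) (hf : HasTubeGrowth ε C f) :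
    Integrable (fun w => ‖tubeRho₂ (tubeBase m) w‖ ^ (-(kernelExp m α + 1 / 2)) * ‖f w‖)
      (tubeWeighted m α) := by
  obtain ⟨K, -, hK⟩ := exists_integral_norm_tubeRho₂_mul_le m (s := kernelExp m α + 1 / 2) hε hεα
    (by rw [kernelExp_eq]; linarith)
  exact (hK C f hC hf (tubeBase m) 1 tubeBase_mem zero_le_one (by simp)).1

lemma measurable_tubeKernel (z : CSpace m) : Measurable (tubeKernel α z) := by
  unfold tubeKernel
  exact measurable_const.div ((continuous_tubeRho₂_right z).measurable.pow_const _)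

lemma HasTubeGrowth.aestronglyMeasurable_tubeWeighted (hf : HasTubeGrowth ε C f) :
    AEStronglyMeasurable f (tubeWeighted m α) :=
  hf.aestronglyMeasurable.mono_ac (tubeWeighted_absolutelyContinuous m α)

lemma HasTubeGrowth.integrable_tubeModKernel_mul (hα : -1 < α) (hε : 0 ≤ ε) (hεα : ε < α + 1)
    (hε2 : ε < 1 / 2) (hC : 0 ≤ C) (hf : HasTubeGrowth ε C f) {z : CSpace m}
    (hz : z ∈ tubeDomain m) :
    Integrable (fun w => tubeModKernel α z w * f w) (tubeWeighted m α) := by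
  obtain ⟨L, hL, h⟩ := exists_norm_tubeModKernel_le hα hz
  refine ((hf.integrable_majorant hε hεα hε2 hC).const_mul L).mono' ?_ ?_
  · exact (((measurable_tubeKernel z).sub
      (measurable_tubeKernel _)).aestronglyMeasurable).mul hf.aestronglyMeasurable_tubeWeighted
  · filter_upwards [ae_tubeWeighted_mem m α] with w hw
    rw [norm_mul, ← mul_assoc]
    gcongr
    exact h w hw

lemma measurable_tubeKernelDeriv (z : CSpace m) : Measurable (tubeKernelDeriv α z) := by
  have h1 : Continuous (tubeRho₂Deriv z) := by
    have : Continuous (starRingEnd ℂ) := Complex.continuous_conj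
    unfold tubeRho₂Deriv
    fun_prop
  exact (measurable_const.mul ((continuous_tubeRho₂_right z).measurable.pow_const _)).smul
    h1.measurable

lemma HasTubeGrowth.integrable_smul_tubeKernelDeriv (hα : -1 < α) (hε : 0 ≤ ε)
    (hεα : ε < α + 1) (hε2 : ε < 1 / 2) (hC : 0 ≤ C) (hf : HasTubeGrowth ε C f) {z : CSpace m}
    (hz : z ∈ tubeDomain m) :
    Integrable (fun w => f w • tubeKernelDeriv α z w) (tubeWeighted m α) := by
  obtain ⟨L, hL, h⟩ := exists_norm_tubeKernelDeriv_le m hα (max 1 ‖z‖) (tubeRho z)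
    (le_max_left _ _) (mem_tubeDomain_iff.1 hz)
  refine ((hf.integrable_majorant hε hεα hε2 hC).const_mul L).mono' ?_ ?_
  · exact hf.aestronglyMeasurable_tubeWeighted.smul
      (measurable_tubeKernelDeriv z).aestronglyMeasurable
  · filter_upwards [ae_tubeWeighted_mem m α] with w hw
    rw [norm_smul, ← mul_assoc, mul_comm]
    gcongr
    exact h z w (le_max_right _ _) le_rfl hw

lemma HasTubeGrowth.hasFDerivAt_tubeModProj (hα : -1 < α) (hε : 0 ≤ ε) (hεα : ε < α + 1)
    (hε2 : ε < 1 / 2) (hC : 0 ≤ C) (hf : HasTubeGrowth ε C f) {z : CSpace m}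
    (hz : z ∈ tubeDomain m) :
    HasFDerivAt (tubeModProj α f) (∫ w, f w • tubeKernelDeriv α z w ∂(tubeWeighted m α)) z := by
  have hz' := mem_tubeDomain_iff.1 hz
  obtain ⟨L, hL, h⟩ := exists_norm_tubeKernelDeriv_le m hα (max 1 (‖z‖ + 1)) (tubeRho z / 2)
    (le_max_left _ _) (by linarith)
  have hopen : IsOpen ({x : CSpace m | ‖x‖ < ‖z‖ + 1} ∩ {x | tubeRho z / 2 < tubeRho x}) :=
    (isOpen_lt continuous_norm continuous_const).inter
      (isOpen_lt continuous_const continuous_tubeRho)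
  refine hasFDerivAt_integral_of_dominated_of_fderiv_le
    (F := fun z w => tubeModKernel α z w * f w) (F' := fun z w => f w • tubeKernelDeriv α z w)
    (bound := fun w => L * (‖tubeRho₂ (tubeBase m) w‖ ^ (-(kernelExp m α + 1 / 2)) * ‖f w‖))
    (hopen.mem_nhds ⟨by simp, by simpa using hz'⟩) ?_
    (hf.integrable_tubeModKernel_mul hα hε hεα hε2 hC hz)
    (hf.integrable_smul_tubeKernelDeriv hα hε hεα hε2 hC hz).aestronglyMeasurable ?_
    ((hf.integrable_majorant hε hεα hε2 hC).const_mul L) ?_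
  · exact Filter.Eventually.of_forall fun x => (((measurable_tubeKernel x).sub
      (measurable_tubeKernel _)).aestronglyMeasurable).mul hf.aestronglyMeasurable_tubeWeighted
  · filter_upwards [ae_tubeWeighted_mem m α] with w hw x hx
    rw [norm_smul, ← mul_assoc, mul_comm]
    gcongr
    exact h x w (hx.1.le.trans (le_max_right _ _)) hx.2.le hw
  · filter_upwards [ae_tubeWeighted_mem m α] with w hw x hx
    have hxm : x ∈ tubeDomain m := mem_tubeDomain_iff.2 (lt_trans (by linarith) hx.2)
    exact ((hasFDerivAt_tubeKernel α hxm hw).sub_const _).mul_const (f w)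

lemma HasTubeGrowth.fderiv_tubeModProj_apply (hα : -1 < α) (hε : 0 ≤ ε) (hεα : ε < α + 1)
    (hε2 : ε < 1 / 2) (hC : 0 ≤ C) (hf : HasTubeGrowth ε C f) {z : CSpace m}
    (hz : z ∈ tubeDomain m) (δ : CSpace m) :
    fderiv ℂ (tubeModProj α f) z δ = ∫ w, f w * tubeKernelDeriv α z w δ ∂(tubeWeighted m α) := by
  rw [(hf.hasFDerivAt_tubeModProj hα hε hεα hε2 hC hz).fderiv,
    ContinuousLinearMap.integral_apply (hf.integrable_smul_tubeKernelDeriv hα hε hεα hε2 hC hz)]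
  rfl

lemma HasTubeGrowth.tubePartialLast_tubeModProj (hα : -1 < α) (hε : 0 ≤ ε) (hεα : ε < α + 1)
    (hε2 : ε < 1 / 2) (hC : 0 ≤ C) (hf : HasTubeGrowth ε C f) {z : CSpace m}
    (hz : z ∈ tubeDomain m) :
    tubePartialLast (tubeModProj α f) z = (kernelConst m α * kernelExp m α * (Complex.I / 2)) *
      ∫ w, f w * tubeRho₂ z w ^ ((-(kernelExp m α + 1) : ℝ) : ℂ) ∂(tubeWeighted m α) := by
  rw [tubePartialLast, hf.fderiv_tubeModProj_apply hα hε hεα hε2 hC hz, ← integral_const_mul]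
  congr 1; funext w
  rw [tubeKernelDeriv, smul_apply, tubeRho₂Deriv_last, smul_eq_mul]
  push_cast
  ring

lemma HasTubeGrowth.integrable_mul_tubeRho₂_cpow (hα : -1 < α) (hε : 0 ≤ ε) (hεα : ε < α + 1)
    (hε2 : ε < 1 / 2) (hC : 0 ≤ C) (hf : HasTubeGrowth ε C f) {z : CSpace m}
    (hz : z ∈ tubeDomain m) :
    Integrable (fun w => f w * tubeRho₂ z w ^ ((-(kernelExp m α + 1) : ℝ) : ℂ))
      (tubeWeighted m α) := by
  have h := (hf.integrable_smul_tubeKernelDeriv hα hε hεα hε2 hC hz).apply_continuousLinearMap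
    (0, 1)
  set c : ℂ := kernelConst m α * kernelExp m α * (Complex.I / 2) with hc
  have hc0 : c ≠ 0 := by
    have h1 : (kernelConst m α : ℂ) ≠ 0 := by exact_mod_cast (kernelConst_pos m hα).ne'
    have h2 : (kernelExp m α : ℂ) ≠ 0 := by exact_mod_cast (kernelExp_pos m hα).ne'
    simp [hc, h1, h2]
  refine (h.const_mul c⁻¹).congr (Filter.Eventually.of_forall fun w => ?_)
  have e : (f w • tubeKernelDeriv α z w) (0, 1)
      = c * (f w * tubeRho₂ z w ^ ((-(kernelExp m α + 1) : ℝ) : ℂ)) := by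
    rw [tubeKernelDeriv, smul_apply, smul_apply, tubeRho₂Deriv_last, smul_eq_mul, smul_eq_mul, hc]
    push_cast
    ring
  simp only [e, inv_mul_cancel_left₀ hc0]

/-- The two components of the invariant gradient of `P̃_α f`, with their decay as `ρ(z) → ∞`. -/
lemma exists_norm_deriv_tubeModProj_le (m : ℕ) {α ε : ℝ} (hα : -1 < α) (hε : 0 ≤ ε)
    (hεα : ε < α + 1) (hε2 : ε < 1 / 2) :
    ∃ K : ℝ, 0 ≤ K ∧ ∀ (C : ℝ) (f : CSpace m → ℂ), 0 ≤ C → HasTubeGrowth ε C f →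
      ∀ (z : CSpace m) (L : ℝ), z ∈ tubeDomain m → 0 ≤ L →
      (∀ w ∈ tubeDomain m, ‖tubeRho₂ (tubeBase m) w‖ ≤ L * ‖tubeRho₂ z w‖) →
      ‖tubePartialLast (tubeModProj α f) z‖ ≤ K * C * L ^ (2 * ε) * tubeRho z ^ (ε - 1) ∧
      ∀ j, ‖tubePartial (tubeModProj α f) j z
          + 2 * ((z.1 j).im : ℂ) * tubePartialLast (tubeModProj α f) z‖
        ≤ K * C * L ^ (2 * ε) * tubeRho z ^ (ε - 1 / 2) := by
  obtain ⟨K₁, hK₁, h₁⟩ := exists_integral_norm_tubeRho₂_mul_le m (s := kernelExp m α + 1) hε hεα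
    (by rw [kernelExp_eq]; linarith)
  obtain ⟨K₂, hK₂, h₂⟩ := exists_integral_norm_tubeRho₂_mul_le m (s := kernelExp m α + 1 / 2) hε
    hεα (by rw [kernelExp_eq]; linarith)
  have hc := kernelConst_pos m hα
  have he := kernelExp_pos m hα
  refine ⟨kernelConst m α * kernelExp m α * (K₁ + K₂), by positivity, ?_⟩
  intro C f hC hf z L hz hL hcmp
  have hz' := mem_tubeDomain_iff.1 hz
  obtain ⟨i₁, b₁⟩ := h₁ C f hC hf z L hz hL hcmp
  obtain ⟨i₂, b₂⟩ := h₂ C f hC hf z L hz hL hcmp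
  rw [show (m : ℝ) + 2 + α + ε - (kernelExp m α + 1) = ε - 1 by rw [kernelExp_eq]; ring] at b₁
  rw [show (m : ℝ) + 2 + α + ε - (kernelExp m α + 1 / 2) = ε - 1 / 2 by rw [kernelExp_eq]; ring]
    at b₂
  constructor
  · rw [tubePartialLast, hf.fderiv_tubeModProj_apply hα hε hεα hε2 hC hz]
    refine (norm_integral_le_of_norm_le
      (i₁.const_mul (kernelConst m α * kernelExp m α)) ?_).trans ?_
    · refine Filter.Eventually.of_forall fun w => ?_
      rw [norm_mul, norm_tubeKernelDeriv_apply hα, tubeRho₂Deriv_last, norm_neg, norm_div,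
        Complex.norm_I]
      norm_num
      have : 0 ≤ kernelConst m α * kernelExp m α *
        (‖tubeRho₂ z w‖ ^ (-1 + -kernelExp m α) * ‖f w‖) := by positivity
      nlinarith
    · rw [integral_const_mul]
      calc _ ≤ kernelConst m α * kernelExp m α *
            (K₁ * C * L ^ (2 * ε) * tubeRho z ^ (ε - 1)) := by gcongr
        _ ≤ kernelConst m α * kernelExp m α *
            ((K₁ + K₂) * C * L ^ (2 * ε) * tubeRho z ^ (ε - 1)) := by gcongr; linarith
        _ = _ := by ring
  · intro j
    have hi : ∀ δ, Integrable (fun w => f w * tubeKernelDeriv α z w δ) (tubeWeighted m α) :=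
      fun δ => (hf.integrable_smul_tubeKernelDeriv hα hε hεα hε2 hC hz).apply_continuousLinearMap δ
    rw [tubePartial, tubePartialLast, hf.fderiv_tubeModProj_apply hα hε hεα hε2 hC hz,
      hf.fderiv_tubeModProj_apply hα hε hεα hε2 hC hz, ← integral_const_mul,
      ← integral_add (hi _) ((hi _).const_mul _)]
    refine (norm_integral_le_of_norm_le
      (i₂.const_mul (kernelConst m α * kernelExp m α)) ?_).trans ?_
    · filter_upwards [ae_tubeWeighted_mem m α] with w hw
      have hN := norm_tubeRho₂_pos hz hw
      have e1 : f w * tubeKernelDeriv α z w (Pi.single j 1, 0)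
          + 2 * ((z.1 j).im : ℂ) * (f w * tubeKernelDeriv α z w (0, 1))
          = f w * tubeKernelDeriv α z w ((Pi.single j 1, 0) + (2 * ((z.1 j).im : ℂ)) • (0, 1)) := by
        rw [map_add, map_smul, smul_eq_mul]; ring
      rw [e1, norm_mul, norm_tubeKernelDeriv_apply hα, map_add, map_smul, smul_eq_mul,
        tubeRho₂Deriv_tangential, norm_div, RCLike.norm_conj]
      have e2 : ‖z.1 j - w.1 j‖ / ‖(2 : ℂ)‖ ≤ ‖tubeRho₂ z w‖ ^ (1 / 2 : ℝ) := by
        have := norm_sub_le_norm_tubeRho₂ hz hw j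
        rw [Complex.norm_ofNat]
        linarith
      calc _ ≤ ‖f w‖ * (kernelConst m α * kernelExp m α * ‖tubeRho₂ z w‖ ^ (-(kernelExp m α + 1))
            * ‖tubeRho₂ z w‖ ^ (1 / 2 : ℝ)) := by gcongr
        _ = _ := by
          rw [show -(kernelExp m α + 1 / 2) = -(kernelExp m α + 1) + 1 / 2 by ring,
            Real.rpow_add hN]
          ring
    · rw [integral_const_mul]
      calc _ ≤ kernelConst m α * kernelExp m α *
            (K₂ * C * L ^ (2 * ε) * tubeRho z ^ (ε - 1 / 2)) := by gcongr
        _ ≤ kernelConst m α * kernelExp m α *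
            ((K₁ + K₂) * C * L ^ (2 * ε) * tubeRho z ^ (ε - 1 / 2)) := by gcongr; linarith
        _ = _ := by ring

end Projection

/-! ### The reproducing formula: the disc and the half plane -/

lemma circleAverage_eq_of_closedBall_subset {g : ℂ → ℂ} {U : Set ℂ}
    (hU : Metric.closedBall 0 1 ⊆ U) (hg : DifferentiableOn ℂ g U) :
    Real.circleAverage g 0 1 = g 0 := by
  refine DiffContOnCl.circleAverage (DifferentiableOn.diffContOnCl (hg.mono ?_))
  rw [abs_one]
  exact Metric.closure_ball_subset_closedBall.trans hU

lemma circleAverage_conj_mul {g : ℂ → ℂ} {U : Set ℂ}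
    (hU : Metric.closedBall 0 1 ⊆ U) (hg : DifferentiableOn ℂ g U) :
    Real.circleAverage (fun c => (starRingEnd ℂ) c * g c) 0 1 = deriv g 0 := by
  have h1 : DiffContOnCl ℂ g (Metric.ball 0 1) :=
    DifferentiableOn.diffContOnCl (hg.mono (Metric.closure_ball_subset_closedBall.trans hU))
  have h2 := h1.deriv_eq_smul_circleIntegral one_pos
  rw [Real.circleAverage_eq_circleIntegral one_ne_zero]
  have h3 : (∮ z in C(0, 1), (z - 0)⁻¹ • ((starRingEnd ℂ) z * g z))
      = ∮ z in C(0, 1), (1 / (z - 0) ^ 2) • g z := by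
    refine circleIntegral.integral_congr zero_le_one fun z hz => ?_
    have hz1 : ‖z‖ = 1 := by simpa using hz
    have hz0 : z ≠ 0 := by rw [← norm_pos_iff, hz1]; norm_num
    have hzc : (starRingEnd ℂ) z = z⁻¹ := by
      rw [Complex.inv_def, Complex.normSq_eq_norm_sq, hz1]; simp
    simp only [hzc, smul_eq_mul, sub_zero]
    field_simp
  rw [h3, h2, smul_smul, inv_mul_cancel₀ (by simp [Real.pi_ne_zero]), one_smul]

lemma integrable_truncPow_one_sub_norm_sq {β : ℝ} (hβ : -1 < β) :
    Integrable fun η : ℂ => truncPow β (1 - ‖η‖ ^ 2) := by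
  by_contra h
  have h1 := integral_truncPow_one_sub_norm_sq hβ
  rw [integral_undef h] at h1
  have : 0 < Real.pi / (β + 1) := div_pos Real.pi_pos (by linarith)
  linarith

lemma integral_truncPow_one_sub_norm_sq_mul_norm_sq {β : ℝ} (hβ : -1 < β) :
    ∫ η : ℂ, truncPow β (1 - ‖η‖ ^ 2) * ‖η‖ ^ 2 = Real.pi / ((β + 1) * (β + 2)) := by
  have h : ∀ η : ℂ, truncPow β (1 - ‖η‖ ^ 2) * ‖η‖ ^ 2
      = truncPow β (1 - ‖η‖ ^ 2) - truncPow (β + 1) (1 - ‖η‖ ^ 2) := by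
    intro η
    rcases le_or_gt (1 - ‖η‖ ^ 2) 0 with h | h
    · simp [truncPow_of_nonpos h]
    · rw [truncPow_of_pos h, truncPow_of_pos h, Real.rpow_add_one h.ne']; ring
  simp only [h]
  rw [integral_sub (integrable_truncPow_one_sub_norm_sq hβ)
    (integrable_truncPow_one_sub_norm_sq (by linarith)), integral_truncPow_one_sub_norm_sq hβ,
    integral_truncPow_one_sub_norm_sq (by linarith)]
  have h1 : β + 1 ≠ 0 := by linarith
  have h2 : β + 1 + 1 ≠ 0 := by linarith
  have h3 : β + 2 ≠ 0 := by linarith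
  field_simp
  ring

lemma closedBall_subset_preimage_smul {η : ℂ} (hη : ‖η‖ < 1) :
    Metric.closedBall 0 1 ⊆ (fun c : ℂ => c • η) ⁻¹' Metric.ball 0 1 := by
  intro c hc
  have hc' : ‖c‖ ≤ 1 := by simpa using hc
  simp only [Set.mem_preimage, mem_ball_zero_iff, norm_smul]
  nlinarith [norm_nonneg η, norm_nonneg c]

lemma one_sub_norm_sq_nonpos {η : ℂ} (hη : 1 ≤ ‖η‖) : 1 - ‖η‖ ^ 2 ≤ 0 := by
  nlinarith

lemma norm_smul_of_mem_sphere {E : Type*} [SeminormedAddCommGroup E] [NormedSpace ℂ E] {c : ℂ}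
    (hc : c ∈ Metric.sphere (0 : ℂ) |1|) (u : E) : ‖c • u‖ = ‖u‖ := by
  have : ‖c‖ = 1 := by simpa using hc
  rw [norm_smul, this, one_mul]

/-- The mean value property on the disc for the weight `(1-|η|²)^β`. -/
lemma integral_disc_mul {β : ℝ} (hβ : -1 < β) {H : ℂ → ℂ}
    (hH : DifferentiableOn ℂ H (Metric.ball 0 1))
    (hint : Integrable fun η : ℂ => (truncPow β (1 - ‖η‖ ^ 2) : ℂ) * H η) :
    ∫ η : ℂ, (truncPow β (1 - ‖η‖ ^ 2) : ℂ) * H η = (Real.pi / (β + 1) : ℝ) * H 0 := by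
  rw [integral_eq_integral_circleAverage volume measurePreserving_circleMap_smul _ hint]
  have h : ∀ η : ℂ, Real.circleAverage
      (fun c => (truncPow β (1 - ‖c • η‖ ^ 2) : ℂ) * H (c • η)) 0 1
      = (truncPow β (1 - ‖η‖ ^ 2) : ℂ) * H 0 := by
    intro η
    have e1 : Real.circleAverage (fun c => (truncPow β (1 - ‖c • η‖ ^ 2) : ℂ) * H (c • η)) 0 1
        = Real.circleAverage (fun c => (truncPow β (1 - ‖η‖ ^ 2) : ℂ) • H (c • η)) 0 1 :=
      Real.circleAverage_congr_sphere fun c hc => by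
        rw [norm_smul_of_mem_sphere hc, smul_eq_mul (truncPow β (1 - ‖η‖ ^ 2) : ℂ)]
    rw [e1, Real.circleAverage_fun_smul]
    rcases lt_or_ge ‖η‖ 1 with h1 | h1
    · rw [circleAverage_eq_of_closedBall_subset (g := fun c => H (c • η))
        (closedBall_subset_preimage_smul h1)
        (hH.comp (by fun_prop) (Set.mapsTo_preimage _ _)), zero_smul, smul_eq_mul]
    · rw [truncPow_of_nonpos (one_sub_norm_sq_nonpos h1)]; simp
  simp only [h]
  rw [integral_mul_const, integral_complex_ofReal, integral_truncPow_one_sub_norm_sq hβ]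

/-- The first moment version: the factor `1 - η̄` picks out `H(0)` and `H'(0)`. -/
lemma integral_disc_mul_one_sub_conj {β : ℝ} (hβ : -1 < β) {H : ℂ → ℂ}
    (hH : DifferentiableOn ℂ H (Metric.ball 0 1))
    (hint : Integrable fun η : ℂ =>
      (truncPow β (1 - ‖η‖ ^ 2) : ℂ) * H η * (1 - (starRingEnd ℂ) η)) :
    ∫ η : ℂ, (truncPow β (1 - ‖η‖ ^ 2) : ℂ) * H η * (1 - (starRingEnd ℂ) η)
      = (Real.pi / (β + 1) : ℝ) * H 0 - (Real.pi / ((β + 1) * (β + 2)) : ℝ) * deriv H 0 := by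
  rw [integral_eq_integral_circleAverage volume measurePreserving_circleMap_smul _ hint]
  have h : ∀ η : ℂ, Real.circleAverage (fun c => (truncPow β (1 - ‖c • η‖ ^ 2) : ℂ) * H (c • η)
      * (1 - (starRingEnd ℂ) (c • η))) 0 1
      = (truncPow β (1 - ‖η‖ ^ 2) : ℂ) * H 0
        - ((truncPow β (1 - ‖η‖ ^ 2) * ‖η‖ ^ 2 : ℝ) : ℂ) * deriv H 0 := by
    intro η
    have e1 : Real.circleAverage (fun c => (truncPow β (1 - ‖c • η‖ ^ 2) : ℂ) * H (c • η)
        * (1 - (starRingEnd ℂ) (c • η))) 0 1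
        = Real.circleAverage (fun c => (truncPow β (1 - ‖η‖ ^ 2) : ℂ) • (H (c • η)
          - (starRingEnd ℂ) η • ((starRingEnd ℂ) c * H (c • η)))) 0 1 :=
      Real.circleAverage_congr_sphere fun c hc => by
        simp only [norm_smul_of_mem_sphere hc]
        simp only [smul_eq_mul, map_mul]
        ring
    rw [e1, Real.circleAverage_fun_smul]
    rcases lt_or_ge ‖η‖ 1 with h1 | h1
    · have hsub := closedBall_subset_preimage_smul h1
      have hd : DifferentiableOn ℂ (fun c => H (c • η)) ((fun c : ℂ => c • η) ⁻¹' Metric.ball 0 1) :=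
        hH.comp (by fun_prop) (Set.mapsTo_preimage _ _)
      have hcont : ContinuousOn (fun c : ℂ => H (c • η)) (Metric.sphere 0 1) :=
        hd.continuousOn.mono (Metric.sphere_subset_closedBall.trans hsub)
      have i1 : CircleIntegrable (fun c => H (c • η)) 0 1 := hcont.circleIntegrable zero_le_one
      have i2 : CircleIntegrable
          (fun c => (starRingEnd ℂ) η • ((starRingEnd ℂ) c * H (c • η))) 0 1 :=
        (ContinuousOn.circleIntegrable zero_le_one
          (Complex.continuous_conj.continuousOn.mul hcont)).const_smul
      rw [Real.circleAverage_fun_sub i1 i2, Real.circleAverage_fun_smul,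
        circleAverage_eq_of_closedBall_subset hsub hd, circleAverage_conj_mul hsub hd]
      have hder : deriv (fun c : ℂ => H (c • η)) 0 = η * deriv H 0 := by
        have hH0 : HasDerivAt H (deriv H 0) ((0 : ℂ) * η) := by
          rw [zero_mul]
          exact (hH.differentiableAt (Metric.ball_mem_nhds 0 one_pos)).hasDerivAt
        have := hH0.comp (0 : ℂ) ((hasDerivAt_id (0 : ℂ)).mul_const η)
        rw [one_mul, mul_comm] at this
        exact this.deriv
      have hηη : (starRingEnd ℂ) η * η = ((‖η‖ ^ 2 : ℝ) : ℂ) := by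
        rw [mul_comm, Complex.mul_conj, Complex.normSq_eq_norm_sq]
      rw [hder, zero_smul, smul_eq_mul, smul_eq_mul, ← mul_assoc ((starRingEnd ℂ) η), hηη]
      push_cast
      ring
    · rw [truncPow_of_nonpos (one_sub_norm_sq_nonpos h1)]; simp
  simp only [h]
  have i1 : Integrable fun η : ℂ => (truncPow β (1 - ‖η‖ ^ 2) : ℂ) * H 0 :=
    (integrable_truncPow_one_sub_norm_sq hβ).ofReal.mul_const _
  have i2 : Integrable fun η : ℂ =>
      ((truncPow β (1 - ‖η‖ ^ 2) * ‖η‖ ^ 2 : ℝ) : ℂ) * deriv H 0 := by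
    have h0 : Integrable fun η : ℂ => truncPow β (1 - ‖η‖ ^ 2) * ‖η‖ ^ 2 := by
      by_contra h
      have h1 := integral_truncPow_one_sub_norm_sq_mul_norm_sq hβ
      rw [integral_undef h] at h1
      have : 0 < Real.pi / ((β + 1) * (β + 2)) :=
        div_pos Real.pi_pos (mul_pos (by linarith) (by linarith))
      linarith
    exact h0.ofReal.mul_const _
  rw [integral_sub i1 i2, integral_mul_const, integral_mul_const, integral_complex_ofReal,
    integral_complex_ofReal, integral_truncPow_one_sub_norm_sq hβ,
    integral_truncPow_one_sub_norm_sq_mul_norm_sq hβ]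

/-- The Cayley transform of the unit disc onto the upper half plane with `0 ↦ i r`. -/
noncomputable def cayley (r : ℝ) (η : ℂ) : ℂ := Complex.I * r * (1 + η) / (1 - η)

lemma one_sub_ne_zero_of_norm_lt {η : ℂ} (hη : ‖η‖ < 1) : 1 - η ≠ 0 := by
  intro h
  rw [← sub_eq_zero.1 h] at hη
  simp at hη

lemma re_one_sub_pos {η : ℂ} (hη : ‖η‖ < 1) : 0 < (1 - η).re := by
  have := Complex.re_le_norm η
  rw [Complex.sub_re, Complex.one_re]; linarith

lemma arg_ne_pi_of_re_pos {x : ℂ} (hx : 0 < x.re) : x.arg ≠ Real.pi := by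
  intro h
  have := (Complex.arg_eq_pi_iff.1 h).1
  linarith

lemma im_cayley (r : ℝ) {η : ℂ} (hη : ‖η‖ < 1) :
    (cayley r η).im = r * ((1 - ‖η‖ ^ 2) / ‖1 - η‖ ^ 2) := by
  have h0 := one_sub_ne_zero_of_norm_lt hη
  have h1 : (starRingEnd ℂ) (1 - η) ≠ 0 := (map_ne_zero _).2 h0
  have h2 : cayley r η = ((r / ‖1 - η‖ ^ 2 : ℝ) : ℂ)
      * (Complex.I * ((1 + η) * (starRingEnd ℂ) (1 - η))) := by
    push_cast
    rw [← Complex.conj_mul' (1 - η), cayley]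
    field_simp
  have h3 : ((1 + η) * (starRingEnd ℂ) (1 - η)).re = 1 - ‖η‖ ^ 2 := by
    rw [← Complex.normSq_eq_norm_sq, Complex.normSq_apply]
    simp
    ring
  rw [h2, Complex.im_ofReal_mul, Complex.I_mul_im, h3]
  ring

lemma add_I_mul_conj_cayley (r : ℝ) {η : ℂ} (hη : ‖η‖ < 1) :
    ((r : ℂ) + Complex.I * (starRingEnd ℂ) (cayley r η)) / 2
      = r * ((starRingEnd ℂ) (1 - η))⁻¹ := by
  have h0 : (starRingEnd ℂ) (1 - η) ≠ 0 :=
    (map_ne_zero _).2 (one_sub_ne_zero_of_norm_lt hη)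
  have h1 : (1 : ℂ) - (starRingEnd ℂ) η ≠ 0 := by simpa using h0
  simp only [cayley, map_div₀, map_mul, map_add, map_sub, map_one, Complex.conj_I,
    Complex.conj_ofReal]
  field_simp
  linear_combination (-(r * (1 + (starRingEnd ℂ) η))) * Complex.I_sq

lemma hasDerivAt_cayley (r : ℝ) {η : ℂ} (hη : ‖η‖ < 1) :
    HasDerivAt (cayley r) (2 * Complex.I * r / (1 - η) ^ 2) η := by
  have h0 := one_sub_ne_zero_of_norm_lt hη
  have h1 := (((hasDerivAt_id η).const_add 1).const_mul (Complex.I * r)).div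
    ((hasDerivAt_id η).const_sub 1) h0
  refine h1.congr_deriv ?_
  simp only [id]
  congr 1
  ring

lemma injOn_cayley {r : ℝ} (hr : r ≠ 0) : Set.InjOn (cayley r) (Metric.ball 0 1) := by
  intro x hx y hy hxy
  have hx0 := one_sub_ne_zero_of_norm_lt (mem_ball_zero_iff.1 hx)
  have hy0 := one_sub_ne_zero_of_norm_lt (mem_ball_zero_iff.1 hy)
  have hr' : (r : ℂ) ≠ 0 := by exact_mod_cast hr
  simp only [cayley] at hxy
  rw [div_eq_div_iff hx0 hy0] at hxy
  have : (2 * Complex.I * r) * (x - y) = 0 := by linear_combination hxy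
  simpa [hr', Complex.I_ne_zero, sub_eq_zero] using this

lemma image_cayley {r : ℝ} (hr : 0 < r) :
    cayley r '' Metric.ball 0 1 = {ω : ℂ | 0 < ω.im} := by
  ext ω
  constructor
  · rintro ⟨η, hη, rfl⟩
    have hη' := mem_ball_zero_iff.1 hη
    have h0 := norm_pos_iff.2 (one_sub_ne_zero_of_norm_lt hη')
    have : 0 < 1 - ‖η‖ ^ 2 := by nlinarith [norm_nonneg η]
    rw [Set.mem_ofPred_eq, im_cayley r hη']
    positivity
  · intro hω
    have hω' : 0 < ω.im := hω
    have hne : ω + Complex.I * r ≠ 0 := by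
      intro h
      have := congrArg Complex.im h
      simp at this
      linarith
    refine ⟨(ω - Complex.I * r) / (ω + Complex.I * r), ?_, ?_⟩
    · rw [mem_ball_zero_iff, norm_div, div_lt_one (norm_pos_iff.2 hne),
        ← pow_lt_pow_iff_left₀ (norm_nonneg _) (norm_nonneg _) two_ne_zero,
        ← Complex.normSq_eq_norm_sq, ← Complex.normSq_eq_norm_sq, Complex.normSq_apply,
        Complex.normSq_apply]
      simp
      nlinarith [mul_pos hω' hr]
    · have hr' : (r : ℂ) ≠ 0 := by exact_mod_cast hr.ne'
      have h2 : 1 - (ω - Complex.I * r) / (ω + Complex.I * r)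
          = 2 * Complex.I * r / (ω + Complex.I * r) := by field_simp; ring
      have h3 : 1 + (ω - Complex.I * r) / (ω + Complex.I * r)
          = 2 * ω / (ω + Complex.I * r) := by field_simp; ring
      rw [cayley, h2, h3]
      have := Complex.I_ne_zero
      field_simp

lemma ofReal_mul_cpow {r : ℝ} (hr : 0 < r) {x : ℂ} (hx : x ≠ 0) (c : ℂ) :
    ((r : ℂ) * x) ^ c = (r : ℂ) ^ c * x ^ c := by
  have hr' : (r : ℂ) ≠ 0 := by exact_mod_cast hr.ne'
  rw [Complex.cpow_def_of_ne_zero (mul_ne_zero hr' hx), Complex.cpow_def_of_ne_zero hr',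
    Complex.cpow_def_of_ne_zero hx, Complex.log_ofReal_mul hr hx, ← Complex.exp_add,
    Complex.ofReal_log hr.le]
  congr 1; ring

/-- After the Cayley transform the integrand is a radial weight times a holomorphic function and a
power of `1 - η̄`. -/
lemma cayley_integrand {r B : ℝ} (hr : 0 < r) (k : ℕ) (h : ℂ → ℂ) {η : ℂ} (hη : ‖η‖ < 1) :
    ((‖2 * Complex.I * r / (1 - η) ^ 2‖ ^ 2 : ℝ) : ℂ) *
      ((truncPow B (cayley r η).im : ℂ) * h (cayley r η) *
        (((r : ℂ) + Complex.I * (starRingEnd ℂ) (cayley r η)) / 2) ^ ((-(2 + B + k) : ℝ) : ℂ))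
      = (4 * ((r : ℂ) ^ k)⁻¹) * ((truncPow B (1 - ‖η‖ ^ 2) : ℂ) *
        (h (cayley r η) * (1 - η) ^ ((-(B + 2) : ℝ) : ℂ)) * (1 - (starRingEnd ℂ) η) ^ k) := by
  set x := 1 - η with hx
  have hx0 : x ≠ 0 := one_sub_ne_zero_of_norm_lt hη
  have hxre : 0 < x.re := re_one_sub_pos hη
  have hxc0 : (starRingEnd ℂ) x ≠ 0 := by simpa using hx0
  have hxarg := arg_ne_pi_of_re_pos hxre
  have hxcarg : ((starRingEnd ℂ) x).arg ≠ Real.pi := arg_ne_pi_of_re_pos (by simpa using hxre)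
  have hn : 0 < ‖x‖ := norm_pos_iff.2 hx0
  have hr' : (r : ℂ) ≠ 0 := by exact_mod_cast hr.ne'
  have hq : (1 - ‖η‖ ^ 2) / ‖x‖ ^ 2 = (‖x‖ ^ 2)⁻¹ * (1 - ‖η‖ ^ 2) := by ring
  have hnB : ((‖x‖ ^ 2)⁻¹) ^ B = (‖x‖ ^ (B + 2))⁻¹ ^ 2 * ‖x‖ ^ 4 := by
    rw [Real.rpow_add hn, Real.inv_rpow (by positivity), ← Real.rpow_natCast ‖x‖ 2,
      ← Real.rpow_mul hn.le, mul_comm _ B, Real.rpow_mul hn.le]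
    norm_num
    field_simp
  have hker : (((r : ℂ) + Complex.I * (starRingEnd ℂ) (cayley r η)) / 2)
      ^ ((-(2 + B + k) : ℝ) : ℂ) = ((r ^ (-(2 + B + k)) : ℝ) : ℂ) *
      ((starRingEnd ℂ) (x ^ ((B + 2 : ℝ) : ℂ)) * (1 - (starRingEnd ℂ) η) ^ k) := by
    rw [add_I_mul_conj_cayley r hη, ofReal_mul_cpow hr (inv_ne_zero hxc0),
      Complex.ofReal_cpow hr.le, Complex.inv_cpow _ _ hxcarg, ← Complex.cpow_neg]
    congr 1
    rw [show -((-(2 + B + k) : ℝ) : ℂ) = ((B + 2 : ℝ) : ℂ) + (k : ℂ) by push_cast; ring,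
      Complex.cpow_add _ _ hxc0, Complex.cpow_natCast, Complex.conj_cpow _ _ hxarg,
      Complex.conj_ofReal]
    simp [hx]
  have hconj : (starRingEnd ℂ) (x ^ ((B + 2 : ℝ) : ℂ))
      = ((‖x‖ ^ (B + 2)) ^ 2 : ℝ) * x ^ ((-(B + 2) : ℝ) : ℂ) := by
    have h1 : x ^ ((B + 2 : ℝ) : ℂ) ≠ 0 := by simp [Complex.cpow_eq_zero_iff, hx0]
    rw [Complex.ofReal_neg, Complex.cpow_neg, ← Complex.norm_cpow_real,
      Complex.ofReal_pow, ← Complex.conj_mul']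
    field_simp
  have hdet : ‖2 * Complex.I * r / x ^ 2‖ ^ 2 = 4 * r ^ 2 * (‖x‖ ^ 4)⁻¹ := by
    simp only [norm_div, norm_mul, norm_pow, Complex.norm_I, Complex.norm_ofNat,
      Complex.norm_real, Real.norm_eq_abs, abs_of_pos hr]
    field_simp
    ring
  have hrpow : r ^ 2 * r ^ B * r ^ (-(2 + B + k)) = (r ^ k)⁻¹ := by
    rw [← Real.rpow_natCast r 2, ← Real.rpow_add hr, ← Real.rpow_add hr, ← Real.rpow_natCast r k,
      ← Real.rpow_neg hr.le]
    congr 1; push_cast; ring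
  rw [hker, hconj, hdet, im_cayley r hη, truncPow_mul hr, hq, truncPow_mul (by positivity), hnB]
  have hcast : ((r : ℂ) ^ k)⁻¹ = ((r ^ 2 * r ^ B * r ^ (-(2 + B + k)) : ℝ) : ℂ) := by
    rw [hrpow]; push_cast; rfl
  rw [hcast]
  have hN : ((‖x‖ ^ (B + 2) : ℝ) : ℂ) ≠ 0 := by
    exact_mod_cast (Real.rpow_pos_of_pos hn _).ne'
  have hN4 : ((‖x‖ : ℝ) : ℂ) ≠ 0 := by exact_mod_cast hn.ne'
  push_cast
  field_simp

lemma det_restrictScalars_smul (a : ℂ) :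
    (ContinuousLinearMap.restrictScalars ℝ
      (ContinuousLinearMap.toSpanSingleton ℂ a : ℂ →L[ℂ] ℂ)).det = ‖a‖ ^ 2 := by
  simp [ContinuousLinearMap.det, LinearMap.det_restrictScalars,
    Algebra.norm_complex_eq, Complex.normSq_eq_norm_sq]

lemma halfPlane_integral_eq_disc {r B : ℝ} (hr : 0 < r) (k : ℕ) (h : ℂ → ℂ) :
    (Integrable (fun ω : ℂ => (truncPow B ω.im : ℂ) * h ω *
        (((r : ℂ) + Complex.I * (starRingEnd ℂ) ω) / 2) ^ ((-(2 + B + k) : ℝ) : ℂ)) →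
      Integrable (fun η : ℂ => (truncPow B (1 - ‖η‖ ^ 2) : ℂ) *
        (h (cayley r η) * (1 - η) ^ ((-(B + 2) : ℝ) : ℂ)) * (1 - (starRingEnd ℂ) η) ^ k)) ∧
    ∫ ω : ℂ, (truncPow B ω.im : ℂ) * h ω *
        (((r : ℂ) + Complex.I * (starRingEnd ℂ) ω) / 2) ^ ((-(2 + B + k) : ℝ) : ℂ)
      = (4 * ((r : ℂ) ^ k)⁻¹) * ∫ η : ℂ, (truncPow B (1 - ‖η‖ ^ 2) : ℂ) *
        (h (cayley r η) * (1 - η) ^ ((-(B + 2) : ℝ) : ℂ)) * (1 - (starRingEnd ℂ) η) ^ k := by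
  set F : ℂ → ℂ := fun ω => (truncPow B ω.im : ℂ) * h ω *
        (((r : ℂ) + Complex.I * (starRingEnd ℂ) ω) / 2) ^ ((-(2 + B + k) : ℝ) : ℂ) with hF
  set E : ℂ → ℂ := fun η => (truncPow B (1 - ‖η‖ ^ 2) : ℂ) *
        (h (cayley r η) * (1 - η) ^ ((-(B + 2) : ℝ) : ℂ)) * (1 - (starRingEnd ℂ) η) ^ k with hE
  have hF0 : ∀ ω ∉ {ω : ℂ | 0 < ω.im}, F ω = 0 := fun ω hω => by
    simp only [hF, truncPow_of_nonpos (not_lt.1 hω), Complex.ofReal_zero, zero_mul]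
  have hE0 : ∀ η ∉ Metric.ball (0 : ℂ) 1, E η = 0 := fun η hη => by
    have : 1 ≤ ‖η‖ := by simpa using hη
    simp only [hE, truncPow_of_nonpos (one_sub_norm_sq_nonpos this), Complex.ofReal_zero, zero_mul]
  have hFs : Function.support F ⊆ {ω : ℂ | 0 < ω.im} := fun ω hω => by
    by_contra h; exact hω (hF0 ω h)
  have hEs : Function.support E ⊆ Metric.ball 0 1 := fun ω hω => by
    by_contra h; exact hω (hE0 ω h)
  have hder : ∀ η ∈ Metric.ball (0 : ℂ) 1, HasFDerivWithinAt (cayley r)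
      (ContinuousLinearMap.restrictScalars ℝ
        (ContinuousLinearMap.toSpanSingleton ℂ (2 * Complex.I * r / (1 - η) ^ 2)))
      (Metric.ball 0 1) η := fun η hη =>
    ((hasDerivAt_cayley r (mem_ball_zero_iff.1 hη)).hasFDerivAt.restrictScalars ℝ).hasFDerivWithinAt
  have hcongr : Set.EqOn (fun η => |(ContinuousLinearMap.restrictScalars ℝ
        (ContinuousLinearMap.toSpanSingleton ℂ (2 * Complex.I * r / (1 - η) ^ 2))).det| •
          F (cayley r η)) (fun η => (4 * ((r : ℂ) ^ k)⁻¹) * E η) (Metric.ball 0 1) := by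
    intro η hη
    simp only
    rw [det_restrictScalars_smul, abs_of_nonneg (by positivity), Complex.real_smul]
    exact cayley_integrand hr k h (mem_ball_zero_iff.1 hη)
  have hr' : (r : ℂ) ≠ 0 := by exact_mod_cast hr.ne'
  have hc : (4 * ((r : ℂ) ^ k)⁻¹) ≠ 0 := mul_ne_zero (by norm_num) (inv_ne_zero (pow_ne_zero _ hr'))
  constructor
  · intro hint
    rw [← integrableOn_iff_integrable_of_support_subset hFs, ← image_cayley hr,
      integrableOn_image_iff_integrableOn_abs_det_fderiv_smul volume measurableSet_ball hder
        (injOn_cayley hr.ne'), integrableOn_congr_fun hcongr measurableSet_ball] at hint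
    rw [← integrableOn_iff_integrable_of_support_subset hEs]
    have := hint.const_mul (4 * ((r : ℂ) ^ k)⁻¹)⁻¹
    simp only [inv_mul_cancel_left₀ hc] at this
    exact this
  · rw [← setIntegral_eq_integral_of_forall_compl_eq_zero hF0, ← image_cayley hr,
      integral_image_eq_integral_abs_det_fderiv_smul volume measurableSet_ball hder
        (injOn_cayley hr.ne'), setIntegral_congr_fun measurableSet_ball hcongr,
      integral_const_mul, setIntegral_eq_integral_of_forall_compl_eq_zero hE0]

lemma differentiableOn_comp_cayley {r B : ℝ} (hr : 0 < r) {h : ℂ → ℂ}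
    (hh : DifferentiableOn ℂ h {ω : ℂ | 0 < ω.im}) :
    DifferentiableOn ℂ (fun η => h (cayley r η) * (1 - η) ^ ((-(B + 2) : ℝ) : ℂ))
      (Metric.ball 0 1) := by
  refine DifferentiableOn.mul (hh.comp (t := {ω : ℂ | 0 < ω.im}) ?_ ?_) ?_
  · exact fun η hη =>
      (hasDerivAt_cayley r (mem_ball_zero_iff.1 hη)).differentiableAt.differentiableWithinAt
  · rw [← image_cayley hr]; exact Set.mapsTo_image _ _
  · exact DifferentiableOn.cpow_const (by fun_prop)
      fun η hη => Or.inl (re_one_sub_pos (mem_ball_zero_iff.1 hη))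

lemma cayley_zero (r : ℝ) : cayley r 0 = Complex.I * r := by simp [cayley]

/-- The weighted mean value property of the upper half plane. -/
lemma integral_halfPlane_reproducing {r B : ℝ} (hr : 0 < r) (hB : -1 < B) {h : ℂ → ℂ}
    (hh : DifferentiableOn ℂ h {ω : ℂ | 0 < ω.im})
    (hint : Integrable (fun ω : ℂ => (truncPow B ω.im : ℂ) * h ω *
      (((r : ℂ) + Complex.I * (starRingEnd ℂ) ω) / 2) ^ ((-(2 + B) : ℝ) : ℂ))) :
    ∫ ω : ℂ, (truncPow B ω.im : ℂ) * h ω *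
        (((r : ℂ) + Complex.I * (starRingEnd ℂ) ω) / 2) ^ ((-(2 + B) : ℝ) : ℂ)
      = (4 * Real.pi / (B + 1) : ℝ) * h (Complex.I * r) := by
  obtain ⟨h1, h2⟩ := halfPlane_integral_eq_disc (B := B) hr 0 h
  simp only [Nat.cast_zero, add_zero, pow_zero, mul_one] at h1 h2
  rw [h2, integral_disc_mul hB (differentiableOn_comp_cayley hr hh) (h1 hint), cayley_zero]
  simp
  ring

/-- With one more power in the kernel, the derivative is reproduced. -/
lemma integral_halfPlane_reproducing_deriv {r B : ℝ} (hr : 0 < r) (hB : -1 < B) {h : ℂ → ℂ}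
    (hh : DifferentiableOn ℂ h {ω : ℂ | 0 < ω.im})
    (hint : Integrable (fun ω : ℂ => (truncPow B ω.im : ℂ) * h ω *
      (((r : ℂ) + Complex.I * (starRingEnd ℂ) ω) / 2) ^ ((-(2 + B + 1) : ℝ) : ℂ))) :
    ∫ ω : ℂ, (truncPow B ω.im : ℂ) * h ω *
        (((r : ℂ) + Complex.I * (starRingEnd ℂ) ω) / 2) ^ ((-(2 + B + 1) : ℝ) : ℂ)
      = (-(8 * Real.pi / ((B + 1) * (B + 2))) : ℝ) * Complex.I * deriv h (Complex.I * r) := by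
  obtain ⟨h1, h2⟩ := halfPlane_integral_eq_disc (B := B) hr 1 h
  simp only [Nat.cast_one, pow_one] at h1 h2
  have hI : (0 : ℝ) < (Complex.I * r).im := by simpa using hr
  have hd : HasDerivAt (fun η => h (cayley r η) * (1 - η) ^ ((-(B + 2) : ℝ) : ℂ))
      (deriv h (Complex.I * r) * (2 * Complex.I * r) + h (Complex.I * r) * (B + 2)) 0 := by
    have e1 : HasDerivAt h (deriv h (Complex.I * r)) (cayley r 0) := by
      rw [cayley_zero]
      exact (hh.differentiableAt
        ((isOpen_lt continuous_const Complex.continuous_im).mem_nhds hI)).hasDerivAt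
    have e2 := e1.comp (0 : ℂ) (hasDerivAt_cayley r (η := 0) (by simp))
    have e3 := ((hasDerivAt_id (0 : ℂ)).const_sub 1).cpow_const (c := ((-(B + 2) : ℝ) : ℂ))
      (by simp)
    refine (e2.mul e3).congr_deriv ?_
    simp [cayley_zero]
  have hB1 : (B : ℂ) + 1 ≠ 0 := by exact_mod_cast (by linarith : B + 1 ≠ 0)
  have hB2 : (B : ℂ) + 2 ≠ 0 := by exact_mod_cast (by linarith : B + 2 ≠ 0)
  have hr' : (r : ℂ) ≠ 0 := by exact_mod_cast hr.ne'
  rw [h2, integral_disc_mul_one_sub_conj hB (differentiableOn_comp_cayley hr hh) (h1 hint),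
    hd.deriv, cayley_zero]
  simp
  field_simp
  ring

/-! ### The reproducing formula on the tubular domain -/

lemma measurable_truncPow_tubeRho (m : ℕ) (β : ℝ) :
    Measurable fun w : CSpace m => truncPow β (tubeRho w) :=
  (measurable_truncPow β).comp continuous_tubeRho.measurable

lemma tubeWeighted_eq (m : ℕ) (β : ℝ) :
    tubeWeighted m β = volume.withDensity fun w => ENNReal.ofReal (truncPow β (tubeRho w)) := by
  rw [tubeWeighted, tubeVolume, ← withDensity_indicator isOpen_tubeDomain.measurableSet]
  congr 1
  funext w
  by_cases hw : w ∈ tubeDomain m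
  · rw [Set.indicator_of_mem hw, truncPow_of_pos (mem_tubeDomain_iff.1 hw)]
  · rw [Set.indicator_of_notMem hw,
      truncPow_of_nonpos (not_lt.1 (mt mem_tubeDomain_iff.2 hw)), ENNReal.ofReal_zero]

lemma integral_tubeWeighted (m : ℕ) (β : ℝ) (F : CSpace m → ℂ) :
    ∫ w, F w ∂(tubeWeighted m β) = ∫ w, (truncPow β (tubeRho w) : ℂ) * F w := by
  rw [tubeWeighted_eq, integral_withDensity_eq_integral_toReal_smul
    (measurable_truncPow_tubeRho m β).ennreal_ofReal
    (Filter.Eventually.of_forall fun _ => ENNReal.ofReal_lt_top)]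
  simp only [ENNReal.toReal_ofReal (truncPow_nonneg _ _), Complex.real_smul]

lemma integrable_tubeWeighted_iff (m : ℕ) (β : ℝ) (F : CSpace m → ℂ) :
    Integrable F (tubeWeighted m β) ↔
      Integrable fun w => (truncPow β (tubeRho w) : ℂ) * F w := by
  rw [tubeWeighted_eq, integrable_withDensity_iff_integrable_smul'
    (measurable_truncPow_tubeRho m β).ennreal_ofReal
    (Filter.Eventually.of_forall fun _ => ENNReal.ofReal_lt_top)]
  simp only [ENNReal.toReal_ofReal (truncPow_nonneg _ _), Complex.real_smul]

lemma hasDerivAt_siegelMap_zero_right {m : ℕ} (z : CSpace m) (ω : ℂ) :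
    HasDerivAt (fun ω => siegelMap z (0, ω)) (0, 1) ω := by
  have h : (fun ω => siegelMap z (0, ω))
      = fun ω => (z.1, (z.2 - Complex.I * tubeRho z) + ω) := by
    funext ω; simp [siegelMap]
  rw [h]
  exact (hasDerivAt_const ω z.1).prodMk ((hasDerivAt_id ω).const_add _)

lemma siegelMap_base {m : ℕ} (z : CSpace m) : siegelMap z (0, Complex.I * tubeRho z) = z := by
  simp [siegelMap]

lemma siegelMap_zero_mem {m : ℕ} (z : CSpace m) {ω : ℂ} (hω : 0 < ω.im) :
    siegelMap z (0, ω) ∈ tubeDomain m := by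
  rw [mem_tubeDomain_iff, tubeRho_siegelMap]
  simpa using hω

/-- In Siegel coordinates at `z` the kernel depends on `ω` only, so the average of a holomorphic
function over the rotations of `u` may be taken first: only its values at `u = 0` remain, and the
integral over `T_B` becomes one over the half plane. -/
lemma tube_integral_eq_halfPlane {m : ℕ} {β : ℝ} (hβ : -1 < β) (s : ℂ) {G : CSpace m → ℂ}
    (hG : DifferentiableOn ℂ G (tubeDomain m)) (z : CSpace m)
    (hint : Integrable fun w => (truncPow β (tubeRho w) : ℂ) * (G w * tubeRho₂ z w ^ s)) :
    Integrable (fun ω : ℂ => (truncPow (β + m) ω.im : ℂ) * G (siegelMap z (0, ω)) *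
        (((tubeRho z : ℂ) + Complex.I * (starRingEnd ℂ) ω) / 2) ^ s) ∧
    ∫ w, (truncPow β (tubeRho w) : ℂ) * (G w * tubeRho₂ z w ^ s)
      = fibreConst m β * ∫ ω : ℂ, (truncPow (β + m) ω.im : ℂ) * G (siegelMap z (0, ω)) *
        (((tubeRho z : ℂ) + Complex.I * (starRingEnd ℂ) ω) / 2) ^ s := by
  set κ : ℂ → ℂ := fun ω => (((tubeRho z : ℂ) + Complex.I * (starRingEnd ℂ) ω) / 2) ^ s with hκ
  set F : CSpace m → ℂ := fun p => (truncPow β (p.2.im - ∑ j, ‖p.1 j‖ ^ 2 / 2) : ℂ) *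
    (G (siegelMap z p) * κ p.2) with hF
  have hFeq : F = (fun w => (truncPow β (tubeRho w) : ℂ) * (G w * tubeRho₂ z w ^ s)) ∘
      siegelMap z := by
    funext p
    simp only [hF, hκ, Function.comp, tubeRho_siegelMap, tubeRho₂_siegelMap]
  have hFint : Integrable F (volume.prod volume) := by
    rw [hFeq]
    exact ((measurePreserving_siegelMap z).integrable_comp_emb
      (measurableEmbedding_siegelMap z)).2 hint
  have hslice : ∀ᵐ ω : ℂ, ∫ u : Fin m → ℂ, F (u, ω)
      = fibreConst m β * ((truncPow (β + m) ω.im : ℂ) * G (siegelMap z (0, ω)) * κ ω) := by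
    filter_upwards [hFint.prod_left_ae] with ω hω
    rw [integral_eq_integral_circleAverage volume (measurePreserving_circleMap_smul_pi m) _ hω]
    have havg : ∀ u : Fin m → ℂ, Real.circleAverage (fun c => F (c • u, ω)) 0 1
        = (truncPow β (ω.im - ∑ j, ‖u j‖ ^ 2 / 2) : ℂ) * (G (siegelMap z (0, ω)) * κ ω) := by
      intro u
      have e1 : Real.circleAverage (fun c => F (c • u, ω)) 0 1
          = Real.circleAverage (fun c => ((truncPow β (ω.im - ∑ j, ‖u j‖ ^ 2 / 2) : ℂ) * κ ω) •
            G (siegelMap z (c • u, ω))) 0 1 :=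
        Real.circleAverage_congr_sphere fun c hc => by
          simp only [hF, Pi.smul_apply, norm_smul_of_mem_sphere hc, smul_eq_mul (a := _ * κ ω)]
          ring
      rw [e1, Real.circleAverage_fun_smul]
      rcases le_or_gt (ω.im - ∑ j, ‖u j‖ ^ 2 / 2) 0 with h | h
      · simp [truncPow_of_nonpos h]
      · have hsub : Metric.closedBall (0 : ℂ) 1 ⊆
            (fun c : ℂ => siegelMap z (c • u, ω)) ⁻¹' tubeDomain m := by
          intro c hc
          have hc' : ‖c‖ ≤ 1 := by simpa using hc
          rw [Set.mem_preimage, mem_tubeDomain_iff, tubeRho_siegelMap]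
          refine h.trans_le (sub_le_sub_left (Finset.sum_le_sum fun j _ => ?_) _)
          simp only [Pi.smul_apply, norm_smul]
          have : ‖c‖ * ‖u j‖ ≤ ‖u j‖ := mul_le_of_le_one_left (norm_nonneg _) hc'
          gcongr
        have hd : DifferentiableOn ℂ (fun c : ℂ => G (siegelMap z (c • u, ω)))
            ((fun c : ℂ => siegelMap z (c • u, ω)) ⁻¹' tubeDomain m) := by
          refine hG.comp (Differentiable.differentiableOn ?_) (Set.mapsTo_preimage _ _)
          unfold siegelMap
          simp only [Pi.smul_apply]
          fun_prop
        rw [circleAverage_eq_of_closedBall_subset hsub hd, zero_smul, smul_eq_mul]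
        ring
    simp only [havg]
    rw [integral_mul_const, integral_complex_ofReal, integral_truncPow_sub_sum m hβ]
    push_cast
    ring
  have hc : (fibreConst m β : ℂ) ≠ 0 := by exact_mod_cast (fibreConst_pos m hβ).ne'
  constructor
  · have h1 := hFint.integral_prod_right.congr hslice
    have h2 := h1.const_mul (fibreConst m β : ℂ)⁻¹
    simp only [inv_mul_cancel_left₀ hc] at h2
    exact h2
  · rw [← (measurePreserving_siegelMap z).integral_comp (measurableEmbedding_siegelMap z),
      ← integral_const_mul, ← integral_congr_ae hslice, Measure.volume_eq_prod,
      ← integral_prod_symm _ hFint, hFeq]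
    rfl

lemma differentiableOn_comp_siegelMap_zero {m : ℕ} {G : CSpace m → ℂ}
    (hG : DifferentiableOn ℂ G (tubeDomain m)) (z : CSpace m) :
    DifferentiableOn ℂ (fun ω => G (siegelMap z (0, ω))) {ω : ℂ | 0 < ω.im} :=
  hG.comp (fun ω _ =>
    (hasDerivAt_siegelMap_zero_right z ω).differentiableAt.differentiableWithinAt)
    fun _ hω => siegelMap_zero_mem z hω

lemma integral_tube_reproducing {m : ℕ} {β : ℝ} (hβ : -1 < β) {G : CSpace m → ℂ}
    (hG : DifferentiableOn ℂ G (tubeDomain m)) {z : CSpace m} (hz : z ∈ tubeDomain m)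
    (hint : Integrable fun w => (truncPow β (tubeRho w) : ℂ) *
      (G w * tubeRho₂ z w ^ ((-(m + 2 + β) : ℝ) : ℂ))) :
    ∫ w, (truncPow β (tubeRho w) : ℂ) * (G w * tubeRho₂ z w ^ ((-(m + 2 + β) : ℝ) : ℂ))
      = (fibreConst m β * (4 * Real.pi / (β + m + 1)) : ℝ) * G z := by
  have hm0 : (0 : ℝ) ≤ m := Nat.cast_nonneg m
  obtain ⟨h1, h2⟩ := tube_integral_eq_halfPlane hβ _ hG z hint
  rw [show (m : ℝ) + 2 + β = 2 + (β + m) by ring] at h1 h2 ⊢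
  rw [h2, integral_halfPlane_reproducing (mem_tubeDomain_iff.1 hz) (by linarith)
    (differentiableOn_comp_siegelMap_zero hG z) h1, siegelMap_base]
  push_cast
  ring

lemma integral_tube_reproducing_deriv {m : ℕ} {β : ℝ} (hβ : -1 < β) {G : CSpace m → ℂ}
    (hG : DifferentiableOn ℂ G (tubeDomain m)) {z : CSpace m} (hz : z ∈ tubeDomain m)
    (hint : Integrable fun w => (truncPow β (tubeRho w) : ℂ) *
      (G w * tubeRho₂ z w ^ ((-(m + 2 + β + 1) : ℝ) : ℂ))) :
    ∫ w, (truncPow β (tubeRho w) : ℂ) * (G w * tubeRho₂ z w ^ ((-(m + 2 + β + 1) : ℝ) : ℂ))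
      = (-(fibreConst m β * (8 * Real.pi / ((β + m + 1) * (β + m + 2)))) : ℝ) * Complex.I *
        tubePartialLast G z := by
  have hm0 : (0 : ℝ) ≤ m := Nat.cast_nonneg m
  obtain ⟨h1, h2⟩ := tube_integral_eq_halfPlane hβ _ hG z hint
  have hder : deriv (fun ω => G (siegelMap z (0, ω))) (Complex.I * tubeRho z)
      = tubePartialLast G z := by
    have e1 : HasFDerivAt G (fderiv ℂ G z) (siegelMap z (0, Complex.I * tubeRho z)) := by
      rw [siegelMap_base]
      exact (hG.differentiableAt (isOpen_tubeDomain.mem_nhds hz)).hasFDerivAt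
    exact (e1.comp_hasDerivAt (Complex.I * tubeRho z)
      (hasDerivAt_siegelMap_zero_right z _)).deriv
  rw [show (m : ℝ) + 2 + β + 1 = 2 + (β + m) + 1 by ring] at h1 h2 ⊢
  rw [h2, integral_halfPlane_reproducing_deriv (mem_tubeDomain_iff.1 hz) (by linarith)
    (differentiableOn_comp_siegelMap_zero hG z) h1, hder]
  push_cast
  ring

lemma reproducing_constant_deriv (m : ℕ) {α : ℝ} (hα : -1 < α) :
    kernelConst m α * kernelExp m α *
      (fibreConst m α * (8 * Real.pi / ((α + m + 1) * (α + m + 2)))) = 2 := by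
  have hm0 : (0 : ℝ) ≤ m := Nat.cast_nonneg m
  have h1 := Real.Gamma_pos_of_pos (s := α + 1) (by linarith)
  have h2 := Real.Gamma_pos_of_pos (s := α + m + 1) (by linarith)
  have h3 : Real.Gamma (kernelExp m α) = (α + m + 1) * Real.Gamma (α + m + 1) := by
    rw [kernelExp_eq, ← Real.Gamma_add_one (by linarith)]
    congr 1; ring
  have h4 : (α + m + 1) ≠ 0 := by linarith
  have h5 : (α + m + 2) ≠ 0 := by linarith
  rw [kernelConst, h3, fibreConst, kernelExp_eq, show (m : ℝ) + 2 + α = α + m + 2 by ring]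
  field_simp
  rw [mul_pow]
  ring

lemma reproducing_constant (m : ℕ) {α : ℝ} (hα : -1 < α) :
    kernelConst m α * kernelExp m α *
      (fibreConst m (α + 1) * (4 * Real.pi / (α + 1 + m + 1))) = α + 1 := by
  have hm0 : (0 : ℝ) ≤ m := Nat.cast_nonneg m
  have h1 := Real.Gamma_pos_of_pos (s := α + 1) (by linarith)
  have h2 := Real.Gamma_pos_of_pos (s := α + m + 1) (by linarith)
  have h4 : (α + m + 1) ≠ 0 := by linarith
  have h5 : (α + m + 2) ≠ 0 := by linarith
  have e1 : Real.Gamma (α + 1 + 1) = (α + 1) * Real.Gamma (α + 1) :=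
    Real.Gamma_add_one (by linarith)
  have e2 : Real.Gamma (α + 1 + m + 1) = (α + m + 1) * Real.Gamma (α + m + 1) := by
    rw [← Real.Gamma_add_one h4]; congr 1; ring
  have h3 : Real.Gamma (kernelExp m α) = (α + m + 1) * Real.Gamma (α + m + 1) := by
    rw [kernelExp_eq, ← Real.Gamma_add_one h4]
    congr 1; ring
  rw [kernelConst, fibreConst, e1, e2, h3, kernelExp_eq, show (m : ℝ) + 2 + α = α + m + 2 by ring,
    show α + 1 + m + 1 = α + m + 2 by ring]
  field_simp
  rw [mul_pow]
  ring

/-! ### Growth of Bloch functions -/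

section Bloch

variable {m : ℕ} {g : CSpace m → ℂ} {A : ℝ}

lemma norm_tubePartialLast_le_of_tubeInvGrad_le (hA : 0 ≤ A) {z : CSpace m}
    (hz : z ∈ tubeDomain m) (h : tubeInvGrad g z ≤ A) :
    ‖tubePartialLast g z‖ ≤ A / tubeRho z := by
  have hρ := mem_tubeDomain_iff.1 hz
  rw [tubeInvGrad, Real.sqrt_le_left hA] at h
  have h0 : 0 ≤ ∑ j, ‖tubePartial g j z + 2 * ((z.1 j).im : ℂ) * tubePartialLast g z‖ ^ 2 :=
    Finset.sum_nonneg fun _ _ => by positivity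
  rw [le_div_iff₀ hρ, ← pow_le_pow_iff_left₀ (by positivity) hA two_ne_zero]
  nlinarith [mul_nonneg hρ.le h0, sq_nonneg (‖tubePartialLast g z‖ * tubeRho z)]

lemma norm_tangential_le_of_tubeInvGrad_le (hA : 0 ≤ A) {z : CSpace m}
    (hz : z ∈ tubeDomain m) (h : tubeInvGrad g z ≤ A) (j : Fin m) :
    ‖tubePartial g j z + 2 * ((z.1 j).im : ℂ) * tubePartialLast g z‖ ≤ A / √(tubeRho z) := by
  have hρ := mem_tubeDomain_iff.1 hz
  rw [tubeInvGrad, Real.sqrt_le_left hA] at h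
  have h0 : ‖tubePartial g j z + 2 * ((z.1 j).im : ℂ) * tubePartialLast g z‖ ^ 2
      ≤ ∑ j, ‖tubePartial g j z + 2 * ((z.1 j).im : ℂ) * tubePartialLast g z‖ ^ 2 :=
    Finset.single_le_sum
      (f := fun j => ‖tubePartial g j z + 2 * ((z.1 j).im : ℂ) * tubePartialLast g z‖ ^ 2)
      (fun _ _ => by positivity) (Finset.mem_univ j)
  rw [le_div_iff₀ (Real.sqrt_pos.2 hρ), ← pow_le_pow_iff_left₀ (by positivity) hA two_ne_zero,
    mul_pow, Real.sq_sqrt hρ.le]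
  have h1 := mul_le_mul_of_nonneg_left h0 hρ.le
  have h2 : 0 ≤ ‖tubePartial g j z + 2 * ((z.1 j).im : ℂ) * tubePartialLast g z‖ ^ 2 := by
    positivity
  nlinarith [mul_nonneg hρ.le h2, mul_nonneg hρ.le (mul_nonneg hρ.le
    (sq_nonneg ‖tubePartialLast g z‖))]

/-- The derivative in any direction, in terms of the components of the invariant gradient. -/
lemma fderiv_apply_eq_tangential (z δ : CSpace m) :
    fderiv ℂ g z δ = ∑ j, δ.1 j * (tubePartial g j z + 2 * ((z.1 j).im : ℂ) * tubePartialLast g z)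
      + (δ.2 - 2 * ∑ j, ((z.1 j).im : ℂ) * δ.1 j) * tubePartialLast g z := by
  have h1 : δ = ∑ j, δ.1 j • ((Pi.single j 1, 0) : CSpace m) + δ.2 • ((0, 1) : CSpace m) := by
    ext j
    · simp [Prod.fst_sum, Pi.single_apply]
    · simp [Prod.snd_sum]
  conv_lhs => rw [h1]
  simp only [map_add, map_sum, map_smul, smul_eq_mul]
  change ∑ j, δ.1 j * tubePartial g j z + δ.2 * tubePartialLast g z = _
  simp only [mul_add, Finset.sum_add_distrib, sub_mul, Finset.mul_sum, Finset.sum_mul]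
  have h2 : ∀ j, δ.1 j * (2 * ((z.1 j).im : ℂ) * tubePartialLast g z)
      = 2 * (((z.1 j).im : ℂ) * δ.1 j) * tubePartialLast g z := fun j => by ring
  simp only [h2]
  ring

lemma tubeRho_add_vertical (z : CSpace m) (t : ℝ) :
    tubeRho (z + (0, Complex.I * t)) = tubeRho z + t := by
  simp [tubeRho]; ring

/-- Along vertical lines a Bloch function grows at most logarithmically. -/
lemma norm_vertical_sub_le (hA : 0 ≤ A) (hg : DifferentiableOn ℂ g (tubeDomain m))
    (hb : ∀ z ∈ tubeDomain m, tubeInvGrad g z ≤ A) {z : CSpace m} (hz : z ∈ tubeDomain m)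
    {R : ℝ} (hR : 0 ≤ R) :
    ‖g (z + (0, Complex.I * R)) - g z‖ ≤ A * Real.log ((tubeRho z + R) / tubeRho z) := by
  have hρ := mem_tubeDomain_iff.1 hz
  have hmem : ∀ t : ℝ, 0 ≤ t → z + (0, Complex.I * t) ∈ tubeDomain m := fun t ht => by
    rw [mem_tubeDomain_iff, tubeRho_add_vertical]; linarith
  have hder : ∀ t : ℝ, 0 ≤ t → HasDerivAt (fun t : ℝ => g (z + (0, Complex.I * t)) - g z)
      (Complex.I * tubePartialLast g (z + (0, Complex.I * t))) t := by
    intro t ht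
    have e1 : HasDerivAt (fun t : ℝ => z + ((0, Complex.I * t) : CSpace m)) (0, Complex.I) t := by
      refine HasDerivAt.const_add _ ((hasDerivAt_const t 0).prodMk ?_)
      simpa using (Complex.ofRealCLM.hasDerivAt (x := t)).const_mul Complex.I
    have e2 := ((hg.differentiableAt (isOpen_tubeDomain.mem_nhds
      (hmem t ht))).hasFDerivAt.restrictScalars ℝ).comp_hasDerivAt t e1
    refine (e2.sub_const (g z)).congr_deriv ?_
    have e3 : ((0, Complex.I) : CSpace m) = Complex.I • (0, 1) := by simp
    simp only [ContinuousLinearMap.coe_restrictScalars']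
    rw [e3, map_smul, smul_eq_mul]
    rfl
  have hB : ∀ t : ℝ, 0 ≤ t → HasDerivAt (fun t => A * Real.log ((tubeRho z + t) / tubeRho z))
      (A / (tubeRho z + t)) t := by
    intro t ht
    have e1 : HasDerivAt (fun t => (tubeRho z + t) / tubeRho z) (1 / tubeRho z) t :=
      ((hasDerivAt_id t).const_add _).div_const _
    have e2 := (e1.log (by positivity)).const_mul A
    refine e2.congr_deriv ?_
    field_simp
  refine image_norm_le_of_norm_deriv_right_le_deriv_boundary'
    (f := fun t : ℝ => g (z + (0, Complex.I * t)) - g z) (a := 0) (b := R)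
    (B := fun t => A * Real.log ((tubeRho z + t) / tubeRho z))
    (fun t ht => (hder t ht.1).continuousAt.continuousWithinAt)
    (fun t ht => (hder t ht.1).hasDerivWithinAt) ?_
    (fun t ht => (hB t ht.1).continuousAt.continuousWithinAt)
    (fun t ht => (hB t ht.1).hasDerivWithinAt) (fun t ht => ?_) ⟨hR, le_rfl⟩
  · have h0 : ((0, 0) : CSpace m) = 0 := rfl
    simp [h0, div_self hρ.ne']
  · rw [norm_mul, Complex.norm_I, one_mul, ← tubeRho_add_vertical]
    exact norm_tubePartialLast_le_of_tubeInvGrad_le hA (hmem t ht.1) (hb _ (hmem t ht.1))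

/-- At height `R`, comparable to the size of `w`, the domain looks bounded: moving from `w` to the
vertical axis there changes a Bloch function by a bounded amount. -/
lemma norm_horizontal_sub_le (hA : 0 ≤ A) (hg : DifferentiableOn ℂ g (tubeDomain m))
    (hb : ∀ z ∈ tubeDomain m, tubeInvGrad g z ≤ A) {w : CSpace m} (hw : w ∈ tubeDomain m)
    {R : ℝ} (hR : R = 1 + ∑ j, ‖w.1 j‖ ^ 2 + ‖w.2‖) :
    ‖g (tubeBase m + (0, Complex.I * R)) - g (w + (0, Complex.I * R))‖ ≤ A * (m + 3) := by
  have hρ := mem_tubeDomain_iff.1 hw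
  have hS0 : 0 ≤ ∑ j, ‖w.1 j‖ ^ 2 := Finset.sum_nonneg fun _ _ => by positivity
  have hR1 : 1 ≤ R := by linarith [norm_nonneg w.2]
  set p : CSpace m := w + (0, Complex.I * R) with hp
  set q : CSpace m := tubeBase m + (0, Complex.I * R) with hq
  have hconv := convex_le_tubeRho (m := m) R
  have hpR : p ∈ {z : CSpace m | R ≤ tubeRho z} := by
    change R ≤ tubeRho p
    rw [hp, tubeRho_add_vertical]; linarith
  have hqR : q ∈ {z : CSpace m | R ≤ tubeRho z} := by
    change R ≤ tubeRho q
    rw [hq, tubeRho_add_vertical, tubeRho_tubeBase]; linarith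
  have hseg : ∀ t ∈ Set.Icc (0 : ℝ) 1, R ≤ tubeRho (p + t • (q - p)) := fun t ht =>
    hconv.add_smul_sub_mem hpR hqR ht
  have hsegm : ∀ t ∈ Set.Icc (0 : ℝ) 1, p + t • (q - p) ∈ tubeDomain m := fun t ht =>
    mem_tubeDomain_iff.2 (by linarith [hseg t ht])
  have hδ1 : ∀ j, (q - p).1 j = -w.1 j := fun j => by simp [hp, hq, tubeBase]
  have hδ2 : (q - p).2 = Complex.I - w.2 := by simp [hp, hq, tubeBase]
  have hwj : ∀ j, ‖w.1 j‖ ≤ √R := fun j => by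
    refine Real.le_sqrt_of_sq_le ?_
    have := Finset.single_le_sum (f := fun j => ‖w.1 j‖ ^ 2) (fun _ _ => by positivity)
      (Finset.mem_univ j)
    linarith [norm_nonneg w.2]
  have hder : ∀ t ∈ Set.Icc (0 : ℝ) 1, HasDerivWithinAt (fun t : ℝ => g (p + t • (q - p)))
      (fderiv ℂ g (p + t • (q - p)) (q - p)) (Set.Icc 0 1) t := by
    intro t ht
    have e1 : HasDerivAt (fun t : ℝ => p + t • (q - p)) (q - p) t := by
      simpa using ((hasDerivAt_id t).smul_const (q - p)).const_add p
    have e2 := ((hg.differentiableAt (isOpen_tubeDomain.mem_nhds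
      (hsegm t ht))).hasFDerivAt.restrictScalars ℝ).comp_hasDerivAt t e1
    exact e2.hasDerivWithinAt
  have hbound : ∀ t ∈ Set.Ico (0 : ℝ) 1,
      ‖fderiv ℂ g (p + t • (q - p)) (q - p)‖ ≤ A * (m + 3) := by
    intro t ht
    have ht' : t ∈ Set.Icc (0 : ℝ) 1 := ⟨ht.1, ht.2.le⟩
    set x := p + t • (q - p) with hx
    have hxR := hseg t ht'
    have hxm := hsegm t ht'
    have hxρ : 0 < tubeRho x := by linarith
    have hxj : ∀ j, |(x.1 j).im| ≤ ‖w.1 j‖ := fun j => by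
      have e : x.1 j = ((1 - t : ℝ) : ℂ) * w.1 j := by
        have : x.1 j = p.1 j + t * (q - p).1 j := by simp [hx]
        rw [this, hδ1, hp]
        simp
        ring
      rw [e]
      refine (Complex.abs_im_le_norm _).trans ?_
      rw [norm_mul, Complex.norm_real, Real.norm_eq_abs, abs_of_nonneg (by linarith [ht.2])]
      exact mul_le_of_le_one_left (norm_nonneg _) (by linarith [ht.1])
    rw [fderiv_apply_eq_tangential]
    have b1 : ‖∑ j, (q - p).1 j *
        (tubePartial g j x + 2 * ((x.1 j).im : ℂ) * tubePartialLast g x)‖ ≤ m * A := by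
      refine (norm_sum_le_of_le (n := fun _ => A) _ fun j _ => ?_).trans (by simp)
      rw [norm_mul, hδ1, norm_neg]
      have h1 := norm_tangential_le_of_tubeInvGrad_le hA hxm (hb x hxm) j
      have h2 : √R ≤ √(tubeRho x) := Real.sqrt_le_sqrt hxR
      have h3 : 0 < √R := Real.sqrt_pos.2 (by linarith)
      calc _ ≤ √R * (A / √R) := by
            refine mul_le_mul (hwj j) (h1.trans ?_) (norm_nonneg _) h3.le
            gcongr
        _ = A := by field_simp
    have b2 : ‖(q - p).2 - 2 * ∑ j, ((x.1 j).im : ℂ) * (q - p).1 j‖ ≤ 3 * R := by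
      have h1 : ‖(q - p).2‖ ≤ R := by
        rw [hδ2]
        refine (norm_sub_le _ _).trans ?_
        rw [Complex.norm_I]; linarith
      have h2 : ‖∑ j, ((x.1 j).im : ℂ) * (q - p).1 j‖ ≤ ∑ j, ‖w.1 j‖ ^ 2 := by
        refine norm_sum_le_of_le _ fun j _ => ?_
        rw [norm_mul, hδ1, norm_neg, Complex.norm_real, Real.norm_eq_abs, pow_two]
        exact mul_le_mul_of_nonneg_right (hxj j) (norm_nonneg _)
      refine (norm_sub_le _ _).trans ?_
      rw [norm_mul, Complex.norm_ofNat]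
      linarith [norm_nonneg w.2]
    have b3 : ‖tubePartialLast g x‖ ≤ A / R :=
      (norm_tubePartialLast_le_of_tubeInvGrad_le hA hxm (hb x hxm)).trans (by gcongr)
    calc _ ≤ m * A + 3 * R * (A / R) := by
          refine (norm_add_le _ _).trans (add_le_add b1 ?_)
          rw [norm_mul]
          gcongr
      _ = A * (m + 3) := by field_simp
  have := norm_image_sub_le_of_norm_deriv_le_segment_01' hder hbound
  simpa using this

lemma exists_norm_le_of_tubeInvGrad_le (hA : 0 ≤ A) (hg : DifferentiableOn ℂ g (tubeDomain m))
    (hb : ∀ z ∈ tubeDomain m, tubeInvGrad g z ≤ A) {ε : ℝ} (hε : 0 < ε) :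
    ∃ C : ℝ, 0 ≤ C ∧ ∀ w ∈ tubeDomain m,
      ‖g w‖ ≤ C * (tubeRho w ^ (-ε) * ‖tubeRho₂ (tubeBase m) w‖ ^ (2 * ε)) := by
  refine ⟨(‖g (tubeBase m)‖ + A * (m + 3) + 2 * A / ε) * 20 ^ ε, by positivity, fun w hw => ?_⟩
  have hρ := mem_tubeDomain_iff.1 hw
  set R := 1 + ∑ j, ‖w.1 j‖ ^ 2 + ‖w.2‖ with hR
  set N := ‖tubeRho₂ (tubeBase m) w‖ with hN
  have hRN : R ≤ 8 * N := size_le_norm_tubeRho₂_base hw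
  have hS0 : 0 ≤ ∑ j, ‖w.1 j‖ ^ 2 := Finset.sum_nonneg fun _ _ => by positivity
  have hR1 : 1 ≤ R := by linarith [norm_nonneg w.2]
  have hN1 : 1 / 2 ≤ N := by
    have := tubeRho_le_norm_tubeRho₂ (z := tubeBase m) hw
    rwa [tubeRho_tubeBase] at this
  have hN2 : tubeRho w / 2 ≤ N := tubeRho_le_norm_tubeRho₂' tubeBase_mem
  -- one quantity dominating the arguments of both logarithms below
  set X := 20 * N ^ 2 / tubeRho w with hX
  have hX1 : 10 * N ≤ X := by
    rw [hX, le_div_iff₀ hρ]; nlinarith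
  have hX2 : (tubeRho w + R) / tubeRho w ≤ X := by
    rw [hX]; gcongr; nlinarith
  have hX3 : 1 ≤ X := by linarith
  have hXε : X ^ ε = 20 ^ ε * (tubeRho w ^ (-ε) * N ^ (2 * ε)) := by
    rw [hX, div_eq_mul_inv, Real.mul_rpow (by positivity) (by positivity),
      Real.mul_rpow (by norm_num) (by positivity), Real.inv_rpow hρ.le, Real.rpow_neg hρ.le,
      ← Real.rpow_natCast N 2, ← Real.rpow_mul (by linarith)]
    push_cast
    ring
  have hlogX : Real.log X ≤ X ^ ε / ε := Real.log_le_rpow_div (by linarith) hε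
  have v1 := norm_vertical_sub_le hA hg hb hw (R := R) (by linarith)
  have v2 := norm_vertical_sub_le hA hg hb (tubeBase_mem (m := m)) (R := R) (by linarith)
  have v3 := norm_horizontal_sub_le hA hg hb hw hR
  rw [tubeRho_tubeBase, div_one] at v2
  have l1 : Real.log ((tubeRho w + R) / tubeRho w) ≤ X ^ ε / ε :=
    (Real.log_le_log (by positivity) hX2).trans hlogX
  have l2 : Real.log (1 + R) ≤ X ^ ε / ε :=
    (Real.log_le_log (by positivity) (by linarith)).trans hlogX
  have hXε1 : 1 ≤ X ^ ε := Real.one_le_rpow hX3 hε.le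
  have htri : ‖g w‖ ≤ ‖g (tubeBase m)‖
      + ‖g (tubeBase m + (0, Complex.I * R)) - g (tubeBase m)‖
      + ‖g (tubeBase m + (0, Complex.I * R)) - g (w + (0, Complex.I * R))‖
      + ‖g (w + (0, Complex.I * R)) - g w‖ := by
    have e : g w = g (tubeBase m) + (g (tubeBase m + (0, Complex.I * R)) - g (tubeBase m))
      - (g (tubeBase m + (0, Complex.I * R)) - g (w + (0, Complex.I * R)))
      - (g (w + (0, Complex.I * R)) - g w) := by ring
    calc ‖g w‖ = ‖_‖ := congrArg _ e
      _ ≤ _ := (norm_sub_le _ _).trans (add_le_add ((norm_sub_le _ _).trans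
        (add_le_add (norm_add_le _ _) le_rfl)) le_rfl)
  calc ‖g w‖ ≤ ‖g (tubeBase m)‖ + A * (X ^ ε / ε) + A * (m + 3) + A * (X ^ ε / ε) := by
        have := mul_le_mul_of_nonneg_left l1 hA
        have := mul_le_mul_of_nonneg_left l2 hA
        linarith
    _ = (‖g (tubeBase m)‖ + A * (m + 3)) * 1 + 2 * A / ε * X ^ ε := by ring
    _ ≤ (‖g (tubeBase m)‖ + A * (m + 3)) * X ^ ε + 2 * A / ε * X ^ ε := by gcongr
    _ = _ := by rw [hXε]; ring

end Bloch

/-! ### Derivatives of holomorphic functions of several variables -/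

/-- Complex differentiability on an open set passes to directional derivatives: by Cauchy's formula
in the direction `v` the derivative is an average of translates of `g`, which may be
differentiated under the integral sign. -/
lemma differentiableOn_fderiv_apply {E : Type*} [NormedAddCommGroup E] [NormedSpace ℂ E]
    [FiniteDimensional ℂ E] [MeasurableSpace E] [BorelSpace E] {U : Set E} (hU : IsOpen U) {g : E → ℂ}
    (hg : DifferentiableOn ℂ g U) (v : E) :
    DifferentiableOn ℂ (fun x => fderiv ℂ g x v) U := by
  intro x₀ hx₀
  have hgx₀ := (hg.differentiableAt (hU.mem_nhds hx₀)).continuousAt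
  obtain ⟨R, hR, hball⟩ : ∃ R > 0, Metric.ball x₀ (3 * R) ⊆
      U ∩ {x | dist (g x) (g x₀) < 1} := by
    obtain ⟨R, hR, h⟩ := Metric.mem_nhds_iff.1 (Filter.inter_mem (hU.mem_nhds hx₀)
      (hgx₀ (Metric.ball_mem_nhds _ one_pos)))
    exact ⟨R / 3, by positivity, by rwa [mul_div_cancel₀ R (by norm_num)]⟩
  obtain ⟨s, hs, hsv⟩ : ∃ s : ℝ, 0 < s ∧ s * ‖v‖ < R :=
    ⟨R / (‖v‖ + 1), by positivity, by
      rw [div_mul_eq_mul_div, div_lt_iff₀ (by positivity)]; nlinarith [norm_nonneg v]⟩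
  have hs' : (s : ℂ) ≠ 0 := by exact_mod_cast hs.ne'
  have hshift : ∀ x ∈ Metric.ball x₀ R, ∀ c : ℂ, ‖c‖ ≤ 1 →
      x + (s * c) • v ∈ Metric.ball x₀ (2 * R) := by
    intro x hx c hc
    rw [mem_ball_iff_norm] at hx ⊢
    have h1 : ‖(s * c) • v‖ ≤ s * ‖v‖ := by
      rw [norm_smul, norm_mul, Complex.norm_real, Real.norm_eq_abs, abs_of_pos hs]
      have := mul_le_mul_of_nonneg_left hc hs.le
      gcongr
      linarith
    calc ‖x + (s * c) • v - x₀‖ = ‖(x - x₀) + (s * c) • v‖ := by congr 1; abel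
      _ ≤ _ := norm_add_le _ _
      _ < 2 * R := by linarith
  have hsub : Metric.ball x₀ (2 * R) ⊆ Metric.ball x₀ (3 * R) :=
    Metric.ball_subset_ball (by linarith)
  have hmem : ∀ x ∈ Metric.ball x₀ R, ∀ c : ℂ, ‖c‖ ≤ 1 → x + (s * c) • v ∈ U :=
    fun x hx c hc => (hball (hsub (hshift x hx c hc))).1
  have hfb : ∀ y ∈ Metric.ball x₀ (2 * R), ‖fderiv ℂ g y‖ ≤ 2 / R := by
    intro y hy
    have hyb : Metric.ball y R ⊆ Metric.ball x₀ (3 * R) :=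
      Metric.ball_subset_ball' (by have := Metric.mem_ball.1 hy; linarith)
    refine Complex.norm_fderiv_le_div_of_mapsTo_ball
      (hg.mono fun x hx => (hball (hyb hx)).1) (fun x hx => ?_) hR
    have h1 : dist (g x) (g x₀) < 1 := (hball (hyb hx)).2
    have h2 : dist (g y) (g x₀) < 1 := (hball (hsub hy)).2
    rw [Metric.mem_closedBall]
    linarith [dist_triangle_right (g x) (g y) (g x₀)]
  have hcm : ∀ θ : ℝ, ‖circleMap 0 1 θ‖ ≤ 1 := fun θ => by simp
  have hpath : ∀ x : E, Continuous fun θ : ℝ => x + (s * circleMap 0 1 θ) • v := fun x =>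
    continuous_const.add ((continuous_const.mul (continuous_circleMap 0 1)).smul
      continuous_const)
  have hconjc : Continuous fun θ : ℝ => (starRingEnd ℂ) (circleMap 0 1 θ) :=
    Complex.continuous_conj.comp (continuous_circleMap 0 1)
  have hF : ∀ x ∈ Metric.ball x₀ R, Continuous fun θ : ℝ =>
      (starRingEnd ℂ) (circleMap 0 1 θ) * g (x + (s * circleMap 0 1 θ) • v) := by
    intro x hx
    refine hconjc.mul (continuous_iff_continuousAt.2 fun θ => ?_)
    exact ContinuousAt.comp (f := fun θ : ℝ => x + (s * circleMap 0 1 θ) • v)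
      (hg.differentiableAt (hU.mem_nhds (hmem x hx _ (hcm θ)))).continuousAt
      (hpath x).continuousAt
  have hmain := intervalIntegral.hasFDerivAt_integral_of_dominated_of_fderiv_le
    (μ := volume) (a := 0) (b := 2 * Real.pi) (x₀ := x₀) (s := Metric.ball x₀ R)
    (F := fun x θ => (starRingEnd ℂ) (circleMap 0 1 θ) * g (x + (s * circleMap 0 1 θ) • v))
    (F' := fun x θ => (starRingEnd ℂ) (circleMap 0 1 θ) •
      fderiv ℂ g (x + (s * circleMap 0 1 θ) • v)) (bound := fun _ => 2 / R)
    (Metric.ball_mem_nhds _ hR)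
    (by filter_upwards [Metric.ball_mem_nhds x₀ hR] with x hx
        using (hF x hx).aestronglyMeasurable)
    ((hF x₀ (Metric.mem_ball_self hR)).intervalIntegrable _ _)
    (by
      refine AEStronglyMeasurable.smul hconjc.aestronglyMeasurable ?_
      exact ((measurable_fderiv ℂ g).comp (hpath x₀).measurable).aestronglyMeasurable)
    (Filter.Eventually.of_forall fun θ _ x hx => by
      rw [norm_smul, RCLike.norm_conj]
      exact (mul_le_of_le_one_left (norm_nonneg _) (hcm θ)).trans
        (hfb _ (hshift x hx _ (hcm θ))))
    intervalIntegrable_const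
    (Filter.Eventually.of_forall fun θ _ x hx =>
      ((hasFDerivAt_comp_add_right _).2
        (hg.differentiableAt (hU.mem_nhds (hmem x hx _ (hcm θ)))).hasFDerivAt).const_mul _)
  have heq : (fun x => fderiv ℂ g x v) =ᶠ[nhds x₀] fun x => (s : ℂ)⁻¹ * ((2 * Real.pi)⁻¹ •
      ∫ θ in (0 : ℝ)..2 * Real.pi, (starRingEnd ℂ) (circleMap 0 1 θ) *
        g (x + (s * circleMap 0 1 θ) • v)) := by
    filter_upwards [Metric.ball_mem_nhds x₀ hR] with x hx
    have hd : DifferentiableOn ℂ (fun c : ℂ => g (x + (s * c) • v))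
        ((fun c : ℂ => x + (s * c) • v) ⁻¹' U) :=
      hg.comp (by fun_prop) (Set.mapsTo_preimage _ _)
    have h1 := circleAverage_conj_mul (U := (fun c : ℂ => x + (s * c) • v) ⁻¹' U)
      (fun c hc => hmem x hx c (by simpa using hc)) hd
    have h2 : HasDerivAt (fun c : ℂ => g (x + (s * c) • v)) (fderiv ℂ g x ((s : ℂ) • v)) 0 := by
      have e1 : HasDerivAt (fun c : ℂ => x + (s * c) • v) ((s : ℂ) • v) 0 := by
        simpa using (((hasDerivAt_id (0 : ℂ)).const_mul (s : ℂ)).smul_const v).const_add x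
      have e2 : HasFDerivAt g (fderiv ℂ g x) (x + ((s : ℂ) * 0) • v) := by
        have := hmem x hx 0 (by simp)
        simp only [mul_zero, zero_smul, add_zero] at this ⊢
        exact (hg.differentiableAt (hU.mem_nhds this)).hasFDerivAt
      exact e2.comp_hasDerivAt (0 : ℂ) e1
    rw [h2.deriv, map_smul, smul_eq_mul, Real.circleAverage] at h1
    rw [h1, inv_mul_cancel_left₀ hs']
  refine DifferentiableAt.differentiableWithinAt (DifferentiableAt.congr_of_eventuallyEq ?_ heq)
  exact (hmain.differentiableAt.const_smul (2 * Real.pi : ℝ)⁻¹).const_mul _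

/-! ### The projection onto the Bloch space -/

section BlochProjection

variable {m : ℕ} {α ε C : ℝ} {f g : CSpace m → ℂ}

lemma IsTubeBloch.exists_bound (hg : IsTubeBloch g) :
    ∃ A : ℝ, 0 ≤ A ∧ ∀ z ∈ tubeDomain m, tubeInvGrad g z ≤ A := by
  obtain ⟨A, hA⟩ := hg.2
  exact ⟨A, (Real.sqrt_nonneg _).trans (hA ⟨tubeBase m, tubeBase_mem, rfl⟩),
    fun z hz => hA ⟨z, hz, rfl⟩⟩

lemma IsTubeBloch.exists_hasTubeGrowth (hg : IsTubeBloch g) (hε : 0 < ε) :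
    ∃ C : ℝ, 0 ≤ C ∧ HasTubeGrowth ε C g := by
  obtain ⟨A, hA, hb⟩ := hg.exists_bound
  obtain ⟨C, hC, h⟩ := exists_norm_le_of_tubeInvGrad_le hA hg.1 hb hε
  refine ⟨C, hC, hg.1.continuousOn.aestronglyMeasurable isOpen_tubeDomain.measurableSet, ?_⟩
  filter_upwards [ae_tubeVolume_mem m] with w hw using h w hw

lemma hasTubeGrowth_of_memLp (hf : MemLp f ∞ (tubeVolume m)) :
    HasTubeGrowth 0 (eLpNorm f ∞ (tubeVolume m)).toReal f := by
  refine ⟨hf.1, ?_⟩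
  filter_upwards [ae_le_eLpNormEssSup (f := f) (μ := tubeVolume m)] with w hw
  simp only [neg_zero, Real.rpow_zero, mul_zero, mul_one]
  rw [eLpNorm_exponent_top]
  have h := ENNReal.toReal_mono (by simpa using hf.2.ne) hw
  simpa using h

lemma HasTubeGrowth.differentiableOn_tubeModProj (hα : -1 < α) (hε : 0 ≤ ε) (hεα : ε < α + 1)
    (hε2 : ε < 1 / 2) (hC : 0 ≤ C) (hf : HasTubeGrowth ε C f) :
    DifferentiableOn ℂ (tubeModProj α f) (tubeDomain m) := fun _ hz =>
  (hf.hasFDerivAt_tubeModProj hα hε hεα hε2 hC hz).differentiableAt.differentiableWithinAt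

lemma tubeModProj_tubeBase (α : ℝ) (f : CSpace m → ℂ) : tubeModProj α f (tubeBase m) = 0 := by
  simp [tubeModProj, tubeModKernel]

/-- A point `z` is comparable with the base point, as far as `|ρ(·,w)|` is concerned, and remains
so with the same constant when it moves up vertically. -/
lemma exists_norm_tubeRho₂_base_le {z : CSpace m} (hz : z ∈ tubeDomain m) :
    ∃ L : ℝ, 0 ≤ L ∧ ∀ t : ℝ, 0 ≤ t → ∀ w ∈ tubeDomain m,
      ‖tubeRho₂ (tubeBase m) w‖ ≤ L * ‖tubeRho₂ (z + (0, Complex.I * t)) w‖ := by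
  obtain ⟨L, hL, h⟩ := exists_norm_tubeRho₂_le_mul m (max 1 ‖z‖) (tubeRho z) (by positivity)
    (mem_tubeDomain_iff.1 hz)
  refine ⟨L, hL.le, fun t ht w hw => (h z (tubeBase m) w (le_max_right _ _)
    ((norm_tubeBase_le m).trans (le_max_left _ _)) le_rfl hw).trans ?_⟩
  gcongr
  have e : tubeRho₂ (z + (0, Complex.I * t)) w = tubeRho₂ z w + ((t / 2 : ℝ) : ℂ) := by
    simp only [tubeRho₂, Prod.fst_add, Prod.snd_add, add_zero]
    push_cast
    linear_combination (-(t : ℂ) / 2) * Complex.I_mul_I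
  have hre := re_tubeRho₂_pos hz hw
  rw [e, ← pow_le_pow_iff_left₀ (norm_nonneg _) (norm_nonneg _) two_ne_zero,
    ← Complex.normSq_eq_norm_sq, ← Complex.normSq_eq_norm_sq, Complex.normSq_apply,
    Complex.normSq_apply, Complex.add_re, Complex.add_im, Complex.ofReal_re, Complex.ofReal_im]
  nlinarith [mul_nonneg hre.le ht]

/-- The invariant gradient of `P̃_α f` is controlled by `‖f‖_∞`. -/
lemma exists_tubeInvGrad_tubeModProj_le (m : ℕ) {α : ℝ} (hα : -1 < α) :
    ∃ K : ℝ, 0 ≤ K ∧ ∀ f : CSpace m → ℂ, MemLp f ∞ (tubeVolume m) → ∀ z ∈ tubeDomain m,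
      tubeInvGrad (tubeModProj α f) z ≤ K * (eLpNorm f ∞ (tubeVolume m)).toReal := by
  obtain ⟨K, hK, h⟩ := exists_norm_deriv_tubeModProj_le m (ε := 0) hα le_rfl (by linarith)
    (by norm_num)
  refine ⟨√(8 + 4 * m) * K, by positivity, fun f hf z hz => ?_⟩
  set N := (eLpNorm f ∞ (tubeVolume m)).toReal with hN
  have hN0 : 0 ≤ N := ENNReal.toReal_nonneg
  have hρ := mem_tubeDomain_iff.1 hz
  obtain ⟨L, hL, hcmp⟩ := exists_norm_tubeRho₂_base_le hz
  have hcmp0 := hcmp 0 le_rfl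
  simp only [Complex.ofReal_zero, mul_zero, Prod.mk_zero_zero, add_zero] at hcmp0
  obtain ⟨h1, h2⟩ := h N f hN0 (hasTubeGrowth_of_memLp hf) z L hz hL hcmp0
  simp only [mul_zero, Real.rpow_zero, mul_one, zero_sub, Real.rpow_neg_one] at h1 h2
  have h3 : tubeRho z ^ (-(1 / 2) : ℝ) = (√(tubeRho z))⁻¹ := by
    rw [Real.rpow_neg hρ.le, Real.sqrt_eq_rpow]
  rw [h3] at h2
  refine Real.sqrt_le_iff.2 ⟨by positivity, ?_⟩
  have b1 : ‖tubePartialLast (tubeModProj α f) z‖ ^ 2 ≤ (K * N) ^ 2 * (tubeRho z ^ 2)⁻¹ := by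
    calc _ ≤ (K * N * (tubeRho z)⁻¹) ^ 2 := by gcongr
      _ = _ := by ring
  have b2 : ∑ j, ‖tubePartial (tubeModProj α f) j z
      + 2 * ((z.1 j).im : ℂ) * tubePartialLast (tubeModProj α f) z‖ ^ 2
      ≤ m * ((K * N) ^ 2 * (tubeRho z)⁻¹) := by
    refine (Finset.sum_le_card_nsmul _ _ ((K * N) ^ 2 * (tubeRho z)⁻¹) fun j _ => ?_).trans
      (by simp)
    calc _ ≤ (K * N * (√(tubeRho z))⁻¹) ^ 2 := by gcongr; exact h2 j
      _ = _ := by rw [mul_pow, inv_pow, Real.sq_sqrt hρ.le]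
  calc _ ≤ 4 * tubeRho z * (2 * tubeRho z * ((K * N) ^ 2 * (tubeRho z ^ 2)⁻¹)
        + m * ((K * N) ^ 2 * (tubeRho z)⁻¹)) := by gcongr
    _ = (8 + 4 * m) * (K * N) ^ 2 := by field_simp; ring
    _ = (√(8 + 4 * m) * K * N) ^ 2 := by
        have hsq := Real.sq_sqrt (show (0 : ℝ) ≤ 8 + 4 * m by positivity)
        linear_combination (-(K * N) ^ 2) * hsq

/-- If `∂_n (P̃_α f - g) = 0` then `P̃_α f - g` is invariant under vertical translations, along which
its tangential derivatives decay; so it is constant. -/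
lemma tubeModProj_eq_of_tubePartialLast_eq (hα : -1 < α) (hε : 0 ≤ ε) (hεα : ε < α + 1)
    (hε2 : ε < 1 / 2) (hC : 0 ≤ C) (hf : HasTubeGrowth ε C f) (hg : IsTubeBlochZero g)
    (hlast : ∀ z ∈ tubeDomain m, tubePartialLast (tubeModProj α f) z = tubePartialLast g z)
    {z : CSpace m} (hz : z ∈ tubeDomain m) : tubeModProj α f z = g z := by
  have hP := hf.differentiableOn_tubeModProj hα hε hεα hε2 hC
  have hPd : ∀ x ∈ tubeDomain m, DifferentiableAt ℂ (tubeModProj α f) x := fun x hx =>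
    hP.differentiableAt (isOpen_tubeDomain.mem_nhds hx)
  have hgd : ∀ x ∈ tubeDomain m, DifferentiableAt ℂ g x := fun x hx =>
    hg.1.1.differentiableAt (isOpen_tubeDomain.mem_nhds hx)
  set h : CSpace m → ℂ := fun x => tubeModProj α f x - g x with hh
  have hfd : ∀ x ∈ tubeDomain m, fderiv ℂ h x = fderiv ℂ (tubeModProj α f) x - fderiv ℂ g x :=
    fun x hx => fderiv_fun_sub (hPd x hx) (hgd x hx)
  have hlast0 : ∀ x ∈ tubeDomain m, tubePartialLast h x = 0 := fun x hx => by
    have := hlast x hx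
    simp only [tubePartialLast] at this ⊢
    rw [hfd x hx, sub_apply, this, sub_self]
  have hd : DifferentiableOn ℂ h (tubeDomain m) := hP.sub hg.1.1
  have hmem : ∀ x ∈ tubeDomain m, ∀ t : ℝ, 0 ≤ t → x + (0, Complex.I * t) ∈ tubeDomain m :=
    fun x hx t ht => by
      rw [mem_tubeDomain_iff] at hx ⊢
      rw [tubeRho_add_vertical]; linarith
  -- vertical translations do not change `h`, hence do not change its derivative
  have hinv : ∀ x ∈ tubeDomain m, ∀ t : ℝ, 0 ≤ t → h (x + (0, Complex.I * t)) = h x := by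
    intro x hx t ht
    have hder : ∀ τ ∈ Set.Icc (0 : ℝ) 1, HasDerivWithinAt
        (fun τ : ℝ => h (x + (0, Complex.I * (τ * t : ℝ)))) 0 (Set.Icc 0 1) τ := by
      intro τ hτ
      have hx' := hmem x hx (τ * t) (mul_nonneg hτ.1 ht)
      have e1 : HasDerivAt (fun τ : ℝ => x + ((0, Complex.I * (τ * t : ℝ)) : CSpace m))
          (0, Complex.I * t) τ := by
        refine HasDerivAt.const_add _ ((hasDerivAt_const τ 0).prodMk ?_)
        have := (((hasDerivAt_id τ).mul_const t).ofReal_comp).const_mul Complex.I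
        simpa using this
      have e2 := ((hd.differentiableAt (isOpen_tubeDomain.mem_nhds
        hx')).hasFDerivAt.restrictScalars ℝ).comp_hasDerivAt τ e1
      refine (e2.congr_deriv ?_).hasDerivWithinAt
      have e3 : ((0, Complex.I * t) : CSpace m) = (Complex.I * t) • (0, 1) := by simp
      rw [ContinuousLinearMap.coe_restrictScalars', e3, map_smul]
      exact (congrArg _ (hlast0 _ hx')).trans (smul_zero _)
    have := norm_image_sub_le_of_norm_deriv_le_segment_01' hder (C := 0) (fun _ _ => by simp)
    have h0 : ((0, 0) : CSpace m) = 0 := rfl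
    simpa [h0, sub_eq_zero] using this
  have hfinv : ∀ x ∈ tubeDomain m, ∀ t : ℝ, 0 ≤ t →
      fderiv ℂ h (x + (0, Complex.I * t)) = fderiv ℂ h x := by
    intro x hx t ht
    rw [← fderiv_comp_add_right]
    refine Filter.EventuallyEq.fderiv_eq ?_
    filter_upwards [isOpen_tubeDomain.mem_nhds hx] with y hy using hinv y hy t ht
  have htang : ∀ x ∈ tubeDomain m, ∀ j, tubePartial h j x = 0 := by
    intro x hx j
    obtain ⟨A, hA, hb⟩ := hg.1.exists_bound
    obtain ⟨K, hK, hbd⟩ := exists_norm_deriv_tubeModProj_le m hα hε hεα hε2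
    obtain ⟨L, hL, hcmp⟩ := exists_norm_tubeRho₂_base_le hx
    have hρ := mem_tubeDomain_iff.1 hx
    have hle : ∀ t : ℝ, 0 ≤ t → ‖tubePartial h j x‖ ≤
        K * C * L ^ (2 * ε) * (tubeRho x + t) ^ (-(1 / 2 - ε))
          + A * (tubeRho x + t) ^ (-(1 / 2) : ℝ) := by
      intro t ht
      have hxt := hmem x hx t ht
      have h1 := (hbd C f hC hf _ L hxt hL (hcmp t ht)).2 j
      have h2 := norm_tangential_le_of_tubeInvGrad_le hA hxt (hb _ hxt) j
      have hρt : 0 < tubeRho x + t := by linarith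
      rw [tubeRho_add_vertical] at h1 h2
      rw [Real.sqrt_eq_rpow, div_eq_mul_inv, ← Real.rpow_neg hρt.le] at h2
      have e : tubePartial h j x
          = (tubePartial (tubeModProj α f) j (x + (0, Complex.I * t))
            + 2 * (((x + (0, Complex.I * t)).1 j).im : ℂ) *
              tubePartialLast (tubeModProj α f) (x + (0, Complex.I * t)))
          - (tubePartial g j (x + (0, Complex.I * t))
            + 2 * (((x + (0, Complex.I * t)).1 j).im : ℂ) *
              tubePartialLast g (x + (0, Complex.I * t))) := by
        rw [hlast _ hxt, add_sub_add_right_eq_sub, tubePartial, ← hfinv x hx t ht, hfd _ hxt]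
        rfl
      rw [e, neg_sub]
      exact (norm_sub_le _ _).trans (add_le_add h1 h2)
    have hlim : Filter.Tendsto (fun t : ℝ => K * C * L ^ (2 * ε) *
        (tubeRho x + t) ^ (-(1 / 2 - ε)) + A * (tubeRho x + t) ^ (-(1 / 2) : ℝ))
        Filter.atTop (nhds 0) := by
      have ht := Filter.tendsto_atTop_add_const_left Filter.atTop (tubeRho x) Filter.tendsto_id
      have l1 := (tendsto_rpow_neg_atTop (show 0 < 1 / 2 - ε by linarith)).comp ht
      have l2 := (tendsto_rpow_neg_atTop (show (0 : ℝ) < 1 / 2 by norm_num)).comp ht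
      simpa using (l1.const_mul (K * C * L ^ (2 * ε))).add (l2.const_mul A)
    have := ge_of_tendsto hlim
      (Filter.eventually_atTop.2 ⟨0, fun t ht => hle t ht⟩)
    exact norm_le_zero_iff.1 this
  have hzero : Set.EqOn (fderiv ℂ h) 0 (tubeDomain m) := by
    intro x hx
    refine ContinuousLinearMap.ext fun δ => ?_
    rw [fderiv_apply_eq_tangential]
    simp [htang x hx, hlast0 x hx]
  have hconst := isOpen_tubeDomain.is_const_of_fderiv_eq_zero
    (convex_tubeDomain (m := m)).isPreconnected hd hzero hz tubeBase_mem
  simp only [hh, tubeModProj_tubeBase, hg.2, sub_zero] at hconst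
  exact sub_eq_zero.1 hconst

/-- `P̃_α` fixes the Bloch functions vanishing at the base point. -/
lemma tubeModProj_eq_self (hα : -1 < α) (hg : IsTubeBlochZero g) {z : CSpace m}
    (hz : z ∈ tubeDomain m) :
    Integrable (fun w => tubeModKernel α z w * g w) (tubeWeighted m α) ∧
      tubeModProj α g z = g z := by
  -- any growth exponent below `min (α + 1) (1/2)` makes the integrals converge
  obtain ⟨ε, hε, hε'⟩ := exists_between (show 0 < min (α + 1) (1 / 2) from
    lt_min (by linarith) (by norm_num))
  obtain ⟨hεα, hε2⟩ := lt_min_iff.1 hε'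
  obtain ⟨C, hC, hgr⟩ := hg.1.exists_hasTubeGrowth hε
  refine ⟨hgr.integrable_tubeModKernel_mul hα hε.le hεα hε2 hC hz,
    tubeModProj_eq_of_tubePartialLast_eq hα hε.le hεα hε2 hC hgr hg (fun x hx => ?_) hz⟩
  have hint := hgr.integrable_mul_tubeRho₂_cpow hα hε.le hεα hε2 hC hx
  rw [integrable_tubeWeighted_iff] at hint
  rw [hgr.tubePartialLast_tubeModProj hα hε.le hεα hε2 hC hx, integral_tubeWeighted]
  rw [kernelExp_eq] at hint ⊢
  rw [integral_tube_reproducing_deriv hα hg.1.1 hx hint]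
  have h := congrArg (fun r : ℝ => (r : ℂ)) (reproducing_constant_deriv m hα)
  simp only [Complex.ofReal_mul, kernelExp_eq] at h
  push_cast at h ⊢
  linear_combination (-(Complex.I ^ 2) / 2 * tubePartialLast g x) * h
    - tubePartialLast g x * Complex.I_sq

/-- The bounded function `-2i/(α+1) ρ ∂_n g`, from which `P̃_α` recovers `g`. -/
noncomputable def blochPreimage (α : ℝ) (g : CSpace m → ℂ) (w : CSpace m) : ℂ :=
  -(2 * Complex.I) / ((α + 1 : ℝ) : ℂ) * (tubeRho w * tubePartialLast g w)

lemma differentiableOn_tubePartialLast (hg : DifferentiableOn ℂ g (tubeDomain m)) :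
    DifferentiableOn ℂ (tubePartialLast g) (tubeDomain m) :=
  differentiableOn_fderiv_apply isOpen_tubeDomain hg _

lemma memLp_blochPreimage (hα : -1 < α) (hg : IsTubeBloch g) :
    MemLp (blochPreimage α g) ∞ (tubeVolume m) := by
  obtain ⟨A, hA, hb⟩ := hg.exists_bound
  refine memLp_top_of_bound (C := 2 / (α + 1) * A) ?_ ?_
  · refine ContinuousOn.aestronglyMeasurable ?_ isOpen_tubeDomain.measurableSet
    exact continuousOn_const.mul ((Complex.continuous_ofReal.comp
      continuous_tubeRho).continuousOn.mul (differentiableOn_tubePartialLast hg.1).continuousOn)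
  · filter_upwards [ae_tubeVolume_mem m] with w hw
    have hρ := mem_tubeDomain_iff.1 hw
    have h1 := norm_tubePartialLast_le_of_tubeInvGrad_le hA hw (hb w hw)
    rw [le_div_iff₀ hρ] at h1
    rw [blochPreimage, norm_mul, norm_div, norm_neg, norm_mul, norm_mul, Complex.norm_I,
      Complex.norm_real, Complex.norm_real, Complex.norm_ofNat, Real.norm_eq_abs,
      Real.norm_eq_abs, abs_of_pos hρ, abs_of_pos (by linarith), mul_one, mul_comm (tubeRho w)]
    have : 0 < α + 1 := by linarith
    gcongr

lemma tubeModProj_blochPreimage (hα : -1 < α) (hg : IsTubeBlochZero g) {z : CSpace m}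
    (hz : z ∈ tubeDomain m) : tubeModProj α (blochPreimage α g) z = g z := by
  have hgr := hasTubeGrowth_of_memLp (memLp_blochPreimage hα hg.1)
  have h0α : 0 < α + 1 := by linarith
  refine tubeModProj_eq_of_tubePartialLast_eq hα le_rfl h0α (by norm_num)
    ENNReal.toReal_nonneg hgr hg (fun x hx => ?_) hz
  have hα0 : ((α + 1 : ℝ) : ℂ) ≠ 0 := by exact_mod_cast h0α.ne'
  have hint := hgr.integrable_mul_tubeRho₂_cpow hα le_rfl h0α (by norm_num)
    ENNReal.toReal_nonneg hx
  rw [integrable_tubeWeighted_iff] at hint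
  -- the factor `ρ` raises the weight exponent to `α + 1`, which matches the order of `∂_n K_α`
  have hfun : ∀ w, (truncPow α (tubeRho w) : ℂ) * (blochPreimage α g w *
        tubeRho₂ x w ^ ((-(kernelExp m α + 1) : ℝ) : ℂ))
      = -(2 * Complex.I) / ((α + 1 : ℝ) : ℂ) * ((truncPow (α + 1) (tubeRho w) : ℂ) *
        (tubePartialLast g w * tubeRho₂ x w ^ ((-(m + 2 + (α + 1)) : ℝ) : ℂ))) := by
    intro w
    have e : (truncPow (α + 1) (tubeRho w) : ℂ) = truncPow α (tubeRho w) * tubeRho w := by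
      rcases le_or_gt (tubeRho w) 0 with h | h
      · simp [truncPow_of_nonpos h]
      · rw [truncPow_of_pos h, truncPow_of_pos h, Real.rpow_add_one h.ne']; push_cast; rfl
    rw [e, blochPreimage, kernelExp_eq, show (m : ℝ) + 2 + α + 1 = m + 2 + (α + 1) by ring]
    ring
  simp only [hfun] at hint
  have hc : -(2 * Complex.I) / ((α + 1 : ℝ) : ℂ) ≠ 0 :=
    div_ne_zero (neg_ne_zero.2 (mul_ne_zero two_ne_zero Complex.I_ne_zero)) hα0
  have hint' := hint.const_mul (-(2 * Complex.I) / ((α + 1 : ℝ) : ℂ))⁻¹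
  simp only [inv_mul_cancel_left₀ hc] at hint'
  rw [hgr.tubePartialLast_tubeModProj hα le_rfl h0α (by norm_num) ENNReal.toReal_nonneg hx,
    integral_tubeWeighted]
  simp only [hfun]
  rw [integral_const_mul, integral_tube_reproducing (by linarith)
    (differentiableOn_tubePartialLast hg.1.1) hx hint']
  have h := congrArg (fun r : ℝ => (r : ℂ)) (reproducing_constant m hα)
  simp only [Complex.ofReal_mul] at h
  have hI := Complex.I_sq
  rw [Complex.ofReal_mul (fibreConst m (α + 1))]
  calc _ = -(Complex.I ^ 2) / ((α + 1 : ℝ) : ℂ) * (kernelConst m α * kernelExp m α *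
        (fibreConst m (α + 1) * ((4 * Real.pi / (α + 1 + m + 1) : ℝ) : ℂ))) *
          tubePartialLast g x := by ring
    _ = _ := by rw [h, hI]; field_simp

end BlochProjection

theorem theoremC (m : ℕ) (α : ℝ) (hα : -1 < α) :
    -- for `f ∈ L^∞(T_B)` the integral converges absolutely on `T_B`, and `P̃_α f ∈ 𝓑̃`
    (∀ f : CSpace m → ℂ, MemLp f ∞ (tubeVolume m) →
      (∀ z ∈ tubeDomain m,
        Integrable (fun w => tubeModKernel α z w * f w) (tubeWeighted m α)) ∧
      IsTubeBlochZero (tubeModProj α f)) ∧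
    -- `P̃_α` is linear on `L^∞(T_B)`
    (∀ (a : ℂ) (f g : CSpace m → ℂ), MemLp f ∞ (tubeVolume m) → MemLp g ∞ (tubeVolume m) →
      ∀ z ∈ tubeDomain m,
        tubeModProj α (fun w => a * f w + g w) z = a * tubeModProj α f z + tubeModProj α g z) ∧
    -- `P̃_α` is bounded
    (∃ C : ℝ, ∀ f : CSpace m → ℂ, MemLp f ∞ (tubeVolume m) →
      tubeBlochNorm (tubeModProj α f) ≤ C * (eLpNorm f ∞ (tubeVolume m)).toReal) ∧
    -- `P̃_α` maps `L^∞(T_B)` onto `𝓑̃`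
    (∀ g : CSpace m → ℂ, IsTubeBlochZero g →
      ∃ f : CSpace m → ℂ, MemLp f ∞ (tubeVolume m) ∧
        ∀ z ∈ tubeDomain m, tubeModProj α f z = g z) ∧
    -- `P̃_α` is a projection: it fixes every element of `𝓑̃`, by an absolutely convergent integral
    (∀ g : CSpace m → ℂ, IsTubeBlochZero g → ∀ z ∈ tubeDomain m,
      Integrable (fun w => tubeModKernel α z w * g w) (tubeWeighted m α) ∧
        tubeModProj α g z = g z) := by
  have hint : ∀ f : CSpace m → ℂ, MemLp f ∞ (tubeVolume m) → ∀ z ∈ tubeDomain m,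
      Integrable (fun w => tubeModKernel α z w * f w) (tubeWeighted m α) := fun f hf z hz =>
    (hasTubeGrowth_of_memLp hf).integrable_tubeModKernel_mul hα le_rfl (by linarith)
      (by norm_num) ENNReal.toReal_nonneg hz
  obtain ⟨K, -, hK⟩ := exists_tubeInvGrad_tubeModProj_le m hα
  refine ⟨fun f hf => ⟨hint f hf, ⟨⟨?_, ?_⟩, tubeModProj_tubeBase α f⟩⟩, ?_, ⟨K, ?_⟩,
    fun g hg => ⟨blochPreimage α g, memLp_blochPreimage hα hg.1,
      fun z hz => tubeModProj_blochPreimage hα hg hz⟩,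
    fun g hg z hz => tubeModProj_eq_self hα hg hz⟩
  · exact (hasTubeGrowth_of_memLp hf).differentiableOn_tubeModProj hα le_rfl (by linarith)
      (by norm_num) ENNReal.toReal_nonneg
  · refine ⟨K * (eLpNorm f ∞ (tubeVolume m)).toReal, ?_⟩
    rintro _ ⟨z, hz, rfl⟩
    exact hK f hf z hz
  · intro a f g hf hg z hz
    simp only [tubeModProj]
    rw [← integral_const_mul, ← integral_add ((hint f hf z hz).const_mul a) (hint g hg z hz)]
    congr 1; funext w; ring
  · intro f hf
    refine csSup_le ⟨_, tubeBase m, tubeBase_mem, rfl⟩ ?_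
    rintro _ ⟨z, hz, rfl⟩
    exact hK f hf z hz
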